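/- Let $M$ be a closed (compact, Hausdorff, boundaryless, not necessarily orientable) smooth $n$-manifold with a smooth Riemannian metric $g$, let $f\in C^\infty(M)$ and $t\in\mathbb R$. Let $\Omega^q(M)$ be the smooth $q$-forms, let $g$ also denote the induced inner product on $\Lambda^qT_x^*M$ (for which the products $e^{i_1}\wedge\dots\wedge e^{i_q}$, $i_1<\dots<i_q$, of an orthonormal coframe are orthonormal), and put $(\alpha,\beta)=\int_M g(\alpha,\beta)\,dv_g$ with $dv_g$ the Riemannian density. Let $d$ be the exterior derivative and $d_t=e^{-tf}\,d\,e^{tf}:\Omega^q(M)\to\Omega^{q+1}(M)$; let $d^*$, $d_t^*$ be their formal adjoints for $(\cdot,\cdot)$, and let $\Delta=dd^*+d^*d$ and $\Delta_t=d_td_t^*+d_t^*d_t$ be the Hodge and the Witten Laplacian. For a covector $\alpha$ let $\alpha\lrcorner$ be the interior product with the vector $\alpha^\sharp$ metrically dual to $\alpha$ (zero on $0$-forms), and let $\mathrm{Hess}_f=\nabla df$ with $\nabla$ the Levi-Civita connection. **Theorem (Bochner type formula).** The formal adjoints $d^*$ and $d_t^*$ exist on smooth forms, with smooth values, and $d_t=d+t\,df\wedge$,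 $d_t^*=d^*+t\,df\lrcorner$. For every $q$, every $\omega\in\Omega^q(M)$, every $x\in M$ and every basis $(e_k)$ of $T_xM$ with dual basis $(e^k)$ (in particular the coordinate basis $e_k=\partial_k$, $e^k=dx_k$ of any chart at $x$), $$\Delta_t\omega=\Delta\omega+t^2|df|^2\,\omega+t\sum_{k,l}\mathrm{Hess}_f(e_l,e_k)\,[e^l\wedge,\,e^k\lrcorner]\,\omega\quad\text{at }x,$$ where $|df|^2=g(df,df)$ and $[e^l\wedge,e^k\lrcorner]=e^l\wedge e^k\lrcorner-e^k\lrcorner e^l\wedge$. (If $(e_k)$ is orthonormal, $e^k\lrcorner$ is the interior product with $e_k$.) -/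

import Mathlib

open scoped Manifold ContDiff Nat

noncomputable section

namespace Witten

/-! ### Pointwise exterior algebra -/

section Pointwise

variable {V : Type*} [AddCommGroup V] [Module ℝ V] [TopologicalSpace V]

/-- The exterior product `α ∧ η` of a covector and an alternating `q`-form:
`(α ∧ η)(v₀, …, v_q) = ∑ i, (-1)^i α(v_i) η(v₀, …, v̂_i, …, v_q)`. -/
def wedge {q : ℕ} (α : V →L[ℝ] ℝ) (η : V [⋀^Fin q]→L[ℝ] ℝ) : V [⋀^Fin (q + 1)]→L[ℝ] ℝ :=
  { AlternatingMap.alternatizeUncurryFin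
      ((α : V →ₗ[ℝ] ℝ).smulRight η.toAlternatingMap) with
    cont := by
      have h : ∀ v : Fin (q + 1) → V, AlternatingMap.alternatizeUncurryFin
          ((α : V →ₗ[ℝ] ℝ).smulRight η.toAlternatingMap) v =
          ∑ i : Fin (q + 1), (-1) ^ (i : ℕ) * (α (v i) * η (i.removeNth v)) := by
        intro v
        simp [AlternatingMap.alternatizeUncurryFin_apply]
      change Continuous fun v => AlternatingMap.alternatizeUncurryFin
          ((α : V →ₗ[ℝ] ℝ).smulRight η.toAlternatingMap) v
      simp only [h]
      refine continuous_finsetSum _ fun i _ => continuous_const.mul (Continuous.mul ?_ ?_)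
      · exact α.continuous.comp (continuous_apply i)
      · exact η.cont.comp (continuous_pi fun j => continuous_apply _) }

theorem wedge_apply {q : ℕ} (α : V →L[ℝ] ℝ) (η : V [⋀^Fin q]→L[ℝ] ℝ) (v : Fin (q + 1) → V) :
    wedge α η v = ∑ i : Fin (q + 1), (-1) ^ (i : ℕ) * (α (v i) * η (i.removeNth v)) := by
  change AlternatingMap.alternatizeUncurryFin
    ((α : V →ₗ[ℝ] ℝ).smulRight η.toAlternatingMap) v = _
  simp [AlternatingMap.alternatizeUncurryFin_apply]

/-- The interior product with a vector: `(ι_v η)(v₁, …, v_q) = η(v, v₁, …, v_q)`. -/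
def interior {q : ℕ} (v : V) (η : V [⋀^Fin (q + 1)]→L[ℝ] ℝ) : V [⋀^Fin q]→L[ℝ] ℝ :=
  { η.toAlternatingMap.curryLeft v with
    cont := by
      change Continuous fun m : Fin q → V => η (Matrix.vecCons v m)
      exact η.cont.comp (Continuous.matrixVecCons continuous_const continuous_id) }

theorem interior_apply {q : ℕ} (v : V) (η : V [⋀^Fin (q + 1)]→L[ℝ] ℝ) (m : Fin q → V) :
    interior v η m = η (Matrix.vecCons v m) := rfl

/-- The commutator `[α ∧, ι_v] = α ∧ ι_v - ι_v (α ∧ ·)` on `q`-forms; the interior product vanishes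
on `0`-forms. -/
def commWedgeInterior (α : V →L[ℝ] ℝ) (v : V) :
    {q : ℕ} → V [⋀^Fin q]→L[ℝ] ℝ → V [⋀^Fin q]→L[ℝ] ℝ
  | 0, η => -interior v (wedge α η)
  | _ + 1, η => wedge α (interior v η) - interior v (wedge α η)

end Pointwise

/-! ### Differential forms on a manifold -/

section Forms

variable {n : ℕ} {M : Type*} [TopologicalSpace M] [ChartedSpace (EuclideanSpace ℝ (Fin n)) M]

/-- The type of (not necessarily smooth) differential `q`-forms on `M`. -/
abbrev DiffForm (n : ℕ) (M : Type*) [TopologicalSpace M]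
    [ChartedSpace (EuclideanSpace ℝ (Fin n)) M] (q : ℕ) : Type _ :=
  (x : M) → TangentSpace (𝓡 n) x [⋀^Fin q]→L[ℝ] ℝ

/-- Smoothness of a `q`-form, as a section of the bundle of alternating forms. -/
def IsSmoothForm [IsManifold (𝓡 n) ∞ M] {q : ℕ} (η : DiffForm n M q) : Prop :=
  ContMDiff (𝓡 n) ((𝓡 n).prod 𝓘(ℝ, EuclideanSpace ℝ (Fin n) [⋀^Fin q]→L[ℝ] ℝ)) ∞
    (fun x => Bundle.TotalSpace.mk' (EuclideanSpace ℝ (Fin n) [⋀^Fin q]→L[ℝ] ℝ)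
      (E := fun x : M => TangentSpace (𝓡 n) x [⋀^Fin q]→L[ℝ] Bundle.Trivial M ℝ x) x (η x))

/-- The derivative at `y` of the inverse of the preferred chart at `x₀`. -/
def chartInvDeriv (x₀ : M) (y : EuclideanSpace ℝ (Fin n)) :
    EuclideanSpace ℝ (Fin n) →L[ℝ] TangentSpace (𝓡 n) ((extChartAt (𝓡 n) x₀).symm y) :=
  @mfderiv ℝ _ _ _ _ _ _ 𝓘(ℝ, EuclideanSpace ℝ (Fin n)) _ _ (chartedSpaceSelf _)
    _ _ _ _ _ (𝓡 n) M _ _ (extChartAt (𝓡 n) x₀).symm y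

/-- The derivative at `x` of the preferred chart at `x`. -/
def chartDeriv (x : M) : TangentSpace (𝓡 n) x →L[ℝ] EuclideanSpace ℝ (Fin n) :=
  mvfderiv (𝓡 n) (extChartAt (𝓡 n) x) x

/-- The `i`-th coordinate vector `∂_i`, at the point with coordinates `y` in the chart at `x₀`. -/
def coordVec (x₀ : M) (y : EuclideanSpace ℝ (Fin n)) (i : Fin n) :
    TangentSpace (𝓡 n) ((extChartAt (𝓡 n) x₀).symm y) :=
  chartInvDeriv x₀ y (EuclideanSpace.single i 1)

/-- The expression of a form in the preferred chart at `x₀`: its pullback by the inverse chart. -/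
def localForm {q : ℕ} (x₀ : M) (η : DiffForm n M q) (y : EuclideanSpace ℝ (Fin n)) :
    EuclideanSpace ℝ (Fin n) [⋀^Fin q]→L[ℝ] ℝ :=
  (η ((extChartAt (𝓡 n) x₀).symm y)).compContinuousLinearMap (chartInvDeriv x₀ y)

/-- The exterior derivative: the exterior derivative of the form read in a chart around the point,
pulled back to the manifold. -/
def extD {q : ℕ} (η : DiffForm n M q) : DiffForm n M (q + 1) := fun x =>
  (extDeriv (localForm x η) (extChartAt (𝓡 n) x x)).compContinuousLinearMap (chartDeriv x)

/-- The deformed exterior derivative `d_t = e^{-tf} d e^{tf}`. -/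
def wittenD (f : M → ℝ) (t : ℝ) {q : ℕ} (η : DiffForm n M q) : DiffForm n M (q + 1) := fun x =>
  Real.exp (-(t * f x)) • extD (fun y => Real.exp (t * f y) • η y) x

end Forms

/-! ### Riemannian geometry -/

section Metric

variable {n : ℕ} {M : Type*} [TopologicalSpace M] [ChartedSpace (EuclideanSpace ℝ (Fin n)) M]
  [IsManifold (𝓡 n) ∞ M]

/-- Smooth Riemannian metrics on `M`. -/
abbrev RMetric (n : ℕ) (M : Type*) [TopologicalSpace M]
    [ChartedSpace (EuclideanSpace ℝ (Fin n)) M] [IsManifold (𝓡 n) ∞ M] : Type _ :=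
  Bundle.ContMDiffRiemannianMetric (𝓡 n) ∞ (EuclideanSpace ℝ (Fin n))
    (fun x : M => TangentSpace (𝓡 n) x)

instance (x : M) : FiniteDimensional ℝ (TangentSpace (𝓡 n) x) :=
  inferInstanceAs (FiniteDimensional ℝ (EuclideanSpace ℝ (Fin n)))

instance (x : M) : T2Space (TangentSpace (𝓡 n) x) :=
  inferInstanceAs (T2Space (EuclideanSpace ℝ (Fin n)))

variable (g : RMetric n M)

/-- The metric at `x` as a bilinear form. -/
def bilin (x : M) : LinearMap.BilinForm ℝ (TangentSpace (𝓡 n) x) :=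
  ContinuousLinearMap.coeLM ℝ ∘ₗ (g.inner x : TangentSpace (𝓡 n) x →ₗ[ℝ] _)

@[simp]
theorem bilin_apply (x : M) (v w : TangentSpace (𝓡 n) x) : bilin g x v w = g.inner x v w := rfl

theorem bilin_nondegenerate (x : M) : (bilin g x).Nondegenerate := by
  constructor
  · intro v hv
    by_contra h
    exact (g.pos x v h).ne' (hv v)
  · intro v hv
    by_contra h
    exact (g.pos x v h).ne' (hv v)

/-- The vector `α♯` metrically dual to the covector `α`: `g(α♯, v) = α(v)` for all `v`. -/
def sharp (x : M) (α : TangentSpace (𝓡 n) x →L[ℝ] ℝ) : TangentSpace (𝓡 n) x :=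
  ((bilin g x).toDual (bilin_nondegenerate g x)).symm (α : TangentSpace (𝓡 n) x →ₗ[ℝ] ℝ)

theorem inner_sharp (x : M) (α : TangentSpace (𝓡 n) x →L[ℝ] ℝ) (v : TangentSpace (𝓡 n) x) :
    g.inner x (sharp g x α) v = α v :=
  LinearMap.BilinForm.apply_toDual_symm_apply (B := bilin g x)
    (hB := bilin_nondegenerate g x) (α : TangentSpace (𝓡 n) x →ₗ[ℝ] ℝ) v

/-- The metric induced on covectors. -/
def cometric (x : M) (α β : TangentSpace (𝓡 n) x →L[ℝ] ℝ) : ℝ :=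
  g.inner x (sharp g x α) (sharp g x β)

/-- The `k`-th element of the basis of the cotangent space dual to `b`. -/
def dualCovector {x : M} (b : Module.Basis (Fin n) ℝ (TangentSpace (𝓡 n) x)) (k : Fin n) :
    TangentSpace (𝓡 n) x →L[ℝ] ℝ :=
  LinearMap.toContinuousLinearMap (b.coord k)

/-- For an orthonormal basis `b`, contraction with the covector `b^k` is the interior product
with `b_k`. -/
theorem sharp_dualCovector_of_orthonormal {x : M}
    (b : Module.Basis (Fin n) ℝ (TangentSpace (𝓡 n) x))
    (hb : ∀ i j, g.inner x (b i) (b j) = if i = j then 1 else 0) (k : Fin n) :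
    sharp g x (dualCovector b k) = b k := by
  have h : (bilin g x).toDual (bilin_nondegenerate g x) (b k) = b.coord k := by
    refine b.ext fun j => ?_
    rw [LinearMap.BilinForm.toDual_def, bilin_apply, hb, Module.Basis.coord_apply,
      Module.Basis.repr_self, Finsupp.single_apply]
    simp [eq_comm]
  unfold sharp dualCovector
  rw [LinearEquiv.symm_apply_eq, h]
  rfl

/-- The standard basis of `ℝⁿ` as a basis of the tangent space at `x`: it consists of the coordinate
vectors of the preferred chart at `x`. -/
def stdBasis (x : M) : Module.Basis (Fin n) ℝ (TangentSpace (𝓡 n) x) :=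
  (EuclideanSpace.basisFun (Fin n) ℝ).toBasis

/-- The inner product on alternating `q`-forms on the tangent space,
`(1/q!) ∑ g^{i₁j₁} ⋯ g^{i_qj_q} α_{i₁…i_q} β_{j₁…j_q}`; the factor `1/q!` is the normalization for
which the products `e^{i₁} ∧ ⋯ ∧ e^{i_q}`, `i₁ < ⋯ < i_q`, of an orthonormal basis of covectors are
orthonormal. -/
def formInner (x : M) {q : ℕ} (α β : TangentSpace (𝓡 n) x [⋀^Fin q]→L[ℝ] ℝ) : ℝ :=
  ((q ! : ℕ) : ℝ)⁻¹ * ∑ i : Fin q → Fin n, ∑ j : Fin q → Fin n,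
    (∏ a, cometric g x (dualCovector (stdBasis x) (i a)) (dualCovector (stdBasis x) (j a))) *
      α (fun a => stdBasis x (i a)) * β (fun a => stdBasis x (j a))

/-- The components `g_{ij}` of the metric in the preferred chart at `x₀`. -/
def metricCoeff (x₀ : M) (y : EuclideanSpace ℝ (Fin n)) : Matrix (Fin n) (Fin n) ℝ :=
  Matrix.of fun i j =>
    g.inner ((extChartAt (𝓡 n) x₀).symm y) (coordVec x₀ y i) (coordVec x₀ y j)

/-- The measure `√|det g_{ij}| dy₁ ⋯ dy_n` of the preferred chart at `x₀`, transported to `M`. -/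
def chartVolume [MeasurableSpace M] (x₀ : M) : MeasureTheory.Measure M :=
  ((MeasureTheory.volume.restrict (extChartAt (𝓡 n) x₀).target).withDensity
    (fun y => ENNReal.ofReal (Real.sqrt |(metricCoeff g x₀ y).det|))).map (extChartAt (𝓡 n) x₀).symm

/-- A smooth partition of unity subordinate to the domains of the preferred charts. -/
def chartPartition (n : ℕ) (M : Type*) [TopologicalSpace M]
    [ChartedSpace (EuclideanSpace ℝ (Fin n)) M] [IsManifold (𝓡 n) ∞ M] [T2Space M]
    [SigmaCompactSpace M] : SmoothPartitionOfUnity M (𝓡 n) M Set.univ :=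
  (SmoothPartitionOfUnity.exists_isSubordinate_chartAt_source (𝓡 n) M).choose

/-- The Riemannian volume `dv_g`: the measures of the charts, glued by a partition of unity. -/
def riemVolume [MeasurableSpace M] [T2Space M] [SigmaCompactSpace M] : MeasureTheory.Measure M :=
  MeasureTheory.Measure.sum fun c : M =>
    (chartVolume g c).withDensity fun x => ENNReal.ofReal (chartPartition n M c x)

/-- The global `L²` inner product of two `q`-forms. -/
def l2Inner [MeasurableSpace M] [T2Space M] [SigmaCompactSpace M] {q : ℕ}
    (α β : DiffForm n M q) : ℝ :=
  ∫ x, formInner g x (α x) (β x) ∂(riemVolume g)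

/-- `w` is the value at `v` of the formal adjoint of `D`: it is smooth, and
`(D u, v) = (u, w)` for all smooth `u`. -/
def IsAdjointValue [MeasurableSpace M] [T2Space M] [SigmaCompactSpace M] {q : ℕ}
    (D : DiffForm n M q → DiffForm n M (q + 1)) (v : DiffForm n M (q + 1))
    (w : DiffForm n M q) : Prop :=
  IsSmoothForm w ∧ ∀ u : DiffForm n M q, IsSmoothForm u → l2Inner g (D u) v = l2Inner g u w

/-- `D'` is a formal adjoint of `D` on smooth forms. -/
def IsFormalAdjoint [MeasurableSpace M] [T2Space M] [SigmaCompactSpace M] {q : ℕ}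
    (D : DiffForm n M q → DiffForm n M (q + 1))
    (D' : DiffForm n M (q + 1) → DiffForm n M q) : Prop :=
  ∀ v : DiffForm n M (q + 1), IsSmoothForm v → IsAdjointValue g D v (D' v)

open Classical in
/-- The formal adjoint of `D` with respect to the `L²` inner product (with value `0` at a form
where the adjoint does not exist). -/
def formalAdjoint [MeasurableSpace M] [T2Space M] [SigmaCompactSpace M] {q : ℕ}
    (D : DiffForm n M q → DiffForm n M (q + 1)) (v : DiffForm n M (q + 1)) : DiffForm n M q :=
  if h : ∃ w, IsAdjointValue g D v w then h.choose else 0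

/-- The codifferential `d^*`. -/
def codiff [MeasurableSpace M] [T2Space M] [SigmaCompactSpace M] {q : ℕ}
    (v : DiffForm n M (q + 1)) : DiffForm n M q :=
  formalAdjoint g extD v

/-- The adjoint `d_t^*` of the deformed exterior derivative. -/
def wittenCodiff [MeasurableSpace M] [T2Space M] [SigmaCompactSpace M] (f : M → ℝ) (t : ℝ)
    {q : ℕ} (v : DiffForm n M (q + 1)) : DiffForm n M q :=
  formalAdjoint g (wittenD f t) v

/-- The Hodge Laplacian `Δ = d d^* + d^* d`. -/
def hodgeLaplacian [MeasurableSpace M] [T2Space M] [SigmaCompactSpace M] :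
    {q : ℕ} → DiffForm n M q → DiffForm n M q
  | 0, η => codiff g (extD η)
  | _ + 1, η => extD (codiff g η) + codiff g (extD η)

/-- The Witten Laplacian `Δ_t = d_t d_t^* + d_t^* d_t`. -/
def wittenLaplacian [MeasurableSpace M] [T2Space M] [SigmaCompactSpace M] (f : M → ℝ) (t : ℝ) :
    {q : ℕ} → DiffForm n M q → DiffForm n M q
  | 0, η => wittenCodiff g f t (wittenD f t η)
  | _ + 1, η => wittenD f t (wittenCodiff g f t η) + wittenCodiff g f t (wittenD f t η)

/-- The partial derivative `∂_i h`. -/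
def partialD (i : Fin n) (h : EuclideanSpace ℝ (Fin n) → ℝ) (y : EuclideanSpace ℝ (Fin n)) : ℝ :=
  fderiv ℝ h y (EuclideanSpace.single i 1)

/-- The Christoffel symbols `Γ^l_{ij}` of the Levi-Civita connection in the preferred chart
at `x₀`. -/
def christoffel (x₀ : M) (y : EuclideanSpace ℝ (Fin n)) (l i j : Fin n) : ℝ :=
  (1 / 2) * ∑ m, (metricCoeff g x₀ y)⁻¹ l m *
    (partialD i (fun z => metricCoeff g x₀ z j m) y +
      partialD j (fun z => metricCoeff g x₀ z i m) y -
      partialD m (fun z => metricCoeff g x₀ z i j) y)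

/-- The components of a `1`-form in the preferred chart at `x₀`. -/
def covectorCoeff (x₀ : M) (α : (x : M) → TangentSpace (𝓡 n) x →L[ℝ] ℝ) (j : Fin n)
    (y : EuclideanSpace ℝ (Fin n)) : ℝ :=
  α ((extChartAt (𝓡 n) x₀).symm y) (coordVec x₀ y j)

/-- The Levi-Civita covariant derivative `(∇_v α)(w)` of a `1`-form `α`:
`∑ v_i w_j (∂_i α_j - Γ^l_{ij} α_l)` in a chart around the point. -/
def covDeriv (α : (x : M) → TangentSpace (𝓡 n) x →L[ℝ] ℝ) (x : M)
    (v w : TangentSpace (𝓡 n) x) : ℝ :=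
  ∑ i, ∑ j, chartDeriv x v i * chartDeriv x w j *
    (partialD i (covectorCoeff x α j) (extChartAt (𝓡 n) x x) -
      ∑ l, christoffel g x (extChartAt (𝓡 n) x x) l i j *
        covectorCoeff x α l (extChartAt (𝓡 n) x x))

/-- The Hessian `Hess_f = ∇ df`. -/
def hess (f : M → ℝ) (x : M) (v w : TangentSpace (𝓡 n) x) : ℝ :=
  covDeriv g (mvfderiv (𝓡 n) f) x v w

end Metric

end Witten

end

/-! The second-order identity reduces to the fact that a certain first-order operator plus its
adjoint has order zero. The Leibniz rule gives `d_t = d + t df∧`, and since `ι_{∇f}` is pointwise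
adjoint to `df∧`, `d_t^* = d^* + t ι_{∇f}`. Multiplying out (`wittenLaplacian_eq_lieGrad`), `Δ_t = Δ
+ t (L + L^*) + t² (df∧ ι_{∇f} + ι_{∇f} df∧)`. Here `L = d ι_{∇f} + ι_{∇f} d` is the Lie derivative
along `∇f`, and `L^* = df∧ d^* + d^* df∧` is its formal adjoint. The last bracket is `|df|²` by the
anticommutation relation.

To compute `L + L^*`, work in a chart with metric matrix `G`, inverse `K`, local gradient `X`,
derivative matrix `B = DX` and `N = ∂_X G`. Let `W` be the pointwise inner product of forms times
`√det G`. Cartan's formula gives `L = ∂_X + B·`, where `B·` is the action as a derivation.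
Integration by parts against test forms `ψ α` yields `W(α, L^*η) = W(B·α, η) - div X · W(α, η) - ∂_X
(W(α, η))`. The derivatives of `η` cancel in the sum, leaving `B`, its adjoint, `div X` and the
derivative of `W`. The last is found from Jacobi's formula and `∂_X K = -K N K`. The Christoffel
formula says that the Hessian matrix `H` satisfies `2H = G B + Bᵀ G + N`, that is, `2 Hess_f` is the
Lie derivative of the metric. Everything then collapses to `L + L^* = 2 A· - tr A` with `A = K H`
(`localForm_lieGrad_add_lieGradAdj`). In any basis, `2 A· - tr A` is also `∑ l, [e^l∧, ι_{A e_l}]`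
(`sum_commWedgeInterior`).

No explicit formula for `d^*` is used. Its existence is proved for forms supported in one chart: the
pairing of `du` with `v` is a divergence plus a functional of `u`, which `W` represents by a smooth
form. A partition of unity does the rest (`exists_isAdjointValue_extD`). Uniqueness holds because
the `L²` product is definite on smooth forms, so the choice inside `formalAdjoint` is harmless. All
integrals are taken in charts, by `riemVolume_restrict_source`. -/

noncomputable section
namespace Witten

/-! ### Exterior algebra of a vector space with an inner product -/

section LinearAlgebra

variable {n q : ℕ} {V : Type*} [AddCommGroup V] [Module ℝ V] [TopologicalSpace V]

theorem wedge_compContinuousLinearMap {W : Type*} [AddCommGroup W] [Module ℝ W]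
    [TopologicalSpace W] (T : W →L[ℝ] V) (α : V →L[ℝ] ℝ) (η : V [⋀^Fin q]→L[ℝ] ℝ) :
    (wedge α η).compContinuousLinearMap T =
      wedge (α.comp T) (η.compContinuousLinearMap T) := by
  ext v
  simp only [ContinuousAlternatingMap.compContinuousLinearMap_apply, wedge_apply]
  rfl

theorem interior_compContinuousLinearMap {W : Type*} [AddCommGroup W] [Module ℝ W]
    [TopologicalSpace W] (T : W →L[ℝ] V) (w : W) (η : V [⋀^Fin (q + 1)]→L[ℝ] ℝ) :
    (interior (T w) η).compContinuousLinearMap T =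
      interior w (η.compContinuousLinearMap T) := by
  ext v
  simp only [ContinuousAlternatingMap.compContinuousLinearMap_apply, interior_apply]
  congr 1
  ext i
  refine Fin.cases ?_ (fun j => ?_) i <;> simp

/-- The anticommutation relation `ι_v (α ∧ η) = α(v) η - α ∧ ι_v η`. -/
theorem interior_wedge (α : V →L[ℝ] ℝ) (v : V) (η : V [⋀^Fin (q + 1)]→L[ℝ] ℝ) :
    interior v (wedge α η) = α v • η - wedge α (interior v η) := by
  ext m
  simp only [interior_apply, wedge_apply, ContinuousAlternatingMap.sub_apply,
    ContinuousAlternatingMap.smul_apply, smul_eq_mul]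
  rw [Fin.sum_univ_succ, sub_eq_add_neg, ← Finset.sum_neg_distrib]
  congr 1
  · simp only [Fin.val_zero, pow_zero, one_mul, Matrix.cons_val_zero]
    congr 2
  · refine Finset.sum_congr rfl fun i _ => ?_
    have h : i.succ.removeNth (Matrix.vecCons v m : Fin (q + 2) → V) =
        Matrix.vecCons v (i.removeNth m) := by
      ext j
      refine Fin.cases ?_ (fun j => ?_) j <;> simp [Fin.removeNth]
    rw [h]
    simp [pow_succ]

theorem interior_wedge_zero (α : V →L[ℝ] ℝ) (v : V) (η : V [⋀^Fin 0]→L[ℝ] ℝ) :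
    interior v (wedge α η) = α v • η := by
  ext m
  simp only [interior_apply, wedge_apply, ContinuousAlternatingMap.smul_apply, smul_eq_mul]
  simp only [Fin.sum_univ_succ, Fin.sum_univ_zero]
  simp

theorem wedge_add (α : V →L[ℝ] ℝ) (η ξ : V [⋀^Fin q]→L[ℝ] ℝ) :
    wedge α (η + ξ) = wedge α η + wedge α ξ := by
  ext v
  simp [wedge_apply, mul_add, Finset.sum_add_distrib]

theorem wedge_smul (α : V →L[ℝ] ℝ) (a : ℝ) (η : V [⋀^Fin q]→L[ℝ] ℝ) :
    wedge α (a • η) = a • wedge α η := by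
  ext v
  simp only [wedge_apply, ContinuousAlternatingMap.smul_apply, smul_eq_mul, Finset.mul_sum]
  exact Finset.sum_congr rfl fun i _ => by ring

theorem smul_wedge (α : V →L[ℝ] ℝ) (a : ℝ) (η : V [⋀^Fin q]→L[ℝ] ℝ) :
    wedge (a • α) η = a • wedge α η := by
  ext v
  simp only [wedge_apply, ContinuousAlternatingMap.smul_apply, smul_eq_mul, Finset.mul_sum,
    FunLike.coe_smul, Pi.smul_apply]
  exact Finset.sum_congr rfl fun i _ => by ring

theorem interior_add (v : V) (η ξ : V [⋀^Fin (q + 1)]→L[ℝ] ℝ) :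
    interior v (η + ξ) = interior v η + interior v ξ := by
  ext m
  simp [interior_apply]

theorem interior_smul (v : V) (a : ℝ) (η : V [⋀^Fin (q + 1)]→L[ℝ] ℝ) :
    interior v (a • η) = a • interior v η := by
  ext m
  simp [interior_apply]

/-- Forms that agree on all tuples of basis vectors are equal. -/
theorem form_ext_basis {ι : Type*} (e : Module.Basis ι ℝ V) {α β : V [⋀^Fin q]→L[ℝ] ℝ}
    (h : ∀ I : Fin q → ι, α (fun a => e (I a)) = β (fun a => e (I a))) : α = β := by
  apply ContinuousAlternatingMap.toAlternatingMap_injective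
  apply AlternatingMap.coe_multilinearMap_injective
  exact Module.Basis.ext_multilinear (fun _ => e) h

theorem form_apply_expand {ι : Type*} [Fintype ι] (e : Module.Basis ι ℝ V)
    (α : V [⋀^Fin q]→L[ℝ] ℝ) (v : Fin q → V) :
    α v = ∑ I : Fin q → ι, (∏ a, e.repr (v a) (I a)) * α (fun a => e (I a)) := by
  conv_lhs => rw [show v = fun a => ∑ k, e.repr (v a) k • e k from
    funext fun a => (e.sum_repr (v a)).symm]
  change α.toMultilinearMap _ = _
  classical
  rw [MultilinearMap.map_sum]
  refine Finset.sum_congr rfl fun I _ => ?_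
  rw [MultilinearMap.map_smul_univ]
  rfl

/-- The bilinear form `(1/q!) ∑ K_{i₁j₁} ⋯ K_{i_qj_q} α_{i₁…i_q} β_{j₁…j_q}` on alternating forms,
with components taken with respect to the vectors `e`. -/
def coordInner (K : Matrix (Fin n) (Fin n) ℝ) (e : Fin n → V) (α β : V [⋀^Fin q]→L[ℝ] ℝ) : ℝ :=
  ((q ! : ℕ) : ℝ)⁻¹ * ∑ I : Fin q → Fin n, ∑ J : Fin q → Fin n,
    (∏ a, K (I a) (J a)) * α (fun a => e (I a)) * β (fun a => e (J a))

/-- The Euclidean inner product of the components of alternating forms with respect to the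
vectors `b`. -/
def frameInner (b : Fin n → V) (α β : V [⋀^Fin q]→L[ℝ] ℝ) : ℝ :=
  ((q ! : ℕ) : ℝ)⁻¹ * ∑ I : Fin q → Fin n, α (fun a => b (I a)) * β (fun a => b (I a))

/-- The hypothesis says `K = ∑ m, b_m b_mᵀ` in `e`-coordinates. Expanding each `b (L a)` in the
basis `e` and summing over `L`, the product over slots of the sums over `m` becomes a product of
entries of `K`. This makes the inner product of forms independent of the basis: every expression is
compared with an orthonormal frame. -/
theorem coordInner_eq_frameInner {K : Matrix (Fin n) (Fin n) ℝ} (e : Module.Basis (Fin n) ℝ V)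
    (b : Fin n → V) (hK : ∀ i j, K i j = ∑ m, e.repr (b m) i * e.repr (b m) j)
    (α β : V [⋀^Fin q]→L[ℝ] ℝ) : coordInner K e α β = frameInner b α β := by
  unfold coordInner frameInner
  congr 1
  have h : ∀ L : Fin q → Fin n, α (fun a => b (L a)) * β (fun a => b (L a)) =
      ∑ I : Fin q → Fin n, ∑ J : Fin q → Fin n,
        (∏ a, (e.repr (b (L a)) (I a) * e.repr (b (L a)) (J a))) *
          α (fun a => e (I a)) * β (fun a => e (J a)) := by
    intro L
    rw [form_apply_expand e α, form_apply_expand e β, Finset.sum_mul_sum]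
    refine Finset.sum_congr rfl fun I _ => Finset.sum_congr rfl fun J _ => ?_
    rw [Finset.prod_mul_distrib]
    ring
  simp_rw [h]
  symm
  rw [Finset.sum_comm]
  refine Finset.sum_congr rfl fun I _ => ?_
  rw [Finset.sum_comm]
  refine Finset.sum_congr rfl fun J _ => ?_
  rw [← Finset.sum_mul, ← Finset.sum_mul]
  congr 2
  rw [Finset.prod_congr rfl fun a _ => hK (I a) (J a), Finset.prod_univ_sum,
    Fintype.piFinset_univ]

theorem frameInner_self_nonneg (b : Fin n → V) (α : V [⋀^Fin q]→L[ℝ] ℝ) :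
    0 ≤ frameInner b α α :=
  mul_nonneg (by positivity) (Finset.sum_nonneg fun _ _ => mul_self_nonneg _)

theorem frameInner_self_eq_zero (b : Module.Basis (Fin n) ℝ V) {α : V [⋀^Fin q]→L[ℝ] ℝ}
    (h : frameInner b α α = 0) : α = 0 := by
  have hq : ((q ! : ℕ) : ℝ)⁻¹ ≠ 0 := inv_ne_zero (by exact_mod_cast q.factorial_ne_zero)
  have h0 := (mul_eq_zero.1 h).resolve_left hq
  rw [Finset.sum_eq_zero_iff_of_nonneg fun _ _ => mul_self_nonneg _] at h0
  exact form_ext_basis b fun I => by simpa using h0 I (Finset.mem_univ _)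

/-- Moving an entry from the front to slot `i` takes `i` adjacent transpositions. -/
theorem form_apply_cons_removeNth (η : V [⋀^Fin (q + 1)]→L[ℝ] ℝ) (i : Fin (q + 1)) (z : V)
    (v : Fin (q + 1) → V) :
    (-1) ^ (i : ℕ) * η (Matrix.vecCons z (i.removeNth v)) = η (Function.update v i z) := by
  have h := AlternatingMap.map_insertNth η.toAlternatingMap i z (i.removeNth v)
  rw [Fin.insertNth_removeNth] at h
  simpa using h.symm

/-- The interior product with a vector is adjoint to the exterior product with the dual covector. -/
theorem frameInner_wedge (b : Module.Basis (Fin n) ℝ V) (α : V →L[ℝ] ℝ) (X : V)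
    (hX : X = ∑ k, α (b k) • b k) (u : V [⋀^Fin q]→L[ℝ] ℝ) (v : V [⋀^Fin (q + 1)]→L[ℝ] ℝ) :
    frameInner b (wedge α u) v = frameInner b u (interior X v) := by
  -- A multi-index of length `q + 1` splits into its entry `k` at slot `i` and the remaining `J`.
  -- The sum over `k` assembles `X`, and the two signs `(-1)^i` cancel, so the result does not
  -- depend on `i`.
  have key : ∀ i : Fin (q + 1), ∑ I : Fin (q + 1) → Fin n,
      (-1) ^ (i : ℕ) * (α (b (I i)) * u (i.removeNth fun a => b (I a))) * v (fun a => b (I a)) =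
      ∑ J : Fin q → Fin n, u (fun a => b (J a)) * interior X v (fun a => b (J a)) := by
    intro i
    rw [← (Fin.insertNthEquiv (fun _ => Fin n) i).sum_comp, Fintype.sum_prod_type,
      Finset.sum_comm]
    refine Finset.sum_congr rfl fun J _ => ?_
    have hi : interior X v (fun a => b (J a)) =
        ∑ k, α (b k) * v (Matrix.vecCons (b k) fun a => b (J a)) := by
      rw [interior_apply, hX]
      let L : V →ₗ[ℝ] ℝ :=
        { toFun := fun z => v (Matrix.vecCons z fun a => b (J a))
          map_add' := fun x y => DFunLike.congr_fun (map_add v.toAlternatingMap.curryLeft x y) _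
          map_smul' := fun c x => DFunLike.congr_fun (map_smul v.toAlternatingMap.curryLeft c x) _ }
      change L _ = ∑ k, α (b k) * L (b k)
      simp
    rw [hi, Finset.mul_sum]
    refine Finset.sum_congr rfl fun k _ => ?_
    have h1 := form_apply_cons_removeNth v i (b k)
      (fun a => b (Fin.insertNth (α := fun _ => Fin n) i k J a))
    have h2 : (i.removeNth fun a => b (Fin.insertNth (α := fun _ => Fin n) i k J a)) =
        fun a => b (J a) := by
      ext a
      simp [Fin.removeNth]
    have h3 : Function.update (fun a => b (Fin.insertNth (α := fun _ => Fin n) i k J a)) i (b k) =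
        fun a => b (Fin.insertNth (α := fun _ => Fin n) i k J a) := by
      rw [Function.update_eq_self_iff]
      simp
    rw [h2, h3] at h1
    simp only [Fin.insertNthEquiv_apply, Fin.insertNth_apply_same]
    rw [h2, ← h1]
    have h4 : ((-1 : ℝ) ^ (i : ℕ)) * (-1) ^ (i : ℕ) = 1 := by
      rw [← mul_pow]; simp
    linear_combination (α (b k) * u (fun a => b (J a)) * v (Matrix.vecCons (b k) fun a => b (J a))) * h4
  unfold frameInner
  simp_rw [wedge_apply, Finset.sum_mul]
  rw [Finset.sum_comm]
  simp_rw [key]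
  -- There are `q + 1` equal contributions, which turn `1/(q+1)!` into `1/q!`.
  rw [Finset.sum_const, Finset.card_univ, Fintype.card_fin, Nat.factorial_succ]
  have hq : ((q ! : ℕ) : ℝ) ≠ 0 := by exact_mod_cast q.factorial_ne_zero
  have hq' : ((q : ℝ) + 1) ≠ 0 := by positivity
  rw [nsmul_eq_mul]
  push_cast
  field_simp

/-- A symmetric positive definite bilinear form has an orthonormal basis. -/
theorem exists_orthonormal_basis {V : Type*} [AddCommGroup V] [Module ℝ V]
    [FiniteDimensional ℝ V] (hn : Module.finrank ℝ V = n) (B : LinearMap.BilinForm ℝ V)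
    (hs : ∀ v w, B v w = B w v) (hp : ∀ v, v ≠ 0 → 0 < B v v) :
    ∃ b : Module.Basis (Fin n) ℝ V, ∀ i j, B (b i) (b j) = if i = j then 1 else 0 := by
  let core : InnerProductSpace.Core ℝ V :=
    { inner := fun v w => B v w
      conj_inner_symm := fun v w => by simp [hs v w]
      re_inner_nonneg := fun v => by
        by_cases h : v = 0
        · simp [h]
        · simpa using (hp v h).le
      add_left := fun u v w => by simp
      smul_left := fun u v r => by simp
      definite := fun v hv => by
        by_contra h
        exact (hp v h).ne' hv }
  let _ : NormedAddCommGroup V := core.toNormedAddCommGroup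
  let _ : InnerProductSpace ℝ V := InnerProductSpace.ofCore core.toCore
  subst hn
  let b := stdOrthonormalBasis ℝ V
  refine ⟨b.toBasis, fun i j => ?_⟩
  rw [b.coe_toBasis]
  exact orthonormal_iff_ite.1 b.orthonormal i j

end LinearAlgebra

end Witten
end

noncomputable section
namespace Witten

/-! ### Endomorphisms acting on forms as derivations -/

section Derivation

variable {n q : ℕ} {E : Type*} [NormedAddCommGroup E] [NormedSpace ℝ E]

/-- The action of an endomorphism on alternating forms as a derivation:
`(A · η)(v₁, …, v_q) = ∑ i, η(v₁, …, A v_i, …, v_q)`. -/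
def derivAct (A : E →L[ℝ] E) (η : E [⋀^Fin q]→L[ℝ] ℝ) : E [⋀^Fin q]→L[ℝ] ℝ :=
  η.fderivCompContinuousLinearMap (ContinuousLinearMap.id ℝ E) A

theorem derivAct_apply (A : E →L[ℝ] E) (η : E [⋀^Fin q]→L[ℝ] ℝ) (v : Fin q → E) :
    derivAct A η v = ∑ i, η (Function.update v i (A (v i))) := by
  rw [derivAct, ContinuousAlternatingMap.fderivCompContinuousLinearMap_apply]
  refine Finset.sum_congr rfl fun i _ => ?_
  congr 1
  ext1 j
  rcases eq_or_ne j i with rfl | h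
  · simp
  · simp [h]

theorem derivAct_apply_succ (A : E →L[ℝ] E) (η : E [⋀^Fin (q + 1)]→L[ℝ] ℝ)
    (v : Fin (q + 1) → E) :
    derivAct A η v =
      ∑ i : Fin (q + 1), (-1) ^ (i : ℕ) * η (Matrix.vecCons (A (v i)) (i.removeNth v)) := by
  rw [derivAct_apply]
  exact Finset.sum_congr rfl fun i _ => (form_apply_cons_removeNth η i _ v).symm

/-- Evaluated on `v`, slot `i` receives `∑ l, β l (v i) • A (b l)`, which is `A (v i)` because `β`
is the dual basis. -/
theorem sum_wedge_interior (A : E →L[ℝ] E) (b : Module.Basis (Fin n) ℝ E)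
    (β : Fin n → E →L[ℝ] ℝ) (hβ : ∀ k v, β k v = b.repr v k) (η : E [⋀^Fin (q + 1)]→L[ℝ] ℝ) :
    ∑ l, wedge (β l) (interior (A (b l)) η) = derivAct A η := by
  ext v
  rw [derivAct_apply_succ, ContinuousAlternatingMap.sum_apply]
  simp_rw [wedge_apply, interior_apply]
  rw [Finset.sum_comm]
  refine Finset.sum_congr rfl fun i _ => ?_
  rw [← Finset.mul_sum]
  congr 1
  let L : E →ₗ[ℝ] ℝ :=
    { toFun := fun z => η (Matrix.vecCons z (i.removeNth v))
      map_add' := fun x y => DFunLike.congr_fun (map_add η.toAlternatingMap.curryLeft x y) _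
      map_smul' := fun c x => DFunLike.congr_fun (map_smul η.toAlternatingMap.curryLeft c x) _ }
  change ∑ l, β l (v i) * L (A (b l)) = L (A (v i))
  have h := congrArg (fun z => L (A z)) (b.sum_repr (v i))
  simp only [map_sum, map_smul, smul_eq_mul] at h
  simp only [hβ, h]

/-- By anticommutation each commutator is `2 β^l ∧ ι_{A b_l} - β^l(A b_l)`. The first terms add up
to the derivation and the second to the trace. The right-hand side contains no basis, which is why
the final formula holds in every basis. -/
theorem sum_commWedgeInterior (A : E →L[ℝ] E) (b : Module.Basis (Fin n) ℝ E)
    (β : Fin n → E →L[ℝ] ℝ) (hβ : ∀ k v, β k v = b.repr v k) (η : E [⋀^Fin q]→L[ℝ] ℝ) :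
    ∑ l, commWedgeInterior (β l) (A (b l)) η =
      (2 : ℝ) • derivAct A η - LinearMap.trace ℝ E A • η := by
  have ht : LinearMap.trace ℝ E A = ∑ l, β l (A (b l)) := by
    rw [LinearMap.trace_eq_matrix_trace ℝ b, Matrix.trace]
    simp [LinearMap.toMatrix_apply, hβ]
  cases q with
  | zero =>
    have h : derivAct A η = 0 := by
      ext v
      simp [derivAct_apply]
    simp only [commWedgeInterior, interior_wedge_zero]
    rw [h, ht, Finset.sum_neg_distrib, ← Finset.sum_smul]
    simp
  | succ q =>
    simp only [commWedgeInterior, interior_wedge]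
    rw [← sum_wedge_interior A b β hβ η, ht, Finset.sum_smul, Finset.smul_sum,
      ← Finset.sum_sub_distrib]
    exact Finset.sum_congr rfl fun l _ => by rw [two_smul]; abel

/-- `commWedgeInterior` is additive in the vector. -/
theorem commWedgeInterior_sum {ι : Type*} (s : Finset ι) (α : E →L[ℝ] ℝ) (v : ι → E)
    (a : ι → ℝ) (η : E [⋀^Fin q]→L[ℝ] ℝ) :
    ∑ k ∈ s, a k • commWedgeInterior α (v k) η =
      commWedgeInterior α (∑ k ∈ s, a k • v k) η := by
  have hadd : ∀ {p : ℕ} (ξ : E [⋀^Fin (p + 1)]→L[ℝ] ℝ),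
      interior (∑ k ∈ s, a k • v k) ξ = ∑ k ∈ s, a k • interior (v k) ξ := by
    intro p ξ
    ext m
    let L : E →ₗ[ℝ] ℝ :=
      { toFun := fun z => ξ (Matrix.vecCons z m)
        map_add' := fun x y => DFunLike.congr_fun (map_add ξ.toAlternatingMap.curryLeft x y) _
        map_smul' := fun c x => DFunLike.congr_fun (map_smul ξ.toAlternatingMap.curryLeft c x) _ }
    rw [ContinuousAlternatingMap.sum_apply]
    change L (∑ k ∈ s, a k • v k) = ∑ k ∈ s, a k * L (v k)
    simp
  cases q with
  | zero =>
    simp only [commWedgeInterior, hadd, smul_neg, Finset.sum_neg_distrib]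
  | succ q =>
    have hw : wedge α (∑ k ∈ s, a k • interior (v k) η) =
        ∑ k ∈ s, a k • wedge α (interior (v k) η) := by
      clear hadd
      classical
      induction s using Finset.induction_on with
      | empty =>
        ext m
        simp [wedge_apply]
      | insert k s hk ih => simp [hk, wedge_add, wedge_smul, ih]
    simp only [commWedgeInterior, hadd, hw, smul_sub, Finset.sum_sub_distrib]

/-- The derivative of `coordInner` with respect to the matrix, in the direction `N`. -/
def coordInnerDeriv (K N : Matrix (Fin n) (Fin n) ℝ) (e : Fin n → E)
    (α β : E [⋀^Fin q]→L[ℝ] ℝ) : ℝ :=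
  ((q ! : ℕ) : ℝ)⁻¹ * ∑ I : Fin q → Fin n, ∑ J : Fin q → Fin n,
    (∑ a, (∏ b ∈ Finset.univ.erase a, K (I b) (J b)) * N (I a) (J a)) *
      α (fun a => e (I a)) * β (fun a => e (J a))

theorem hasDerivAt_coordInner {K : ℝ → Matrix (Fin n) (Fin n) ℝ} {N : Matrix (Fin n) (Fin n) ℝ}
    {s : ℝ} (hK : ∀ i j, HasDerivAt (fun r => K r i j) (N i j) s) (e : Fin n → E)
    (α β : E [⋀^Fin q]→L[ℝ] ℝ) :
    HasDerivAt (fun r => coordInner (K r) e α β) (coordInnerDeriv (K s) N e α β) s := by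
  unfold coordInner coordInnerDeriv
  refine HasDerivAt.const_mul _ (HasDerivAt.fun_sum fun I _ => HasDerivAt.fun_sum fun J _ => ?_)
  refine HasDerivAt.mul_const (HasDerivAt.mul_const ?_ _) _
  have := HasDerivAt.fun_finsetProd (u := (Finset.univ : Finset (Fin q)))
    (f := fun a r => K r (I a) (J a)) (f' := fun a => N (I a) (J a)) (x := s)
    fun a _ => hK (I a) (J a)
  simpa using this

theorem coordInnerDeriv_add (K N N' : Matrix (Fin n) (Fin n) ℝ) (e : Fin n → E)
    (α β : E [⋀^Fin q]→L[ℝ] ℝ) :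
    coordInnerDeriv K (N + N') e α β = coordInnerDeriv K N e α β + coordInnerDeriv K N' e α β := by
  unfold coordInnerDeriv
  rw [← mul_add]
  congr 1
  simp only [Finset.sum_add_distrib, Matrix.add_apply, mul_add, add_mul]

theorem coordInnerDeriv_neg (K N : Matrix (Fin n) (Fin n) ℝ) (e : Fin n → E)
    (α β : E [⋀^Fin q]→L[ℝ] ℝ) :
    coordInnerDeriv K (-N) e α β = -coordInnerDeriv K N e α β := by
  unfold coordInnerDeriv
  rw [← mul_neg]
  congr 1
  simp only [Finset.sum_neg_distrib, Matrix.neg_apply, mul_neg, neg_mul]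

/-- The derivative of `coordInner` in the direction `K Bᵀ` is the action of the endomorphism with
matrix `B` on the second factor. -/
theorem coordInnerDeriv_mul_transpose (K : Matrix (Fin n) (Fin n) ℝ) (B : Matrix (Fin n) (Fin n) ℝ)
    (e : Fin n → E) (A : E →L[ℝ] E) (hA : ∀ j, A (e j) = ∑ k, B k j • e k)
    (α β : E [⋀^Fin q]→L[ℝ] ℝ) :
    coordInnerDeriv K (K * B.transpose) e α β = coordInner K e α (derivAct A β) := by
  unfold coordInnerDeriv coordInner
  congr 1
  refine Finset.sum_congr rfl fun I _ => ?_
  have hL : ∀ J : Fin q → Fin n, derivAct A β (fun a => e (J a)) =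
      ∑ a, ∑ k, B k (J a) * β (fun c => e (Function.update J a k c)) := by
    intro J
    rw [derivAct_apply]
    refine Finset.sum_congr rfl fun a _ => ?_
    rw [hA]
    have h1 := map_sum (β.toMultilinearMap.toLinearMap (fun a => e (J a)) a)
      (fun k => B k (J a) • e k) Finset.univ
    refine h1.trans (Finset.sum_congr rfl fun k _ => ?_)
    rw [map_smul]
    change B k (J a) * β (Function.update (fun a => e (J a)) a (e k)) = _
    congr 2
    ext1 c
    rcases eq_or_ne c a with rfl | h
    · simp
    · simp [h]
  simp_rw [hL, Finset.mul_sum, Finset.sum_mul]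
  rw [Finset.sum_comm]
  conv_rhs => rw [Finset.sum_comm]
  refine Finset.sum_congr rfl fun a _ => ?_
  simp_rw [Matrix.mul_apply, Matrix.transpose_apply, Finset.mul_sum, Finset.sum_mul]
  rw [← Fintype.sum_prod_type', ← Fintype.sum_prod_type']
  -- Both sides are sums over a multi-index and one extra index. The involution exchanging the extra
  -- index with the entry at slot `a` matches them term by term.
  let σ : (Fin q → Fin n) × Fin n → (Fin q → Fin n) × Fin n :=
    fun p => (Function.update p.1 a p.2, p.1 a)
  have hσ : Function.Involutive σ := by
    rintro ⟨J, k⟩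
    simp [σ]
  refine Fintype.sum_equiv hσ.toPerm _ _ ?_
  rintro ⟨J, k⟩
  change _ = (∏ x, K (I x) (Function.update J a k x)) * α (fun a => e (I a)) *
    (B (J a) (Function.update J a k a) *
      β (fun c => e (Function.update (Function.update J a k) a (J a) c)))
  rw [← Finset.mul_prod_erase _ _ (Finset.mem_univ a)]
  have : ∏ x ∈ Finset.univ.erase a, K (I x) (Function.update J a k x) =
      ∏ x ∈ Finset.univ.erase a, K (I x) (J x) :=
    Finset.prod_congr rfl fun x hx => by
      rw [Function.update_of_ne (Finset.ne_of_mem_erase hx)]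
  rw [this]
  simp only [Function.update_self, Function.update_idem, Function.update_eq_self]
  ring

theorem coordInner_comm {K : Matrix (Fin n) (Fin n) ℝ} (hK : K.transpose = K) (e : Fin n → E)
    (α β : E [⋀^Fin q]→L[ℝ] ℝ) : coordInner K e α β = coordInner K e β α := by
  unfold coordInner
  rw [Finset.sum_comm]
  congr 1
  refine Finset.sum_congr rfl fun I _ => Finset.sum_congr rfl fun J _ => ?_
  have : ∀ i j, K i j = K j i := fun i j => congrFun (congrFun hK j) i
  simp_rw [this (J _) (I _)]
  ring

/-- Exchanging the two multi-indices transposes `N` and fixes the symmetric `K`. This transfers the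
formula for the second factor to the first. -/
theorem coordInnerDeriv_comm {K : Matrix (Fin n) (Fin n) ℝ} (hK : K.transpose = K)
    (N : Matrix (Fin n) (Fin n) ℝ) (e : Fin n → E) (α β : E [⋀^Fin q]→L[ℝ] ℝ) :
    coordInnerDeriv K N e α β = coordInnerDeriv K N.transpose e β α := by
  unfold coordInnerDeriv
  rw [Finset.sum_comm]
  congr 1
  refine Finset.sum_congr rfl fun I _ => Finset.sum_congr rfl fun J _ => ?_
  have : ∀ i j, K i j = K j i := fun i j => congrFun (congrFun hK j) i
  simp_rw [this (J _) (I _), Matrix.transpose_apply]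
  ring

/-- The derivative of `coordInner` in the direction `B K` is the action of the endomorphism with
matrix `B` on the first factor. -/
theorem coordInnerDeriv_mul {K : Matrix (Fin n) (Fin n) ℝ} (hK : K.transpose = K)
    (B : Matrix (Fin n) (Fin n) ℝ)
    (e : Fin n → E) (A : E →L[ℝ] E) (hA : ∀ j, A (e j) = ∑ k, B k j • e k)
    (α β : E [⋀^Fin q]→L[ℝ] ℝ) :
    coordInnerDeriv K (B * K) e α β = coordInner K e (derivAct A α) β := by
  rw [coordInnerDeriv_comm hK, Matrix.transpose_mul, hK,
    coordInnerDeriv_mul_transpose K B e A hA, coordInner_comm hK]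

end Derivation

end Witten
end

noncomputable section
namespace Witten

/-! ### The metric on a single tangent space and its forms -/

section MetricPointwise

variable {n q : ℕ} {M : Type*} [TopologicalSpace M] [ChartedSpace (EuclideanSpace ℝ (Fin n)) M]
  [IsManifold (𝓡 n) ∞ M] (g : RMetric n M)

theorem exists_orthonormal_tangent_basis (x : M) :
    ∃ b : Module.Basis (Fin n) ℝ (TangentSpace (𝓡 n) x),
      ∀ i j, g.inner x (b i) (b j) = if i = j then 1 else 0 := by
  have hn : Module.finrank ℝ (TangentSpace (𝓡 n) x) = n := finrank_euclideanSpace_fin (𝕜 := ℝ)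
  exact exists_orthonormal_basis hn (bilin g x)
    (fun v w => g.symm x v w) (fun v hv => g.pos x v hv)

variable {g} in
theorem inner_eq_sum_repr {x : M} {b : Module.Basis (Fin n) ℝ (TangentSpace (𝓡 n) x)}
    (hb : ∀ i j, g.inner x (b i) (b j) = if i = j then 1 else 0)
    (v w : TangentSpace (𝓡 n) x) :
    g.inner x v w = ∑ m, b.repr v m * b.repr w m := by
  conv_lhs => rw [← b.sum_repr v, ← b.sum_repr w]
  simp [hb, -Module.Basis.sum_repr, mul_comm]

variable {g} in
theorem sharp_eq_sum {x : M} {b : Module.Basis (Fin n) ℝ (TangentSpace (𝓡 n) x)}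
    (hb : ∀ i j, g.inner x (b i) (b j) = if i = j then 1 else 0)
    (α : TangentSpace (𝓡 n) x →L[ℝ] ℝ) : sharp g x α = ∑ k, α (b k) • b k := by
  have h : ∀ k, b.repr (sharp g x α) k = α (b k) := by
    intro k
    rw [← inner_sharp g x α (b k), inner_eq_sum_repr hb]
    simp [Finsupp.single_apply]
  conv_lhs => rw [← b.sum_repr (sharp g x α)]
  simp only [h]

variable {g} in
theorem cometric_eq_sum {x : M} {b : Module.Basis (Fin n) ℝ (TangentSpace (𝓡 n) x)}
    (hb : ∀ i j, g.inner x (b i) (b j) = if i = j then 1 else 0)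
    (α β : TangentSpace (𝓡 n) x →L[ℝ] ℝ) : cometric g x α β = ∑ m, α (b m) * β (b m) := by
  rw [cometric, inner_sharp, sharp_eq_sum hb, map_sum]
  simp [mul_comm]

variable {g} in
theorem formInner_eq_frameInner {x : M} {b : Module.Basis (Fin n) ℝ (TangentSpace (𝓡 n) x)}
    (hb : ∀ i j, g.inner x (b i) (b j) = if i = j then 1 else 0)
    (α β : TangentSpace (𝓡 n) x [⋀^Fin q]→L[ℝ] ℝ) :
    formInner g x α β = frameInner b α β :=
  coordInner_eq_frameInner (K := Matrix.of fun i j =>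
      cometric g x (dualCovector (stdBasis x) i) (dualCovector (stdBasis x) j))
    (stdBasis x) b (fun _ _ => cometric_eq_sum hb _ _) α β

theorem formInner_self_nonneg (x : M) (α : TangentSpace (𝓡 n) x [⋀^Fin q]→L[ℝ] ℝ) :
    0 ≤ formInner g x α α := by
  obtain ⟨b, hb⟩ := exists_orthonormal_tangent_basis g x
  rw [formInner_eq_frameInner hb]
  exact frameInner_self_nonneg b α

variable {g} in
theorem eq_zero_of_formInner_self {x : M} {α : TangentSpace (𝓡 n) x [⋀^Fin q]→L[ℝ] ℝ}
    (h : formInner g x α α = 0) : α = 0 := by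
  obtain ⟨b, hb⟩ := exists_orthonormal_tangent_basis g x
  rw [formInner_eq_frameInner hb] at h
  exact frameInner_self_eq_zero b h

theorem formInner_wedge (x : M) (α : TangentSpace (𝓡 n) x →L[ℝ] ℝ)
    (u : TangentSpace (𝓡 n) x [⋀^Fin q]→L[ℝ] ℝ) (v : TangentSpace (𝓡 n) x [⋀^Fin (q + 1)]→L[ℝ] ℝ) :
    formInner g x (wedge α u) v = formInner g x u (interior (sharp g x α) v) := by
  obtain ⟨b, hb⟩ := exists_orthonormal_tangent_basis g x
  rw [formInner_eq_frameInner hb, formInner_eq_frameInner hb]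
  exact frameInner_wedge b α _ (sharp_eq_sum hb α) u v

/-- The Gram matrix of a family of tangent vectors. -/
def gram (x : M) (e : Fin n → TangentSpace (𝓡 n) x) : Matrix (Fin n) (Fin n) ℝ :=
  Matrix.of fun i j => g.inner x (e i) (e j)

variable {g} in
theorem gram_eq_mul {x : M} {b : Module.Basis (Fin n) ℝ (TangentSpace (𝓡 n) x)}
    (hb : ∀ i j, g.inner x (b i) (b j) = if i = j then 1 else 0)
    (e : Fin n → TangentSpace (𝓡 n) x) :
    gram g x e = (b.toMatrix e).transpose * b.toMatrix e := by
  ext i j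
  simp [gram, inner_eq_sum_repr hb, Matrix.mul_apply, Module.Basis.toMatrix_apply]

/-- The Gram matrix is `Pᵀ P` with `P` the invertible transition matrix to an orthonormal basis. -/
theorem gram_det_pos (x : M) (e : Module.Basis (Fin n) ℝ (TangentSpace (𝓡 n) x)) :
    0 < (gram g x e).det := by
  obtain ⟨b, hb⟩ := exists_orthonormal_tangent_basis g x
  rw [gram_eq_mul hb, Matrix.det_mul, Matrix.det_transpose]
  have : (b.toMatrix e).det ≠ 0 := by
    have h := congrArg Matrix.det (b.toMatrix_mul_toMatrix_flip e)
    rw [Matrix.det_mul, Matrix.det_one] at h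
    exact left_ne_zero_of_mul_eq_one h
  exact mul_self_pos.2 this

/-- With `G = Pᵀ P`, the inverse is `P⁻¹ (P⁻¹)ᵀ`, which is precisely the condition of
`coordInner_eq_frameInner` for the orthonormal frame. The inner product, defined through `stdBasis`,
thereby becomes computable in the coordinate basis of any chart. -/
theorem formInner_eq_coordInner (x : M) (e : Module.Basis (Fin n) ℝ (TangentSpace (𝓡 n) x))
    (α β : TangentSpace (𝓡 n) x [⋀^Fin q]→L[ℝ] ℝ) :
    formInner g x α β = coordInner (gram g x e)⁻¹ e α β := by
  obtain ⟨b, hb⟩ := exists_orthonormal_tangent_basis g x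
  rw [formInner_eq_frameInner hb]
  refine (coordInner_eq_frameInner e b (fun i j => ?_) α β).symm
  have h : (gram g x e)⁻¹ = e.toMatrix b * (e.toMatrix b).transpose := by
    apply Matrix.inv_eq_right_inv
    rw [gram_eq_mul hb, Matrix.mul_assoc, ← Matrix.mul_assoc (b.toMatrix e),
      b.toMatrix_mul_toMatrix_flip, Matrix.one_mul, ← Matrix.transpose_mul,
      e.toMatrix_mul_toMatrix_flip, Matrix.transpose_one]
  rw [h]
  simp [Matrix.mul_apply, Module.Basis.toMatrix_apply]

theorem formInner_comm (x : M) (α β : TangentSpace (𝓡 n) x [⋀^Fin q]→L[ℝ] ℝ) :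
    formInner g x α β = formInner g x β α := by
  obtain ⟨b, hb⟩ := exists_orthonormal_tangent_basis g x
  rw [formInner_eq_frameInner hb, formInner_eq_frameInner hb]
  simp only [frameInner, mul_comm]

theorem formInner_add_right (x : M) (α β γ : TangentSpace (𝓡 n) x [⋀^Fin q]→L[ℝ] ℝ) :
    formInner g x α (β + γ) = formInner g x α β + formInner g x α γ := by
  simp only [formInner, ContinuousAlternatingMap.add_apply, mul_add, Finset.sum_add_distrib]

theorem formInner_smul_right (x : M) (a : ℝ) (α β : TangentSpace (𝓡 n) x [⋀^Fin q]→L[ℝ] ℝ) :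
    formInner g x α (a • β) = a * formInner g x α β := by
  simp only [formInner, ContinuousAlternatingMap.smul_apply, smul_eq_mul, Finset.mul_sum]
  exact Finset.sum_congr rfl fun _ _ => Finset.sum_congr rfl fun _ _ => by ring

end MetricPointwise

/-! ### Coordinate bases and the metric coefficients -/

section Charts

variable {n q : ℕ} {M : Type*} [TopologicalSpace M] [ChartedSpace (EuclideanSpace ℝ (Fin n)) M]

theorem extChartAt_target_isOpen (c : M) : IsOpen (extChartAt (𝓡 n) c).target :=
  isOpen_extChartAt_target c

variable [IsManifold (𝓡 n) ∞ M]

theorem isManifold_one : IsManifold (𝓡 n) 1 M := IsManifold.of_le (n := ∞) (by norm_num)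

/-- The derivative at `x` of the preferred chart at `c`. -/
def chartDerivAt (c x : M) : TangentSpace (𝓡 n) x →L[ℝ] EuclideanSpace ℝ (Fin n) :=
  mvfderiv (𝓡 n) (extChartAt (𝓡 n) c) x

omit [IsManifold (𝓡 n) ∞ M] in
theorem chartInvDeriv_eq (c : M) (y : EuclideanSpace ℝ (Fin n)) :
    chartInvDeriv c y = mfderivWithin 𝓘(ℝ, EuclideanSpace ℝ (Fin n)) (𝓡 n)
      (extChartAt (𝓡 n) c).symm (Set.range (𝓡 n)) y := by
  simp only [chartInvDeriv, modelWithCornersSelf_coe, Set.range_id, mfderivWithin_univ]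
  rfl

theorem chartDerivAt_comp (c : M) {y : EuclideanSpace ℝ (Fin n)}
    (hy : y ∈ (extChartAt (𝓡 n) c).target) :
    (chartDerivAt c ((extChartAt (𝓡 n) c).symm y)).comp (chartInvDeriv c y) =
      ContinuousLinearMap.id ℝ _ := by
  have := isManifold_one (n := n) (M := M)
  rw [chartInvDeriv_eq]
  exact mfderiv_extChartAt_comp_mfderivWithin_extChartAt_symm hy

theorem chartInvDeriv_comp (c : M) {y : EuclideanSpace ℝ (Fin n)}
    (hy : y ∈ (extChartAt (𝓡 n) c).target) :
    (chartInvDeriv c y).comp (chartDerivAt c ((extChartAt (𝓡 n) c).symm y)) =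
      ContinuousLinearMap.id ℝ _ := by
  have := isManifold_one (n := n) (M := M)
  rw [chartInvDeriv_eq]
  exact mfderivWithin_extChartAt_symm_comp_mfderiv_extChartAt hy

/-- The derivative of the inverse chart as a linear isomorphism. -/
def chartInvEquiv (c : M) {y : EuclideanSpace ℝ (Fin n)}
    (hy : y ∈ (extChartAt (𝓡 n) c).target) :
    EuclideanSpace ℝ (Fin n) ≃ₗ[ℝ] TangentSpace (𝓡 n) ((extChartAt (𝓡 n) c).symm y) :=
  LinearEquiv.ofLinearMap (chartInvDeriv c y).toLinearMap
    (chartDerivAt c ((extChartAt (𝓡 n) c).symm y)).toLinearMap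
    (LinearMap.ext fun v => DFunLike.congr_fun (F := _ →L[ℝ] _) (chartInvDeriv_comp c hy) v)
    (LinearMap.ext fun v => DFunLike.congr_fun (F := _ →L[ℝ] _) (chartDerivAt_comp c hy) v)

/-- The coordinate basis of the tangent space. -/
def coordBasis (c : M) {y : EuclideanSpace ℝ (Fin n)}
    (hy : y ∈ (extChartAt (𝓡 n) c).target) :
    Module.Basis (Fin n) ℝ (TangentSpace (𝓡 n) ((extChartAt (𝓡 n) c).symm y)) :=
  (EuclideanSpace.basisFun (Fin n) ℝ).toBasis.map (chartInvEquiv c hy)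

theorem coordBasis_apply (c : M) {y : EuclideanSpace ℝ (Fin n)}
    (hy : y ∈ (extChartAt (𝓡 n) c).target) (i : Fin n) :
    coordBasis c hy i = coordVec c y i := by
  rw [coordBasis, Module.Basis.map_apply]
  change chartInvDeriv c y ((EuclideanSpace.basisFun (Fin n) ℝ).toBasis i) = _
  rw [OrthonormalBasis.coe_toBasis, EuclideanSpace.basisFun_apply]
  rfl

/-- The tangent space at `x` is the model space, identified through the preferred chart at `x`. Thus
forms at `x` can be compared with their local expressions in that chart without any transport. -/
theorem chartDeriv_self (x : M) :
    chartDeriv x = ContinuousLinearMap.id ℝ (EuclideanSpace ℝ (Fin n)) := by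
  have := isManifold_one (n := n) (M := M)
  exact mfderiv_extChartAt_self

variable (g : RMetric n M)

theorem metricCoeff_eq_gram (c : M) {y : EuclideanSpace ℝ (Fin n)}
    (hy : y ∈ (extChartAt (𝓡 n) c).target) :
    metricCoeff g c y = gram g _ (coordBasis c hy) := by
  ext i j
  simp only [metricCoeff, gram, coordBasis_apply]

theorem metricCoeff_det_pos (c : M) {y : EuclideanSpace ℝ (Fin n)}
    (hy : y ∈ (extChartAt (𝓡 n) c).target) : 0 < (metricCoeff g c y).det := by
  rw [metricCoeff_eq_gram g c hy]
  exact gram_det_pos g _ _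

theorem metricCoeff_symm (c : M) (y : EuclideanSpace ℝ (Fin n)) (i j : Fin n) :
    metricCoeff g c y i j = metricCoeff g c y j i :=
  g.symm _ _ _

theorem formInner_eq_local (c : M) {y : EuclideanSpace ℝ (Fin n)}
    (hy : y ∈ (extChartAt (𝓡 n) c).target) (u v : DiffForm n M q) :
    formInner g ((extChartAt (𝓡 n) c).symm y) (u _) (v _) =
      coordInner (metricCoeff g c y)⁻¹ (fun i => EuclideanSpace.single i (1 : ℝ))
        (localForm c u y) (localForm c v y) := by
  rw [formInner_eq_coordInner g _ (coordBasis c hy), metricCoeff_eq_gram g c hy,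
    show (coordBasis c hy : Fin n → _) = fun i => coordVec c y i from
      funext (coordBasis_apply c hy)]
  rfl

/-- The coordinate vectors are the local frame given by the standard trivialization of the tangent
bundle at `c`, and a smooth metric applied to smooth sections is smooth. -/
theorem contDiffOn_metricCoeff (c : M) (i j : Fin n) :
    ContDiffOn ℝ ∞ (fun y => metricCoeff g c y i j) (extChartAt (𝓡 n) c).target := by
  have h1 := isManifold_one (n := n) (M := M)
  let e := trivializationAt (EuclideanSpace ℝ (Fin n)) (TangentSpace (𝓡 n) : M → Type _) c
  let b := (EuclideanSpace.basisFun (Fin n) ℝ).toBasis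
  have hs : e.baseSet = (chartAt (EuclideanSpace ℝ (Fin n)) c).source := rfl
  have h := fun i => e.contMDiffOn_localFrame_baseSet (I := 𝓡 n) ∞ b i
  have h2 := ContMDiffOn.clm_bundle_apply₂ (g.contMDiff.contMDiffOn (s := e.baseSet)) (h i) (h j)
  have h3 : ContMDiffOn (𝓡 n) 𝓘(ℝ, ℝ) ∞
      (fun x => g.inner x (e.localFrame b i x) (e.localFrame b j x)) e.baseSet := by
    intro x hx
    exact (Bundle.contMDiffWithinAt_totalSpace.1 (h2 x hx)).2
  have h4 := h3.comp (contMDiffOn_extChartAt_symm (I := 𝓡 n) (n := ∞) c)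
    (fun y hy => by
      rw [hs, ← extChartAt_source (𝓡 n)]; exact (extChartAt (𝓡 n) c).map_target hy)
  rw [← contMDiffOn_iff_contDiffOn]
  refine h4.congr fun y hy => ?_
  have hx : (extChartAt (𝓡 n) c).symm y ∈ (chartAt (EuclideanSpace ℝ (Fin n)) c).source := by
    rw [← extChartAt_source (𝓡 n)]; exact (extChartAt (𝓡 n) c).map_target hy
  have hv : ∀ k, coordVec c y k = e.localFrame b k ((extChartAt (𝓡 n) c).symm y) := by
    intro k
    rw [e.localFrame_apply_of_mem_baseSet b (by rw [hs]; exact hx)]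
    have := TangentBundle.symmL_trivializationAt (I := 𝓡 n) (𝕜 := ℝ) hx
    rw [(extChartAt (𝓡 n) c).right_inv hy, ← chartInvDeriv_eq] at this
    rw [coordVec, ← this]
    rw [Bundle.Trivialization.basisAt, Module.Basis.map_apply]
    simp only [b, OrthonormalBasis.coe_toBasis, EuclideanSpace.basisFun_apply]
    exact e.toPretrivialization.symmₗ_apply ℝ (by exact hx) _
  simp only [metricCoeff, Matrix.of_apply, hv]
  rfl

end Charts

end Witten
end

noncomputable section
namespace Witten

/-! ### Differential calculus of form-valued maps on a vector space -/

section FormCalculus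

variable {n q : ℕ} {E : Type*} [NormedAddCommGroup E] [NormedSpace ℝ E]
  {F : Type*} [NormedAddCommGroup F] [NormedSpace ℝ F]

/-- Evaluation of alternating forms on fixed vectors. -/
def evalCLM (v : Fin q → E) : (E [⋀^Fin q]→L[ℝ] ℝ) →L[ℝ] ℝ :=
  ContinuousMultilinearMap.apply ℝ (fun _ => E) ℝ v ∘L
    ContinuousAlternatingMap.toContinuousMultilinearMapCLM ℝ

@[simp]
theorem evalCLM_apply (v : Fin q → E) (η : E [⋀^Fin q]→L[ℝ] ℝ) : evalCLM v η = η v := rfl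

/-- A form is determined by its components, so the component map has a linear left inverse,
continuous because the space of components is finite-dimensional. Smoothness of form-valued maps can
then be tested on components. -/
theorem exists_leftInverse_components (e : Module.Basis (Fin n) ℝ E) (q : ℕ) :
    ∃ L : ((Fin q → Fin n) → ℝ) →L[ℝ] E [⋀^Fin q]→L[ℝ] ℝ,
      ∀ η : E [⋀^Fin q]→L[ℝ] ℝ, L (fun I => η fun a => e (I a)) = η := by
  let C : (E [⋀^Fin q]→L[ℝ] ℝ) →ₗ[ℝ] ((Fin q → Fin n) → ℝ) :=
    { toFun := fun η I => η fun a => e (I a)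
      map_add' := fun _ _ => rfl
      map_smul' := fun _ _ => rfl }
  have hC : LinearMap.ker C = ⊥ := by
    rw [LinearMap.ker_eq_bot']
    intro η h
    exact form_ext_basis e fun I => congrFun h I
  obtain ⟨L, hL⟩ := C.exists_leftInverse_of_injective hC
  exact ⟨LinearMap.toContinuousLinearMap L, fun η => LinearMap.congr_fun hL η⟩

theorem finiteDimensional_form (e : Module.Basis (Fin n) ℝ E) (q : ℕ) :
    FiniteDimensional ℝ (E [⋀^Fin q]→L[ℝ] ℝ) := by
  obtain ⟨L, hL⟩ := exists_leftInverse_components e q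
  exact Module.Finite.of_surjective L.toLinearMap fun η => ⟨fun I => η fun a => e (I a), hL η⟩

instance : FiniteDimensional ℝ (EuclideanSpace ℝ (Fin n) [⋀^Fin q]→L[ℝ] ℝ) :=
  finiteDimensional_form (EuclideanSpace.basisFun (Fin n) ℝ).toBasis q

theorem contDiffWithinAt_form_of_components (e : Module.Basis (Fin n) ℝ E) {k : WithTop ℕ∞}
    {f : F → E [⋀^Fin q]→L[ℝ] ℝ} {s : Set F} {y : F}
    (h : ∀ I : Fin q → Fin n, ContDiffWithinAt ℝ k (fun z => f z fun a => e (I a)) s y) :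
    ContDiffWithinAt ℝ k f s y := by
  obtain ⟨L, hL⟩ := exists_leftInverse_components e q
  have h1 := L.contDiff.comp_contDiffWithinAt (contDiffWithinAt_pi.2 h)
  exact h1.congr (fun z _ => (hL (f z)).symm) (hL (f y)).symm

theorem contDiffWithinAt_form_apply {k : WithTop ℕ∞} {f : F → E [⋀^Fin q]→L[ℝ] ℝ} {s : Set F}
    {y : F} (h : ContDiffWithinAt ℝ k f s y) (v : Fin q → E) :
    ContDiffWithinAt ℝ k (fun z => f z v) s y :=
  (evalCLM v).contDiff.comp_contDiffWithinAt h

theorem contDiffWithinAt_basis_repr [FiniteDimensional ℝ E] (e : Module.Basis (Fin n) ℝ E)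
    {k : WithTop ℕ∞} {f : F → E} {s : Set F} {y : F} (h : ContDiffWithinAt ℝ k f s y) (i : Fin n) :
    ContDiffWithinAt ℝ k (fun z => e.repr (f z) i) s y :=
  (LinearMap.toContinuousLinearMap (e.coord i)).contDiff.comp_contDiffWithinAt h

/-- The components of a pullback are polynomials in the matrix entries of `A` and the components of
`f`. -/
theorem contDiffWithinAt_form_comp [FiniteDimensional ℝ E] (e : Module.Basis (Fin n) ℝ E)
    {k : WithTop ℕ∞}
    {f : F → E [⋀^Fin q]→L[ℝ] ℝ} {A : F → E →L[ℝ] E} {s : Set F}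
    {y : F} (h : ContDiffWithinAt ℝ k f s y) (hA : ContDiffWithinAt ℝ k A s y) :
    ContDiffWithinAt ℝ k (fun z => (f z).compContinuousLinearMap (A z)) s y := by
  refine contDiffWithinAt_form_of_components e fun I => ?_
  have : (fun z => (f z).compContinuousLinearMap (A z) fun a => e (I a)) =
      fun z => ∑ J : Fin q → Fin n, (∏ a, e.repr (A z (e (I a))) (J a)) * f z (fun a => e (J a)) :=
    funext fun z => form_apply_expand e (f z) _
  rw [this]
  refine ContDiffWithinAt.sum fun J _ => ContDiffWithinAt.mul ?_ (contDiffWithinAt_form_apply h _)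
  exact contDiffWithinAt_prod fun a _ =>
    contDiffWithinAt_basis_repr e (hA.clm_apply contDiffWithinAt_const) _

theorem wedge_eq_alternatize (α : E →L[ℝ] ℝ) (η : E [⋀^Fin q]→L[ℝ] ℝ) :
    wedge α η = ContinuousAlternatingMap.alternatizeUncurryFin (α.smulRight η) := by
  ext v
  simp [wedge_apply, ContinuousAlternatingMap.alternatizeUncurryFin_apply]

theorem contDiffWithinAt_form_wedge {k : WithTop ℕ∞} {α : F → E →L[ℝ] ℝ}
    {f : F → E [⋀^Fin q]→L[ℝ] ℝ} {s : Set F} {y : F} (hα : ContDiffWithinAt ℝ k α s y)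
    (h : ContDiffWithinAt ℝ k f s y) :
    ContDiffWithinAt ℝ k (fun z => wedge (α z) (f z)) s y := by
  simp only [wedge_eq_alternatize]
  exact (ContinuousAlternatingMap.alternatizeUncurryFinCLM ℝ E ℝ).contDiff.comp_contDiffWithinAt
    (hα.smulRight h)

/-- The interior product as a continuous bilinear map. -/
def curryCLM : (E [⋀^Fin (q + 1)]→L[ℝ] ℝ) →L[ℝ] E →L[ℝ] E [⋀^Fin q]→L[ℝ] ℝ :=
  (ContinuousAlternatingMap.curryLeftLI (𝕜 := ℝ) (E := E) (F := ℝ) (n := q)).toContinuousLinearMap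

theorem curryCLM_apply (f : E [⋀^Fin (q + 1)]→L[ℝ] ℝ) (v : E) : curryCLM f v = interior v f := by
  ext m
  rfl

theorem contDiffWithinAt_form_interior {k : WithTop ℕ∞} {X : F → E}
    {f : F → E [⋀^Fin (q + 1)]→L[ℝ] ℝ} {s : Set F} {y : F} (hX : ContDiffWithinAt ℝ k X s y)
    (h : ContDiffWithinAt ℝ k f s y) :
    ContDiffWithinAt ℝ k (fun z => interior (X z) (f z)) s y := by
  simp only [← curryCLM_apply]
  exact (curryCLM.contDiff.comp_contDiffWithinAt h).clm_apply hX

theorem hasFDerivAt_clm_comp {G H : Type*} [NormedAddCommGroup G] [NormedSpace ℝ G]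
    [NormedAddCommGroup H] [NormedSpace ℝ H] (L : G →L[ℝ] H) {f : F → G} {f' : F →L[ℝ] G} {y : F}
    (hf : HasFDerivAt f f' y) : HasFDerivAt (fun z => L (f z)) (L.comp f') y :=
  L.hasFDerivAt.comp y hf

theorem contDiffAt_extDeriv {f : E → E [⋀^Fin q]→L[ℝ] ℝ} {y : E}
    (h : ContDiffAt ℝ ∞ f y) : ContDiffAt ℝ ∞ (extDeriv f) y :=
  ContDiffAt.comp y (g := ContinuousAlternatingMap.alternatizeUncurryFinCLM ℝ E ℝ)
    (ContinuousLinearMap.contDiff _).contDiffAt (h.fderiv_right (m := ∞) (by simp))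

theorem extDeriv_smul_fun {h : E → ℝ} {f : E → E [⋀^Fin q]→L[ℝ] ℝ} {y : E}
    (hh : DifferentiableAt ℝ h y) (hf : DifferentiableAt ℝ f y) :
    extDeriv (fun z => h z • f z) y = h y • extDeriv f y + wedge (fderiv ℝ h y) (f y) := by
  rw [extDeriv, fderiv_fun_smul hh hf, ContinuousAlternatingMap.alternatizeUncurryFin_add,
    ContinuousAlternatingMap.alternatizeUncurryFin_smul, wedge_eq_alternatize, extDeriv]

/-- Cartan's formula in a vector space, for forms of positive degree. -/
theorem extDeriv_interior_add {X : E → E} {f : E → E [⋀^Fin (q + 1)]→L[ℝ] ℝ} {y : E}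
    (hX : DifferentiableAt ℝ X y) (hf : DifferentiableAt ℝ f y) :
    extDeriv (fun z => interior (X z) (f z)) y + interior (X y) (extDeriv f y) =
      fderiv ℝ f y (X y) + derivAct (fderiv ℝ X y) (f y) := by
  have h1 : HasFDerivAt (fun z => interior (X z) (f z))
      ((curryCLM (f y)).comp (fderiv ℝ X y) + (curryCLM.comp (fderiv ℝ f y)).flip (X y)) y := by
    simp only [← curryCLM_apply]
    have h0 := hasFDerivAt_clm_comp (H := E →L[ℝ] E [⋀^Fin q]→L[ℝ] ℝ) (curryCLM (E := E) (q := q))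
      hf.hasFDerivAt
    exact h0.clm_apply hX.hasFDerivAt
  ext v
  rw [ContinuousAlternatingMap.add_apply, ContinuousAlternatingMap.add_apply, interior_apply,
    extDeriv, h1.fderiv, extDeriv, ContinuousAlternatingMap.alternatizeUncurryFin_apply,
    ContinuousAlternatingMap.alternatizeUncurryFin_apply, derivAct_apply_succ,
    Fin.sum_univ_succ (n := q + 1)]
  have h2 : ∀ i : Fin (q + 1), i.succ.removeNth (Matrix.vecCons (X y) v : Fin (q + 2) → E) =
      Matrix.vecCons (X y) (i.removeNth v) := by
    intro i
    ext1 j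
    refine Fin.cases ?_ (fun j => ?_) j <;> simp [Fin.removeNth]
  have h3 : ∀ i : Fin (q + 1), ((curryCLM (f y)).comp (fderiv ℝ X y) +
      (curryCLM.comp (fderiv ℝ f y)).flip (X y)) (v i) (i.removeNth v) =
      f y (Matrix.vecCons (fderiv ℝ X y (v i)) (i.removeNth v)) +
      fderiv ℝ f y (v i) (Matrix.vecCons (X y) (i.removeNth v)) := fun _ => rfl
  have h4 : (0 : Fin (q + 2)).removeNth (Matrix.vecCons (X y) v : Fin (q + 2) → E) = v := by
    ext1 j
    simp [Fin.removeNth]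
  -- The terms differentiating `f` along `v i` occur in both summands with opposite signs. What
  -- survives is the derivative along `X`, from slot `0` of `extDeriv f`, and the terms with the
  -- derivative of `X`.
  simp only [h2, h3, h4, smul_add, Finset.sum_add_distrib, Matrix.cons_val_zero,
    Matrix.cons_val_succ, Fin.val_zero, pow_zero, one_smul, Fin.val_succ, pow_succ, mul_neg,
    mul_one, neg_smul, Finset.sum_neg_distrib]
  simp only [zsmul_eq_mul]
  push_cast
  ring

/-- Cartan's formula in degree zero, where the term `d ι_X f` is absent and the derivation acts by
an empty sum; no differentiability is needed. -/
theorem interior_extDeriv_zero {X : E → E} {f : E → E [⋀^Fin 0]→L[ℝ] ℝ} {y : E} :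
    interior (X y) (extDeriv f y) = fderiv ℝ f y (X y) + derivAct (fderiv ℝ X y) (f y) := by
  ext v
  rw [interior_apply, extDeriv, ContinuousAlternatingMap.alternatizeUncurryFin_apply,
    ContinuousAlternatingMap.add_apply, derivAct_apply]
  simp

end FormCalculus

end Witten
end

noncomputable section
namespace Witten

/-! ### Local expressions of forms and change of charts -/

section LocalForms

variable {n q : ℕ} {M : Type*} [TopologicalSpace M] [ChartedSpace (EuclideanSpace ℝ (Fin n)) M]

theorem localForm_add (c : M) (η ξ : DiffForm n M q) (y : EuclideanSpace ℝ (Fin n)) :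
    localForm c (η + ξ) y = localForm c η y + localForm c ξ y := rfl

theorem localForm_smul (c : M) (h : M → ℝ) (η : DiffForm n M q) (y : EuclideanSpace ℝ (Fin n)) :
    localForm c (fun x => h x • η x) y =
      h ((extChartAt (𝓡 n) c).symm y) • localForm c η y := rfl

/-- The coordinate change between two preferred charts. -/
def chartTrans (c c' : M) (y : EuclideanSpace ℝ (Fin n)) : EuclideanSpace ℝ (Fin n) :=
  extChartAt (𝓡 n) c' ((extChartAt (𝓡 n) c).symm y)

variable [IsManifold (𝓡 n) ∞ M]

theorem contMDiffAt_extChartAt_symm (c : M) {y : EuclideanSpace ℝ (Fin n)}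
    (hy : y ∈ (extChartAt (𝓡 n) c).target) :
    ContMDiffAt 𝓘(ℝ, EuclideanSpace ℝ (Fin n)) (𝓡 n) ∞ (extChartAt (𝓡 n) c).symm y :=
  (contMDiffOn_extChartAt_symm c).contMDiffAt ((extChartAt_target_isOpen c).mem_nhds hy)

theorem contMDiffAt_extChartAt_of_mem {c x : M} (hx : x ∈ (extChartAt (𝓡 n) c).source) :
    ContMDiffAt (𝓡 n) 𝓘(ℝ, EuclideanSpace ℝ (Fin n)) ∞ (extChartAt (𝓡 n) c) x :=
  contMDiffAt_extChartAt' (by rwa [← extChartAt_source (𝓡 n)])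

theorem contDiffAt_chartTrans {c c' : M} {y : EuclideanSpace ℝ (Fin n)}
    (hy : y ∈ (extChartAt (𝓡 n) c).target)
    (hy' : (extChartAt (𝓡 n) c).symm y ∈ (extChartAt (𝓡 n) c').source) :
    ContDiffAt ℝ ∞ (chartTrans c c') y :=
  contMDiffAt_iff_contDiffAt.1
    ((contMDiffAt_extChartAt_of_mem hy').comp y (contMDiffAt_extChartAt_symm c hy))

theorem mvfderiv_comp_chartInvDeriv {F : Type*} [NormedAddCommGroup F] [NormedSpace ℝ F]
    {f : M → F} {c : M} {y : EuclideanSpace ℝ (Fin n)}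
    (hy : y ∈ (extChartAt (𝓡 n) c).target)
    (hf : MDifferentiableAt (𝓡 n) 𝓘(ℝ, F) f ((extChartAt (𝓡 n) c).symm y)) :
    (mvfderiv (𝓡 n) f ((extChartAt (𝓡 n) c).symm y)).comp (chartInvDeriv c y) =
      fderiv ℝ (fun z => f ((extChartAt (𝓡 n) c).symm z)) y := by
  have h := mfderiv_comp y hf ((contMDiffAt_extChartAt_symm c hy).mdifferentiableAt (by simp))
  rw [← mfderiv_eq_fderiv]
  exact h.symm

theorem chartDerivAt_comp_chartInvDeriv {c c' : M} {y : EuclideanSpace ℝ (Fin n)}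
    (hy : y ∈ (extChartAt (𝓡 n) c).target)
    (hy' : (extChartAt (𝓡 n) c).symm y ∈ (extChartAt (𝓡 n) c').source) :
    (chartDerivAt c' ((extChartAt (𝓡 n) c).symm y)).comp (chartInvDeriv c y) =
      fderiv ℝ (chartTrans c c') y :=
  mvfderiv_comp_chartInvDeriv hy ((contMDiffAt_extChartAt_of_mem hy').mdifferentiableAt (by simp))

theorem comp_chartDerivAt {c : M} (η : DiffForm n M q) {y : EuclideanSpace ℝ (Fin n)} {x : M}
    (hy : y ∈ (extChartAt (𝓡 n) c).target) (hx : (extChartAt (𝓡 n) c).symm y = x) :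
    (localForm c η y).compContinuousLinearMap (chartDerivAt c x) = η x := by
  subst hx
  ext v
  simp only [localForm, ContinuousAlternatingMap.compContinuousLinearMap_apply]
  congr 1
  ext1 i
  exact DFunLike.congr_fun (F := _ →L[ℝ] _) (chartInvDeriv_comp c hy) (v i)

theorem localForm_chartDerivAt {c x : M} (η : DiffForm n M q)
    (hx : x ∈ (extChartAt (𝓡 n) c).source) :
    (localForm c η (extChartAt (𝓡 n) c x)).compContinuousLinearMap (chartDerivAt c x) = η x :=
  comp_chartDerivAt η ((extChartAt (𝓡 n) c).map_source hx) ((extChartAt (𝓡 n) c).left_inv hx)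

theorem eq_of_localForm_eq {c x : M} {η ξ : DiffForm n M q}
    (hx : x ∈ (extChartAt (𝓡 n) c).source)
    (h : localForm c η (extChartAt (𝓡 n) c x) = localForm c ξ (extChartAt (𝓡 n) c x)) :
    η x = ξ x := by
  rw [← localForm_chartDerivAt η hx, h, localForm_chartDerivAt ξ hx]

/-- The change of the local expression of a form under a change of charts. -/
theorem localForm_chartTrans {c c' : M} (η : DiffForm n M q) {y : EuclideanSpace ℝ (Fin n)}
    (hy : y ∈ (extChartAt (𝓡 n) c).target)
    (hy' : (extChartAt (𝓡 n) c).symm y ∈ (extChartAt (𝓡 n) c').source) :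
    localForm c η y =
      (localForm c' η (chartTrans c c' y)).compContinuousLinearMap
        (fderiv ℝ (chartTrans c c') y) := by
  rw [← chartDerivAt_comp_chartInvDeriv hy hy', localForm, ← localForm_chartDerivAt η hy']
  rfl

theorem eventually_chart_overlap {c c' : M} {y : EuclideanSpace ℝ (Fin n)}
    (hy : y ∈ (extChartAt (𝓡 n) c).target)
    (hy' : (extChartAt (𝓡 n) c).symm y ∈ (extChartAt (𝓡 n) c').source) :
    ∀ᶠ z in nhds y, z ∈ (extChartAt (𝓡 n) c).target ∧
      (extChartAt (𝓡 n) c).symm z ∈ (extChartAt (𝓡 n) c').source :=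
  Filter.Eventually.and ((extChartAt_target_isOpen c).mem_nhds hy)
    ((contMDiffAt_extChartAt_symm c hy).continuousAt.eventually_mem
      ((isOpen_extChartAt_source c').mem_nhds hy'))

theorem contDiffAt_localForm_chartTrans {c c' : M} {η : DiffForm n M q}
    {y : EuclideanSpace ℝ (Fin n)} (hy : y ∈ (extChartAt (𝓡 n) c).target)
    (hy' : (extChartAt (𝓡 n) c).symm y ∈ (extChartAt (𝓡 n) c').source)
    (h : ContDiffAt ℝ ∞ (localForm c' η) (chartTrans c c' y)) :
    ContDiffAt ℝ ∞ (localForm c η) y := by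
  have hτ := contDiffAt_chartTrans hy hy'
  have h1 : ContDiffAt ℝ ∞ (fun z => (localForm c' η (chartTrans c c' z)).compContinuousLinearMap
      (fderiv ℝ (chartTrans c c') z)) y :=
    contDiffWithinAt_form_comp (s := Set.univ) (EuclideanSpace.basisFun (Fin n) ℝ).toBasis
      (h.comp y hτ) (hτ.fderiv_right (m := ∞) (by simp))
  exact h1.congr_of_eventuallyEq ((eventually_chart_overlap hy hy').mono
    fun z hz => localForm_chartTrans η hz.1 hz.2)

/-- The trivialization of the bundle of forms at `x₀` pulls back by the inverse trivialization of
the tangent bundle, which is the derivative of the inverse chart. Hence it reads a section exactly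
as `localForm x₀` does. -/
theorem isSmoothForm_iff_contDiffAt (η : DiffForm n M q) :
    IsSmoothForm η ↔ ∀ x : M, ContDiffAt ℝ ∞ (localForm x η) (extChartAt (𝓡 n) x x) := by
  have h1 := isManifold_one (n := n) (M := M)
  unfold IsSmoothForm ContMDiff
  refine forall_congr' fun x₀ => ?_
  rw [Bundle.contMDiffAt_section]
  have hloc : (fun x => (trivializationAt (EuclideanSpace ℝ (Fin n) [⋀^Fin q]→L[ℝ] ℝ)
      (fun x : M => TangentSpace (𝓡 n) x [⋀^Fin q]→L[ℝ] Bundle.Trivial M ℝ x) x₀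
        ⟨x, η x⟩).2) =ᶠ[nhds x₀] fun x => localForm x₀ η (extChartAt (𝓡 n) x₀ x) := by
    filter_upwards [extChartAt_source_mem_nhds (I := 𝓡 n) x₀] with x hx
    have h2 : ∀ y ∈ (extChartAt (𝓡 n) x₀).target,
        (trivializationAt (EuclideanSpace ℝ (Fin n) [⋀^Fin q]→L[ℝ] ℝ)
          (fun x : M => TangentSpace (𝓡 n) x [⋀^Fin q]→L[ℝ] Bundle.Trivial M ℝ x) x₀
          ⟨(extChartAt (𝓡 n) x₀).symm y, η ((extChartAt (𝓡 n) x₀).symm y)⟩).2 =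
          localForm x₀ η y := by
      intro y hy
      have hx' : (extChartAt (𝓡 n) x₀).symm y ∈ (chartAt (EuclideanSpace ℝ (Fin n)) x₀).source := by
        rw [← extChartAt_source (𝓡 n)]
        exact (extChartAt (𝓡 n) x₀).map_target hy
      have h2 := TangentBundle.symmL_trivializationAt (I := 𝓡 n) (𝕜 := ℝ) hx'
      rw [(extChartAt (𝓡 n) x₀).right_inv hy, ← chartInvDeriv_eq] at h2
      change ContinuousAlternatingMap.inCoordinates _ _ _ _ _ _ _ = _
      rw [ContinuousAlternatingMap.inCoordinates, h2]
      ext v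
      simp [localForm]
      rfl
    have h3 := h2 _ ((extChartAt (𝓡 n) x₀).map_source hx)
    rwa [(extChartAt (𝓡 n) x₀).left_inv hx] at h3
  rw [hloc.contMDiffAt_iff]
  constructor
  · intro h
    have h2 := ContMDiffAt.comp_of_eq (x := extChartAt (𝓡 n) x₀ x₀) h
      (contMDiffAt_extChartAt_symm x₀ (mem_extChartAt_target x₀)) (extChartAt_to_inv x₀)
    rw [← contMDiffAt_iff_contDiffAt]
    refine h2.congr_of_eventuallyEq ?_
    filter_upwards [(extChartAt_target_isOpen x₀).mem_nhds (mem_extChartAt_target x₀)] with y hy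
    simp only [Function.comp_apply]
    rw [(extChartAt (𝓡 n) x₀).right_inv hy]
  · intro h
    exact (contMDiffAt_iff_contDiffAt.2 h).comp x₀
      (contMDiffAt_extChartAt_of_mem (mem_extChartAt_source x₀))

/-- A form is smooth if near each point it is smooth in some chart. -/
theorem isSmoothForm_of_local {η : DiffForm n M q}
    (h : ∀ x : M, ∃ c : M, x ∈ (extChartAt (𝓡 n) c).source ∧
      ContDiffAt ℝ ∞ (localForm c η) (extChartAt (𝓡 n) c x)) : IsSmoothForm η := by
  rw [isSmoothForm_iff_contDiffAt]
  intro x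
  obtain ⟨c, hx, hc⟩ := h x
  have hs : (extChartAt (𝓡 n) x).symm (extChartAt (𝓡 n) x x) = x := extChartAt_to_inv x
  refine contDiffAt_localForm_chartTrans (c' := c) (mem_extChartAt_target x) (by rwa [hs]) ?_
  rw [chartTrans, hs]
  exact hc

theorem IsSmoothForm.contDiffAt {η : DiffForm n M q} (h : IsSmoothForm η) {c : M}
    {y : EuclideanSpace ℝ (Fin n)} (hy : y ∈ (extChartAt (𝓡 n) c).target) :
    ContDiffAt ℝ ∞ (localForm c η) y :=
  contDiffAt_localForm_chartTrans hy (mem_extChartAt_source _)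
    ((isSmoothForm_iff_contDiffAt η).1 h _)

theorem IsSmoothForm.contDiffOn {η : DiffForm n M q} (h : IsSmoothForm η) (c : M) :
    ContDiffOn ℝ ∞ (localForm c η) (extChartAt (𝓡 n) c).target :=
  fun _ hy => (h.contDiffAt hy).contDiffWithinAt

theorem isSmoothForm_of_contDiffAt {η : DiffForm n M q}
    (h : ∀ (c : M) (y : EuclideanSpace ℝ (Fin n)), y ∈ (extChartAt (𝓡 n) c).target →
      ContDiffAt ℝ ∞ (localForm c η) y) : IsSmoothForm η :=
  (isSmoothForm_iff_contDiffAt η).2 fun x => h x _ (mem_extChartAt_target x)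

/-- The exterior derivative can be computed in any chart. -/
theorem localForm_extD {η : DiffForm n M q} (h : IsSmoothForm η) {c : M}
    {y : EuclideanSpace ℝ (Fin n)} (hy : y ∈ (extChartAt (𝓡 n) c).target) :
    localForm c (extD η) y = extDeriv (localForm c η) y := by
  -- `extD` at the point `x` is computed in the preferred chart at `x`, so the claim compares that
  -- chart with the one at `c`: it is naturality of the exterior derivative under the coordinate
  -- change.
  set x := (extChartAt (𝓡 n) c).symm y with hx
  have hy' : (extChartAt (𝓡 n) c).symm y ∈ (extChartAt (𝓡 n) x).source := mem_extChartAt_source _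
  have h1 : localForm c η =ᶠ[nhds y] fun z =>
      (localForm x η (chartTrans c x z)).compContinuousLinearMap (fderiv ℝ (chartTrans c x) z) :=
    (eventually_chart_overlap hy hy').mono fun z hz => localForm_chartTrans η hz.1 hz.2
  have h2 : DifferentiableAt ℝ (localForm x η) (chartTrans c x y) :=
    (h.contDiffAt (mem_extChartAt_target x)).differentiableAt (by simp)
  rw [h1.extDeriv_eq, extDeriv_pullback h2 (contDiffAt_chartTrans hy hy') (by rw [minSmoothness_of_isRCLikeNormedField]; exact WithTop.coe_le_coe.2 (le_top : (2 : ℕ∞) ≤ ⊤)),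
    ← chartDerivAt_comp_chartInvDeriv hy hy']
  rfl

theorem contDiffAt_comp_extChartAt_symm {f : M → ℝ} (hf : ContMDiff (𝓡 n) 𝓘(ℝ, ℝ) ∞ f) {c : M}
    {y : EuclideanSpace ℝ (Fin n)} (hy : y ∈ (extChartAt (𝓡 n) c).target) :
    ContDiffAt ℝ ∞ (fun z => f ((extChartAt (𝓡 n) c).symm z)) y :=
  contMDiffAt_iff_contDiffAt.1 (hf.contMDiffAt.comp y (contMDiffAt_extChartAt_symm c hy))

theorem localForm_wedge_mvfderiv {f : M → ℝ} (hf : ContMDiff (𝓡 n) 𝓘(ℝ, ℝ) ∞ f)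
    (η : DiffForm n M q) {c : M}
    {y : EuclideanSpace ℝ (Fin n)} (hy : y ∈ (extChartAt (𝓡 n) c).target) :
    localForm c (fun x => wedge (mvfderiv (𝓡 n) f x) (η x)) y =
      wedge (fderiv ℝ (fun z => f ((extChartAt (𝓡 n) c).symm z)) y) (localForm c η y) := by
  rw [localForm, wedge_compContinuousLinearMap, mvfderiv_comp_chartInvDeriv hy
    (hf.mdifferentiableAt (by simp))]
  rfl

theorem localForm_interior (X : (x : M) → TangentSpace (𝓡 n) x) (η : DiffForm n M (q + 1)) {c : M}
    {y : EuclideanSpace ℝ (Fin n)} (hy : y ∈ (extChartAt (𝓡 n) c).target) :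
    localForm c (fun x => interior (X x) (η x)) y =
      interior (chartDerivAt c _ (X ((extChartAt (𝓡 n) c).symm y))) (localForm c η y) := by
  have h : chartInvDeriv c y (chartDerivAt c _ (X ((extChartAt (𝓡 n) c).symm y))) =
      X ((extChartAt (𝓡 n) c).symm y) :=
    DFunLike.congr_fun (F := _ →L[ℝ] _) (chartInvDeriv_comp c hy) _
  rw [localForm, localForm, ← interior_compContinuousLinearMap, h]

theorem IsSmoothForm.add {η ξ : DiffForm n M q} (hη : IsSmoothForm η) (hξ : IsSmoothForm ξ) :
    IsSmoothForm (η + ξ) :=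
  isSmoothForm_of_contDiffAt fun _ _ hy => (hη.contDiffAt hy).add (hξ.contDiffAt hy)

theorem IsSmoothForm.sub {η ξ : DiffForm n M q} (hη : IsSmoothForm η) (hξ : IsSmoothForm ξ) :
    IsSmoothForm (η - ξ) :=
  isSmoothForm_of_contDiffAt fun _ _ hy => (hη.contDiffAt hy).sub (hξ.contDiffAt hy)

theorem isSmoothForm_zero : IsSmoothForm (0 : DiffForm n M q) :=
  isSmoothForm_of_contDiffAt fun _ _ _ => contDiffAt_const (c := 0)

theorem IsSmoothForm.smul_fun {η : DiffForm n M q} (hη : IsSmoothForm η) {f : M → ℝ}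
    (hf : ContMDiff (𝓡 n) 𝓘(ℝ, ℝ) ∞ f) : IsSmoothForm fun x => f x • η x :=
  isSmoothForm_of_contDiffAt fun _ _ hy =>
    (contDiffAt_comp_extChartAt_symm hf hy).smul (hη.contDiffAt hy)

theorem IsSmoothForm.const_smul {η : DiffForm n M q} (hη : IsSmoothForm η) (a : ℝ) :
    IsSmoothForm (a • η) :=
  hη.smul_fun (f := fun _ => a) contMDiff_const

theorem IsSmoothForm.sum {ι : Type*} {s : Finset ι} {η : ι → DiffForm n M q}
    (h : ∀ i ∈ s, IsSmoothForm (η i)) : IsSmoothForm (∑ i ∈ s, η i) := by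
  classical
  induction s using Finset.induction_on with
  | empty => exact isSmoothForm_zero
  | insert i s hi ih =>
    rw [Finset.sum_insert hi]
    exact (h i (Finset.mem_insert_self i s)).add
      (ih fun j hj => h j (Finset.mem_insert_of_mem hj))

theorem IsSmoothForm.extD {η : DiffForm n M q} (hη : IsSmoothForm η) :
    IsSmoothForm (extD η) :=
  isSmoothForm_of_contDiffAt fun c y hy => by
    refine (contDiffAt_extDeriv (hη.contDiffAt hy)).congr_of_eventuallyEq ?_
    filter_upwards [(extChartAt_target_isOpen c).mem_nhds hy] with z hz
    exact localForm_extD hη hz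

theorem IsSmoothForm.wedge_mvfderiv {η : DiffForm n M q} (hη : IsSmoothForm η) {f : M → ℝ}
    (hf : ContMDiff (𝓡 n) 𝓘(ℝ, ℝ) ∞ f) :
    IsSmoothForm fun x => wedge (mvfderiv (𝓡 n) f x) (η x) :=
  isSmoothForm_of_contDiffAt fun c y hy => by
    have h1 : ContDiffAt ℝ ∞ (fun w => wedge
        (fderiv ℝ (fun z => f ((extChartAt (𝓡 n) c).symm z)) w) (localForm c η w)) y :=
      contDiffWithinAt_form_wedge (s := Set.univ)
        ((contDiffAt_comp_extChartAt_symm hf hy).fderiv_right (m := ∞) (by simp))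
        (hη.contDiffAt hy)
    refine h1.congr_of_eventuallyEq ?_
    filter_upwards [(extChartAt_target_isOpen c).mem_nhds hy] with z hz
    exact localForm_wedge_mvfderiv hf η hz

theorem extD_add {η ξ : DiffForm n M q} (hη : IsSmoothForm η) (hξ : IsSmoothForm ξ) :
    extD (η + ξ) = extD η + extD ξ := by
  funext x
  refine eq_of_localForm_eq (mem_extChartAt_source x) ?_
  have hy := mem_extChartAt_target (I := 𝓡 n) x
  rw [localForm_extD (hη.add hξ) hy, localForm_add, localForm_extD hη hy, localForm_extD hξ hy]
  exact extDeriv_add ((hη.contDiffAt hy).differentiableAt (by simp))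
    ((hξ.contDiffAt hy).differentiableAt (by simp))

/-- The Leibniz rule for the product of a function and a form. -/
theorem extD_smul_fun {η : DiffForm n M q} (hη : IsSmoothForm η) {f : M → ℝ}
    (hf : ContMDiff (𝓡 n) 𝓘(ℝ, ℝ) ∞ f) (x : M) :
    extD (fun x => f x • η x) x = f x • extD η x + wedge (mvfderiv (𝓡 n) f x) (η x) := by
  have hy := mem_extChartAt_target (I := 𝓡 n) x
  refine eq_of_localForm_eq (η := extD (fun x => f x • η x))
    (ξ := (fun x => f x • extD η x) + fun x => wedge (mvfderiv (𝓡 n) f x) (η x))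
    (mem_extChartAt_source x) ?_
  rw [localForm_add, localForm_smul, localForm_extD (hη.smul_fun hf) hy, localForm_extD hη hy,
    localForm_wedge_mvfderiv hf η hy]
  exact extDeriv_smul_fun ((contDiffAt_comp_extChartAt_symm hf hy).differentiableAt (by simp))
    ((hη.contDiffAt hy).differentiableAt (by simp))

theorem extD_const_smul {η : DiffForm n M q} (hη : IsSmoothForm η) (a : ℝ) :
    extD (a • η) = a • extD η := by
  funext x
  refine eq_of_localForm_eq (mem_extChartAt_source x) ?_
  have hy := mem_extChartAt_target (I := 𝓡 n) x
  rw [localForm_extD (hη.const_smul a) hy]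
  change extDeriv (fun z => a • localForm x η z) _ = a • localForm x (extD η) _
  rw [localForm_extD hη hy]
  exact extDeriv_smul a _

end LocalForms

end Witten
end

noncomputable section
namespace Witten

/-! ### Smoothness of determinants and matrix inverses -/

section MatrixSmoothness

variable {n : ℕ} {F : Type*} [NormedAddCommGroup F] [NormedSpace ℝ F]

theorem contDiffWithinAt_det {k : WithTop ℕ∞} {A : F → Matrix (Fin n) (Fin n) ℝ} {s : Set F} {y : F}
    (h : ∀ i j, ContDiffWithinAt ℝ k (fun z => A z i j) s y) :
    ContDiffWithinAt ℝ k (fun z => (A z).det) s y := by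
  simp only [Matrix.det_apply']
  exact ContDiffWithinAt.sum fun σ _ => contDiffWithinAt_const.mul
    (contDiffWithinAt_prod fun i _ => h _ _)

theorem contDiffWithinAt_matrix_inv {k : WithTop ℕ∞} {A : F → Matrix (Fin n) (Fin n) ℝ} {s : Set F}
    {y : F} (h : ∀ i j, ContDiffWithinAt ℝ k (fun z => A z i j) s y) (hy : (A y).det ≠ 0)
    (i j : Fin n) : ContDiffWithinAt ℝ k (fun z => (A z)⁻¹ i j) s y := by
  simp only [Matrix.inv_def, Matrix.smul_apply, smul_eq_mul, Ring.inverse_eq_inv',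
    Matrix.adjugate_apply]
  refine ((contDiffWithinAt_det h).inv hy).mul (contDiffWithinAt_det fun a b => ?_)
  by_cases ha : a = j
  · subst ha
    simpa using contDiffWithinAt_const
  · simpa [ha] using h a b

end MatrixSmoothness

/-! ### Extension by zero of forms given in a chart -/

section ExtendForm

variable {n q : ℕ} {M : Type*} [TopologicalSpace M] [ChartedSpace (EuclideanSpace ℝ (Fin n)) M]

open Classical in
/-- The form vanishing outside the domain of the chart at `c`, with prescribed expression in this
chart. -/
def extendForm (c : M)
    (w : EuclideanSpace ℝ (Fin n) → EuclideanSpace ℝ (Fin n) [⋀^Fin q]→L[ℝ] ℝ) : DiffForm n M q :=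
  fun x => if x ∈ (extChartAt (𝓡 n) c).source then
    (w (extChartAt (𝓡 n) c x)).compContinuousLinearMap
      (mvfderiv (𝓡 n) (extChartAt (𝓡 n) c) x) else 0

theorem extendForm_of_notMem {c x : M} (hx : x ∉ (extChartAt (𝓡 n) c).source)
    (w : EuclideanSpace ℝ (Fin n) → EuclideanSpace ℝ (Fin n) [⋀^Fin q]→L[ℝ] ℝ) :
    extendForm c w x = 0 := if_neg hx

theorem extendForm_eq_zero {c x : M}
    {w : EuclideanSpace ℝ (Fin n) → EuclideanSpace ℝ (Fin n) [⋀^Fin q]→L[ℝ] ℝ}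
    (hx : w (extChartAt (𝓡 n) c x) = 0) : extendForm c w x = 0 := by
  rw [extendForm]
  split_ifs
  · rw [hx]; rfl
  · rfl

variable [IsManifold (𝓡 n) ∞ M]

theorem localForm_extendForm (c : M)
    (w : EuclideanSpace ℝ (Fin n) → EuclideanSpace ℝ (Fin n) [⋀^Fin q]→L[ℝ] ℝ)
    {y : EuclideanSpace ℝ (Fin n)} (hy : y ∈ (extChartAt (𝓡 n) c).target) :
    localForm c (extendForm c w) y = w y := by
  rw [localForm, extendForm, if_pos ((extChartAt (𝓡 n) c).map_target hy),
    (extChartAt (𝓡 n) c).right_inv hy]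
  ext v
  simp only [ContinuousAlternatingMap.compContinuousLinearMap_apply]
  congr 1
  ext1 i
  exact DFunLike.congr_fun (F := _ →L[ℝ] _) (chartDerivAt_comp c hy) (v i)

omit [IsManifold (𝓡 n) ∞ M] in
-- The image of `K` in `M` is compact, hence closed since `M` is Hausdorff, and it does not contain
-- `x`. Off this image the extended form vanishes.
theorem extendForm_eventuallyEq_zero [T2Space M] {c x : M}
    {w : EuclideanSpace ℝ (Fin n) → EuclideanSpace ℝ (Fin n) [⋀^Fin q]→L[ℝ] ℝ}
    {K : Set (EuclideanSpace ℝ (Fin n))} (hK : IsCompact K)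
    (hKt : K ⊆ (extChartAt (𝓡 n) c).target)
    (h0 : ∀ y ∈ (extChartAt (𝓡 n) c).target, y ∉ K → w y = 0)
    (hx : x ∉ (extChartAt (𝓡 n) c).source) :
    ∀ᶠ z in nhds x, extendForm c w z = 0 := by
  have hc : IsCompact ((extChartAt (𝓡 n) c).symm '' K) :=
    hK.image_of_continuousOn ((continuousOn_extChartAt_symm c).mono hKt)
  have hxK : x ∈ ((extChartAt (𝓡 n) c).symm '' K)ᶜ := by
    rintro ⟨y, hy, rfl⟩
    exact hx ((extChartAt (𝓡 n) c).map_target (hKt hy))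
  filter_upwards [hc.isClosed.isOpen_compl.mem_nhds hxK] with z hz
  by_cases hzs : z ∈ (extChartAt (𝓡 n) c).source
  · refine extendForm_eq_zero (h0 _ ((extChartAt (𝓡 n) c).map_source hzs) fun h => hz ?_)
    exact ⟨_, h, (extChartAt (𝓡 n) c).left_inv hzs⟩
  · exact extendForm_of_notMem hzs w

theorem eventually_extChartAt_symm {x : M} {p : M → Prop} (h : ∀ᶠ z in nhds x, p z) :
    ∀ᶠ y in nhds (extChartAt (𝓡 n) x x), p ((extChartAt (𝓡 n) x).symm y) := by
  have hcont := (contMDiffAt_extChartAt_symm x (mem_extChartAt_target (I := 𝓡 n) x)).continuousAt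
  refine hcont.eventually ?_
  have hs : (extChartAt (𝓡 n) x).symm (extChartAt (𝓡 n) x x) = x := extChartAt_to_inv x
  rwa [hs]

theorem isSmoothForm_extendForm [T2Space M] {c : M}
    {w : EuclideanSpace ℝ (Fin n) → EuclideanSpace ℝ (Fin n) [⋀^Fin q]→L[ℝ] ℝ}
    {K : Set (EuclideanSpace ℝ (Fin n))} (hK : IsCompact K)
    (hKt : K ⊆ (extChartAt (𝓡 n) c).target)
    (hw : ContDiffOn ℝ ∞ w (extChartAt (𝓡 n) c).target)
    (h0 : ∀ y ∈ (extChartAt (𝓡 n) c).target, y ∉ K → w y = 0) :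
    IsSmoothForm (extendForm c w) := by
  refine isSmoothForm_of_local fun x => ?_
  by_cases hx : x ∈ (extChartAt (𝓡 n) c).source
  · refine ⟨c, hx, ?_⟩
    have hy := (extChartAt (𝓡 n) c).map_source hx
    have ht := (extChartAt_target_isOpen c).mem_nhds hy
    refine (hw.contDiffAt ht).congr_of_eventuallyEq ?_
    filter_upwards [ht] with z hz using localForm_extendForm c w hz
  · refine ⟨x, mem_extChartAt_source x, ?_⟩
    refine (contDiffAt_const (c := 0)).congr_of_eventuallyEq ?_
    filter_upwards [eventually_extChartAt_symm (extendForm_eventuallyEq_zero hK hKt h0 hx)] with z hz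
    rw [localForm, hz]
    rfl

end ExtendForm

/-! ### The gradient in coordinates -/

section Gradient

variable {n q : ℕ} {M : Type*} [TopologicalSpace M] [ChartedSpace (EuclideanSpace ℝ (Fin n)) M]
  [IsManifold (𝓡 n) ∞ M] (g : RMetric n M)

/-- The matrix `g^{ij}` in the chart at `c`. -/
def cometricCoeff (c : M) (y : EuclideanSpace ℝ (Fin n)) : Matrix (Fin n) (Fin n) ℝ :=
  (metricCoeff g c y)⁻¹

theorem contDiffOn_cometricCoeff (c : M) (i j : Fin n) :
    ContDiffOn ℝ ∞ (fun y => cometricCoeff g c y i j) (extChartAt (𝓡 n) c).target :=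
  fun y hy => contDiffWithinAt_matrix_inv (fun i j => contDiffOn_metricCoeff g c i j y hy)
    (metricCoeff_det_pos g c hy).ne' i j

theorem bilin_eq_sum_repr {V : Type*} [AddCommGroup V] [Module ℝ V] (B : LinearMap.BilinForm ℝ V)
    (b : Module.Basis (Fin n) ℝ V) (v w : V) :
    B v w = ∑ i, ∑ j, b.repr v i * b.repr w j * B (b i) (b j) := by
  conv_lhs => rw [← b.sum_repr v, ← b.sum_repr w]
  simp only [map_sum, map_smul, LinearMap.sum_apply, LinearMap.smul_apply, smul_eq_mul, mul_assoc,
    Finset.mul_sum]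
  rw [Finset.sum_comm]
  exact Finset.sum_congr rfl fun _ _ => Finset.sum_congr rfl fun _ _ => by ring

theorem coordBasis_repr (c : M) {y : EuclideanSpace ℝ (Fin n)}
    (hy : y ∈ (extChartAt (𝓡 n) c).target)
    (v : TangentSpace (𝓡 n) ((extChartAt (𝓡 n) c).symm y)) (i : Fin n) :
    (coordBasis c hy).repr v i = chartDerivAt c _ v i := rfl

/-- The metric in a chart. -/
theorem inner_eq_sum_metricCoeff (c : M) {y : EuclideanSpace ℝ (Fin n)}
    (hy : y ∈ (extChartAt (𝓡 n) c).target) {x : M} (hx : (extChartAt (𝓡 n) c).symm y = x)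
    (v w : TangentSpace (𝓡 n) x) :
    g.inner x v w = ∑ i, ∑ j, chartDerivAt c x v i * chartDerivAt c x w j *
      metricCoeff g c y i j := by
  subst hx
  have h := bilin_eq_sum_repr (bilin g _) (coordBasis c hy) v w
  simp only [bilin_apply, coordBasis_repr, coordBasis_apply] at h
  exact h

/-- A vector field read in the chart at `c`. -/
def localField (c : M) (X : (x : M) → TangentSpace (𝓡 n) x) (y : EuclideanSpace ℝ (Fin n)) :
    EuclideanSpace ℝ (Fin n) :=
  chartDerivAt c _ (X ((extChartAt (𝓡 n) c).symm y))

/-- The gradient of a function. -/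
def gradient (f : M → ℝ) (x : M) : TangentSpace (𝓡 n) x := sharp g x (mvfderiv (𝓡 n) f x)

variable {f : M → ℝ} (hf : ContMDiff (𝓡 n) 𝓘(ℝ, ℝ) ∞ f)
include hf

/-- This is `g(∂_i, ∇f) = ∂_i f` in coordinates. The lowered form `G X = ∂f` is the one
differentiated later to obtain the Hessian. -/
theorem sum_metricCoeff_gradient {c : M} {y : EuclideanSpace ℝ (Fin n)}
    (hy : y ∈ (extChartAt (𝓡 n) c).target) (i : Fin n) :
    ∑ j, metricCoeff g c y i j * localField c (gradient g f) y j =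
      partialD i (fun z => f ((extChartAt (𝓡 n) c).symm z)) y := by
  have h1 : ∀ k, chartDerivAt c _ (coordVec c y k) = EuclideanSpace.single k (1 : ℝ) := fun k =>
    DFunLike.congr_fun (F := _ →L[ℝ] _) (chartDerivAt_comp c hy) _
  have h2 := inner_sharp g _ (mvfderiv (𝓡 n) f ((extChartAt (𝓡 n) c).symm y)) (coordVec c y i)
  rw [g.symm, inner_eq_sum_metricCoeff g c hy rfl] at h2
  rw [partialD, ← mvfderiv_comp_chartInvDeriv hy (hf.mdifferentiableAt (by simp))]
  refine Eq.trans ?_ h2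
  symm
  rw [h1, Finset.sum_eq_single i]
  · refine Finset.sum_congr rfl fun j _ => ?_
    rw [PiLp.single_apply, if_pos rfl, one_mul, mul_comm]
    rfl
  · intro j _ hj
    refine Finset.sum_eq_zero fun k _ => ?_
    rw [PiLp.single_apply, if_neg hj, zero_mul, zero_mul]
  · simp

theorem localField_gradient {c : M} {y : EuclideanSpace ℝ (Fin n)}
    (hy : y ∈ (extChartAt (𝓡 n) c).target) (k : Fin n) :
    localField c (gradient g f) y k = ∑ i, cometricCoeff g c y k i *
      partialD i (fun z => f ((extChartAt (𝓡 n) c).symm z)) y := by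
  have h : (fun i => partialD i (fun z => f ((extChartAt (𝓡 n) c).symm z)) y) =
      (metricCoeff g c y).mulVec (localField c (gradient g f) y) := by
    ext i
    exact (sum_metricCoeff_gradient g hf hy i).symm
  have h2 : (cometricCoeff g c y).mulVec
      (fun i => partialD i (fun z => f ((extChartAt (𝓡 n) c).symm z)) y) =
      localField c (gradient g f) y := by
    rw [h, Matrix.mulVec_mulVec, cometricCoeff, Matrix.nonsing_inv_mul, Matrix.one_mulVec]
    exact (metricCoeff_det_pos g c hy).ne'.isUnit
  exact (congrFun h2 k).symm

theorem contDiffOn_localField_gradient (c : M) :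
    ContDiffOn ℝ ∞ (localField c (gradient g f)) (extChartAt (𝓡 n) c).target := by
  refine contDiffOn_euclidean.2 fun k => ?_
  refine ContDiffOn.congr ?_ fun y hy => localField_gradient g hf hy k
  refine ContDiffOn.sum fun i _ => (contDiffOn_cometricCoeff g c k i).mul fun y hy => ?_
  exact (((contDiffAt_comp_extChartAt_symm hf hy).fderiv_right (m := ∞) (by simp)).clm_apply
    contDiffAt_const).contDiffWithinAt

theorem IsSmoothForm.interior_gradient {η : DiffForm n M (q + 1)} (hη : IsSmoothForm η) :
    IsSmoothForm fun x => interior (gradient g f x) (η x) :=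
  isSmoothForm_of_contDiffAt fun c y hy => by
    have ht := (extChartAt_target_isOpen c).mem_nhds hy
    have h1 : ContDiffAt ℝ ∞
        (fun w => interior (localField c (gradient g f) w) (localForm c η w)) y :=
      contDiffWithinAt_form_interior (s := Set.univ)
        ((contDiffOn_localField_gradient g hf c).contDiffAt ht) (hη.contDiffAt hy)
    refine h1.congr_of_eventuallyEq ?_
    filter_upwards [ht] with z hz
    exact localForm_interior _ η hz

end Gradient

end Witten
end

noncomputable section
namespace Witten

/-! ### The Riemannian measure in charts -/

section Volume

open MeasureTheory

variable {n q : ℕ} {M : Type*} [TopologicalSpace M] [ChartedSpace (EuclideanSpace ℝ (Fin n)) M]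
  [IsManifold (𝓡 n) ∞ M] (g : RMetric n M)

/-- The Riemannian density in the chart at `c`. -/
def volDensity (c : M) (y : EuclideanSpace ℝ (Fin n)) : ℝ := √|(metricCoeff g c y).det|

theorem metricCoeff_chartTrans {c c' : M} {y : EuclideanSpace ℝ (Fin n)}
    (hy : y ∈ (extChartAt (𝓡 n) c).target)
    (hy' : (extChartAt (𝓡 n) c).symm y ∈ (extChartAt (𝓡 n) c').source) :
    metricCoeff g c y =
      (LinearMap.toMatrix (EuclideanSpace.basisFun (Fin n) ℝ).toBasis
        (EuclideanSpace.basisFun (Fin n) ℝ).toBasis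
        (fderiv ℝ (chartTrans c c') y).toLinearMap).transpose *
      metricCoeff g c' (chartTrans c c' y) *
      LinearMap.toMatrix (EuclideanSpace.basisFun (Fin n) ℝ).toBasis
        (EuclideanSpace.basisFun (Fin n) ℝ).toBasis
        (fderiv ℝ (chartTrans c c') y).toLinearMap := by
  ext i j
  have h1 : ∀ k, chartDerivAt c' _ (coordVec c y k) =
      fderiv ℝ (chartTrans c c') y (EuclideanSpace.single k 1) := fun k =>
    DFunLike.congr_fun (F := _ →L[ℝ] _) (chartDerivAt_comp_chartInvDeriv hy hy') _
  have h2 : metricCoeff g c y i j = _ := inner_eq_sum_metricCoeff g c'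
    (y := chartTrans c c' y) ((extChartAt (𝓡 n) c').map_source hy')
    ((extChartAt (𝓡 n) c').left_inv hy') (coordVec c y i) (coordVec c y j)
  rw [h2, h1, h1]
  simp only [Matrix.mul_apply, Matrix.transpose_apply, LinearMap.toMatrix_apply,
    Finset.sum_mul]
  rw [Finset.sum_comm]
  refine Finset.sum_congr rfl fun a _ => Finset.sum_congr rfl fun b _ => ?_
  simp only [OrthonormalBasis.coe_toBasis, EuclideanSpace.basisFun_apply,
    OrthonormalBasis.coe_toBasis_repr_apply, EuclideanSpace.basisFun_repr]
  change _ = (fderiv ℝ (chartTrans c c') y) (EuclideanSpace.single i 1) b * _ *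
    (fderiv ℝ (chartTrans c c') y) (EuclideanSpace.single j 1) a
  ring

/-- From `G = Jᵀ G' J`, with `J` the Jacobian of the coordinate change, `det G = (det J)² det G'`.
-/
theorem volDensity_chartTrans {c c' : M} {y : EuclideanSpace ℝ (Fin n)}
    (hy : y ∈ (extChartAt (𝓡 n) c).target)
    (hy' : (extChartAt (𝓡 n) c).symm y ∈ (extChartAt (𝓡 n) c').source) :
    volDensity g c y =
      |(fderiv ℝ (chartTrans c c') y).det| * volDensity g c' (chartTrans c c' y) := by
  rw [volDensity, metricCoeff_chartTrans g hy hy', Matrix.det_mul, Matrix.det_mul,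
    Matrix.det_transpose, LinearMap.det_toMatrix, volDensity, ContinuousLinearMap.det,
    show ∀ a b : ℝ, a * b * a = a ^ 2 * b from fun a b => by ring, abs_mul, abs_pow,
    Real.sqrt_mul (by positivity), Real.sqrt_sq (abs_nonneg _)]

theorem contDiffOn_volDensity (c : M) :
    ContDiffOn ℝ ∞ (volDensity g c) (extChartAt (𝓡 n) c).target := by
  have h : ContDiffOn ℝ ∞ (fun y => √(metricCoeff g c y).det) (extChartAt (𝓡 n) c).target :=
    fun y hy => (contDiffWithinAt_det fun i j => contDiffOn_metricCoeff g c i j y hy).sqrt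
      (metricCoeff_det_pos g c hy).ne'
  exact h.congr fun y hy => by rw [volDensity, abs_of_pos (metricCoeff_det_pos g c hy)]

theorem volDensity_pos (c : M) {y : EuclideanSpace ℝ (Fin n)}
    (hy : y ∈ (extChartAt (𝓡 n) c).target) : 0 < volDensity g c y :=
  Real.sqrt_pos.2 (abs_pos.2 (metricCoeff_det_pos g c hy).ne')

variable [MeasurableSpace M] [BorelSpace M]

omit [IsManifold (𝓡 n) ∞ M] in
theorem measurableSet_extChartAt_symm_preimage (c : M) {s : Set M} (hs : MeasurableSet s) :
    MeasurableSet ((extChartAt (𝓡 n) c).symm ⁻¹' s ∩ (extChartAt (𝓡 n) c).target) := by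
  have h1 := (continuousOn_iff_continuous_domRestrict.1
    (continuousOn_extChartAt_symm (I := 𝓡 n) c)).measurable hs
  have h2 := (extChartAt_target_isOpen (n := n) c).measurableSet.subtype_image h1
  convert h2 using 1
  ext y
  simp [and_comm]

omit [IsManifold (𝓡 n) ∞ M] in
theorem aemeasurable_extChartAt_symm (c : M) (f : EuclideanSpace ℝ (Fin n) → ENNReal) :
    AEMeasurable (extChartAt (𝓡 n) c).symm
      ((volume.restrict (extChartAt (𝓡 n) c).target).withDensity f) :=
  ((continuousOn_extChartAt_symm c).aemeasurable
    (extChartAt_target_isOpen c).measurableSet).mono_ac (withDensity_absolutelyContinuous _ _)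

theorem chartVolume_apply (c : M) {s : Set M} (hs : MeasurableSet s) :
    chartVolume g c s =
      ∫⁻ y in (extChartAt (𝓡 n) c).symm ⁻¹' s ∩ (extChartAt (𝓡 n) c).target,
        ENNReal.ofReal (volDensity g c y) := by
  rw [chartVolume, Measure.map_apply_of_aemeasurable (aemeasurable_extChartAt_symm c _) hs,
    withDensity_apply', Measure.restrict_restrict' (extChartAt_target_isOpen c).measurableSet]
  rfl

theorem chartVolume_compl_source (c : M) :
    chartVolume g c (extChartAt (𝓡 n) c).sourceᶜ = 0 := by
  rw [chartVolume_apply g c (isOpen_extChartAt_source c).measurableSet.compl]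
  have : (extChartAt (𝓡 n) c).symm ⁻¹' (extChartAt (𝓡 n) c).sourceᶜ ∩
      (extChartAt (𝓡 n) c).target = ∅ := by
    ext y
    simp only [Set.mem_inter_iff, Set.mem_preimage, Set.mem_compl_iff, Set.mem_empty_iff_false,
      iff_false, not_and]
    exact fun h hy => h ((extChartAt (𝓡 n) c).map_target hy)
  rw [this]
  simp

/-- The change of variables formula: the Jacobian factor is exactly the one relating the two
densities. -/
theorem chartVolume_eq_of_subset {c c' : M} {s : Set M} (hs : MeasurableSet s)
    (hc : s ⊆ (extChartAt (𝓡 n) c).source) (hc' : s ⊆ (extChartAt (𝓡 n) c').source) :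
    chartVolume g c s = chartVolume g c' s := by
  rw [chartVolume_apply g c hs, chartVolume_apply g c' hs]
  set A := (extChartAt (𝓡 n) c).symm ⁻¹' s ∩ (extChartAt (𝓡 n) c).target with hA
  have himage : (extChartAt (𝓡 n) c').symm ⁻¹' s ∩ (extChartAt (𝓡 n) c').target =
      chartTrans c c' '' A := by
    ext z
    constructor
    · rintro ⟨h1, h2⟩
      refine ⟨chartTrans c' c z, ⟨?_, (extChartAt (𝓡 n) c).map_source (hc h1)⟩, ?_⟩
      · rw [Set.mem_preimage, chartTrans, (extChartAt (𝓡 n) c).left_inv (hc h1)]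
        exact h1
      · rw [chartTrans, chartTrans, (extChartAt (𝓡 n) c).left_inv (hc h1),
          (extChartAt (𝓡 n) c').right_inv h2]
    · rintro ⟨y, ⟨h1, h2⟩, rfl⟩
      refine ⟨?_, (extChartAt (𝓡 n) c').map_source (hc' h1)⟩
      rw [Set.mem_preimage, chartTrans, (extChartAt (𝓡 n) c').left_inv (hc' h1)]
      exact h1
  have hinj : Set.InjOn (chartTrans c c') A := by
    rintro y ⟨h1, h2⟩ z ⟨h3, h4⟩ h
    have h5 := (extChartAt (𝓡 n) c').injOn (hc' h1) (hc' h3) h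
    rw [← (extChartAt (𝓡 n) c).right_inv h2, h5, (extChartAt (𝓡 n) c).right_inv h4]
  rw [himage, lintegral_image_eq_lintegral_abs_det_fderiv_mul volume
    (measurableSet_extChartAt_symm_preimage c hs)
    (fun y hy => ((contDiffAt_chartTrans hy.2 (hc' hy.1)).differentiableAt
      (by simp)).hasFDerivAt.hasFDerivWithinAt) hinj]
  refine setLIntegral_congr_fun (measurableSet_extChartAt_symm_preimage c hs) fun y hy => ?_
  rw [volDensity_chartTrans g hy.2 (hc' hy.1), ENNReal.ofReal_mul (abs_nonneg _)]

theorem chartVolume_restrict_comm (c c' : M) :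
    (chartVolume g c).restrict (extChartAt (𝓡 n) c').source =
      (chartVolume g c').restrict (extChartAt (𝓡 n) c).source := by
  ext s hs
  have hm := fun a : M => (isOpen_extChartAt_source (I := 𝓡 n) a).measurableSet
  have h : ∀ a b : M, chartVolume g a (s ∩ (extChartAt (𝓡 n) b).source) =
      chartVolume g a (s ∩ (extChartAt (𝓡 n) b).source ∩ (extChartAt (𝓡 n) a).source) := by
    intro a b
    exact (measure_inter_conull (chartVolume_compl_source g a)).symm
  rw [Measure.restrict_apply hs, Measure.restrict_apply hs, h, h, Set.inter_right_comm s
    (extChartAt (𝓡 n) c).source]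
  exact chartVolume_eq_of_subset g ((hs.inter (hm _)).inter (hm _)) (fun x hx => hx.2)
    fun x hx => hx.1.2

variable [T2Space M] [CompactSpace M]

theorem finite_chartPartition_support (n : ℕ) (M : Type*) [TopologicalSpace M]
    [ChartedSpace (EuclideanSpace ℝ (Fin n)) M] [IsManifold (𝓡 n) ∞ M] [T2Space M]
    [CompactSpace M] :
    {c : M | (Function.support (chartPartition n M c)).Nonempty}.Finite :=
  (chartPartition n M).locallyFinite.finite_nonempty_of_compact

/-- The finitely many indices of the non-trivial members of the partition of unity. -/
def chartIndices (n : ℕ) (M : Type*) [TopologicalSpace M]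
    [ChartedSpace (EuclideanSpace ℝ (Fin n)) M] [IsManifold (𝓡 n) ∞ M] [T2Space M]
    [CompactSpace M] : Finset M := (finite_chartPartition_support n M).toFinset

omit [MeasurableSpace M] [BorelSpace M] in
theorem chartPartition_eq_zero {c : M} (hc : c ∉ chartIndices n M) (x : M) :
    chartPartition n M c x = 0 := by
  by_contra h
  exact hc ((finite_chartPartition_support n M).mem_toFinset.2 ⟨x, h⟩)

omit [MeasurableSpace M] [BorelSpace M] in
theorem sum_chartPartition (x : M) : ∑ c ∈ chartIndices n M, chartPartition n M c x = 1 := by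
  rw [← (chartPartition n M).sum_eq_one (Set.mem_univ x)]
  refine (finsum_eq_sum_of_support_subset _ fun c hc => ?_).symm
  by_contra h
  exact hc (chartPartition_eq_zero h x)

omit [MeasurableSpace M] [BorelSpace M] in
theorem tsupport_chartPartition_subset (c : M) :
    tsupport (chartPartition n M c) ⊆ (extChartAt (𝓡 n) c).source := by
  rw [extChartAt_source]
  exact (SmoothPartitionOfUnity.exists_isSubordinate_chartAt_source (𝓡 n) M).choose_spec c

/-- On overlaps the chart measures agree, so every summand of the glued measure may be rewritten
with the chart at `c`; the partition functions then add up to one. This makes the global integral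
computable in a single chart. -/
theorem riemVolume_restrict_source (c : M) :
    (riemVolume g).restrict (extChartAt (𝓡 n) c).source = chartVolume g c := by
  have hm := fun a : M => (isOpen_extChartAt_source (I := 𝓡 n) a).measurableSet
  have hρ : ∀ a : M, Measurable fun x => ENNReal.ofReal (chartPartition n M a x) := fun a =>
    ((chartPartition n M a).contMDiff.continuous.measurable).ennreal_ofReal
  ext s hs
  have h1 : ∀ a : M, ((chartVolume g a).withDensity
      fun x => ENNReal.ofReal (chartPartition n M a x)) (s ∩ (extChartAt (𝓡 n) c).source) =
      ∫⁻ x in s, ENNReal.ofReal (chartPartition n M a x) ∂(chartVolume g c) := by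
    intro a
    -- The partition function of `a` vanishes outside the chart at `a`, so the integral sees only
    -- the overlap, where both chart measures coincide.
    have h2 : ∫⁻ x in s, ENNReal.ofReal (chartPartition n M a x) ∂(chartVolume g c) =
        ∫⁻ x in s ∩ (extChartAt (𝓡 n) a).source, ENNReal.ofReal (chartPartition n M a x)
          ∂(chartVolume g c) := by
      rw [← Measure.restrict_restrict hs, ← lintegral_indicator hs, ← lintegral_indicator hs,
        ← lintegral_indicator (hm a)]
      refine lintegral_congr fun x => ?_
      by_cases hx : x ∈ (extChartAt (𝓡 n) a).source
      · rw [Set.indicator_of_mem hx]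
      · rw [Set.indicator_of_notMem hx]
        have : chartPartition n M a x = 0 := by
          by_contra h
          exact hx (tsupport_chartPartition_subset a (subset_tsupport _ h))
        simp [this]
    rw [withDensity_apply _ (hs.inter (hm c)), h2, ← Measure.restrict_restrict hs,
      chartVolume_restrict_comm, Measure.restrict_restrict hs]
  rw [Measure.restrict_apply hs, riemVolume, Measure.sum_apply _ (hs.inter (hm c))]
  simp only [h1]
  rw [tsum_eq_sum (s := chartIndices n M) fun a ha => by simp [chartPartition_eq_zero ha],
    ← lintegral_finsetSum _ fun a _ => hρ a]
  have h3 : ∀ x, ∑ a ∈ chartIndices n M, ENNReal.ofReal (chartPartition n M a x) = 1 := by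
    intro x
    rw [← ENNReal.ofReal_sum_of_nonneg fun a _ => (chartPartition n M).nonneg a x,
      sum_chartPartition, ENNReal.ofReal_one]
  simp [h3]

end Volume

end Witten
end

noncomputable section
namespace Witten

set_option maxSynthPendingDepth 3

/-! ### The pairing of forms as a continuous bilinear map -/

section Pairing

variable {n q : ℕ} {E : Type*} [NormedAddCommGroup E] [NormedSpace ℝ E]

/-- The pairing of forms in coordinates as a continuous bilinear map. -/
def coordPairing (q : ℕ) (K : Matrix (Fin n) (Fin n) ℝ) (e : Fin n → E) :
    (E [⋀^Fin q]→L[ℝ] ℝ) →L[ℝ] (E [⋀^Fin q]→L[ℝ] ℝ) →L[ℝ] ℝ :=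
  ∑ i : Fin q → Fin n, ∑ j : Fin q → Fin n, (((q ! : ℕ) : ℝ)⁻¹ * ∏ a, K (i a) (j a)) •
    (evalCLM fun a => e (i a)).smulRight (evalCLM fun a => e (j a))

theorem coordPairing_apply (K : Matrix (Fin n) (Fin n) ℝ) (e : Fin n → E)
    (α β : E [⋀^Fin q]→L[ℝ] ℝ) : coordPairing q K e α β = coordInner K e α β := by
  simp only [coordPairing, coordInner, _root_.sum_apply,
    _root_.smul_apply, ContinuousLinearMap.smulRight_apply, evalCLM_apply, smul_eq_mul,
    Finset.mul_sum, mul_assoc]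

theorem contDiffWithinAt_coordPairing {F : Type*} [NormedAddCommGroup F] [NormedSpace ℝ F]
    {k : WithTop ℕ∞} {K : F → Matrix (Fin n) (Fin n) ℝ} {s : Set F} {y : F} (e : Fin n → E)
    (h : ∀ i j, ContDiffWithinAt ℝ k (fun z => K z i j) s y) :
    ContDiffWithinAt ℝ k (fun z => coordPairing q (K z) e) s y :=
  ContDiffWithinAt.sum fun _ _ => ContDiffWithinAt.sum fun _ _ =>
    (contDiffWithinAt_const.mul (contDiffWithinAt_prod fun _ _ => h _ _)).smul
      contDiffWithinAt_const

end Pairing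

/-! ### Integration by parts and the fundamental lemma on open sets -/

section DivergenceTheorem

open MeasureTheory

variable {E : Type*} [NormedAddCommGroup E] [NormedSpace ℝ E]

theorem contDiff_indicator {F : Type*} [NormedAddCommGroup F] [NormedSpace ℝ F] {k : WithTop ℕ∞}
    {χ : E → F} {U K : Set E} (hU : IsOpen U) (hK : IsCompact K) (hKU : K ⊆ U)
    (hχ : ContDiffOn ℝ k χ U) (h0 : ∀ y ∈ U, y ∉ K → χ y = 0) :
    ContDiff ℝ k (U.indicator χ) := by
  rw [contDiff_iff_contDiffAt]
  intro y
  by_cases hy : y ∈ U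
  · refine (hχ.contDiffAt (hU.mem_nhds hy)).congr_of_eventuallyEq ?_
    filter_upwards [hU.mem_nhds hy] with z hz using Set.indicator_of_mem hz χ
  · refine (contDiffAt_const (c := 0)).congr_of_eventuallyEq ?_
    filter_upwards [hK.isClosed.isOpen_compl.mem_nhds fun h => hy (hKU h)] with z hz
    by_cases hzU : z ∈ U
    · rw [Set.indicator_of_mem hzU, h0 z hzU hz]
    · exact Set.indicator_of_notMem hzU χ

omit [NormedSpace ℝ E] in
theorem hasCompactSupport_indicator {F : Type*} [Zero F] {χ : E → F} {U K : Set E}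
    (hK : IsCompact K) (h0 : ∀ y ∈ U, y ∉ K → χ y = 0) : HasCompactSupport (U.indicator χ) := by
  refine HasCompactSupport.intro hK fun y hy => ?_
  by_cases hyU : y ∈ U
  · rw [Set.indicator_of_mem hyU, h0 y hyU hy]
  · exact Set.indicator_of_notMem hyU χ

variable [FiniteDimensional ℝ E] [MeasurableSpace E] [BorelSpace E] (μ : Measure E)
  [μ.IsAddHaarMeasure]

/-- Integration by parts against the constant function `1`. -/
theorem integral_fderiv_eq_zero_of_hasCompactSupport {χ : E → ℝ} (hχ : ContDiff ℝ 1 χ)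
    (hc : HasCompactSupport χ) (v : E) : ∫ y, fderiv ℝ χ y v ∂μ = 0 := by
  have h1 : Integrable (fun y => fderiv ℝ χ y v) μ :=
    ((hχ.continuous_fderiv (by simp)).clm_apply continuous_const).integrable_of_hasCompactSupport
      (hc.fderiv_apply ℝ v)
  have h2 : Integrable χ μ := hχ.continuous.integrable_of_hasCompactSupport hc
  have h := integral_mul_fderiv_eq_neg_fderiv_mul_of_integrable (μ := μ) (f := fun _ : E => (1 : ℝ))
    (g := χ) (v := v) (by simp) (by simpa using h1) (by simpa using h2)
    (fun _ _ => differentiableAt_const _) (fun y _ => hχ.differentiable (by simp) y)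
  simpa using h

/-- A function on the open set `U` that vanishes off a compact subset extends by zero to a compactly
supported function on the whole space, with the same derivative on `U`. -/
theorem setIntegral_fderiv_eq_zero {χ : E → ℝ} {U K : Set E} (hU : IsOpen U) (hK : IsCompact K)
    (hKU : K ⊆ U) (hχ : ContDiffOn ℝ 1 χ U) (h0 : ∀ y ∈ U, y ∉ K → χ y = 0) (v : E) :
    ∫ y in U, fderiv ℝ χ y v ∂μ = 0 := by
  have h1 : ∫ y in U, fderiv ℝ χ y v ∂μ = ∫ y in U, fderiv ℝ (U.indicator χ) y v ∂μ := by
    refine setIntegral_congr_fun hU.measurableSet fun y hy => ?_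
    have : χ =ᶠ[nhds y] U.indicator χ := by
      filter_upwards [hU.mem_nhds hy] with z hz using (Set.indicator_of_mem hz χ).symm
    rw [this.fderiv_eq]
  rw [h1, setIntegral_eq_integral_of_forall_compl_eq_zero]
  · exact integral_fderiv_eq_zero_of_hasCompactSupport μ (contDiff_indicator hU hK hKU hχ h0)
      (hasCompactSupport_indicator hK h0) v
  · intro y hy
    have : U.indicator χ =ᶠ[nhds y] fun _ => 0 := by
      filter_upwards [hK.isClosed.isOpen_compl.mem_nhds fun h => hy (hKU h)] with z hz
      by_cases hzU : z ∈ U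
      · rw [Set.indicator_of_mem hzU, h0 z hzU hz]
      · exact Set.indicator_of_notMem hzU χ
    rw [this.fderiv_eq]
    simp

omit [NormedSpace ℝ E] [FiniteDimensional ℝ E] in
theorem integrableOn_of_zero_off_compact {χ : E → ℝ} {U K : Set E} (hU : IsOpen U)
    (hK : IsCompact K) (hKU : K ⊆ U) (hχ : ContinuousOn χ U) (h0 : ∀ y ∈ U, y ∉ K → χ y = 0) :
    IntegrableOn χ U μ := by
  have h1 : IntegrableOn χ K μ := (hχ.mono hKU).integrableOn_compact hK
  exact h1.of_forall_sdiff_eq_zero hU.measurableSet fun y hy => h0 y hy.1 hy.2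

/-- The fundamental lemma of the calculus of variations for continuous functions. -/
theorem eq_zero_of_integral_contDiff_smul {χ : E → ℝ} {U : Set E} (hU : IsOpen U)
    (hχ : ContinuousOn χ U)
    (h : ∀ ψ : E → ℝ, ContDiff ℝ ∞ ψ → HasCompactSupport ψ → tsupport ψ ⊆ U →
      ∫ y in U, ψ y * χ y ∂μ = 0) {y : E} (hy : y ∈ U) : χ y = 0 := by
  have h1 : ∀ᵐ x ∂μ, x ∈ U → χ x = 0 := by
    refine hU.ae_eq_zero_of_integral_contDiff_smul_eq_zero
      (hχ.locallyIntegrableOn hU.measurableSet) fun ψ h1 h2 h3 => ?_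
    rw [← h ψ h1 h2 h3]
    refine (setIntegral_eq_integral_of_forall_compl_eq_zero fun x hx => ?_).symm
    rw [image_eq_zero_of_notMem_tsupport fun h => hx (h3 h), zero_smul]
  have h2 : χ =ᵐ[μ.restrict U] fun _ => 0 := (ae_restrict_iff' hU.measurableSet).2 h1
  exact Measure.eqOn_open_of_ae_eq h2 hU hχ continuousOn_const hy

end DivergenceTheorem

/-! ### The global inner product on smooth forms -/

section L2

open MeasureTheory

variable {n q : ℕ} {M : Type*} [TopologicalSpace M] [ChartedSpace (EuclideanSpace ℝ (Fin n)) M]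
  [IsManifold (𝓡 n) ∞ M] (g : RMetric n M)

/-- The inner product on forms in the chart at `c`, as a continuous bilinear map. -/
def localInner (q : ℕ) (c : M) (y : EuclideanSpace ℝ (Fin n)) :
    (EuclideanSpace ℝ (Fin n) [⋀^Fin q]→L[ℝ] ℝ) →L[ℝ]
      (EuclideanSpace ℝ (Fin n) [⋀^Fin q]→L[ℝ] ℝ) →L[ℝ] ℝ :=
  coordPairing q (cometricCoeff g c y) fun i => EuclideanSpace.single i 1

/-- The inner product on forms in the chart at `c`, multiplied with the Riemannian density. -/
def localWeight (q : ℕ) (c : M) (y : EuclideanSpace ℝ (Fin n)) :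
    (EuclideanSpace ℝ (Fin n) [⋀^Fin q]→L[ℝ] ℝ) →L[ℝ]
      (EuclideanSpace ℝ (Fin n) [⋀^Fin q]→L[ℝ] ℝ) →L[ℝ] ℝ :=
  volDensity g c y • localInner g q c y

theorem contDiffOn_localInner (c : M) :
    ContDiffOn ℝ ∞ (localInner g q c) (extChartAt (𝓡 n) c).target :=
  fun y hy => contDiffWithinAt_coordPairing _ fun i j => contDiffOn_cometricCoeff g c i j y hy

theorem contDiffOn_localWeight (c : M) :
    ContDiffOn ℝ ∞ (localWeight g q c) (extChartAt (𝓡 n) c).target :=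
  (contDiffOn_volDensity g c).smul (contDiffOn_localInner g c)

theorem formInner_eq_localInner {c : M} {y : EuclideanSpace ℝ (Fin n)}
    (hy : y ∈ (extChartAt (𝓡 n) c).target) (u v : DiffForm n M q) :
    formInner g ((extChartAt (𝓡 n) c).symm y) (u _) (v _) =
      localInner g q c y (localForm c u y) (localForm c v y) := by
  rw [formInner_eq_local g c hy, localInner, coordPairing_apply, cometricCoeff]

theorem continuous_formInner {u v : DiffForm n M q} (hu : IsSmoothForm u) (hv : IsSmoothForm v) :
    Continuous fun x => formInner g x (u x) (v x) := by
  rw [continuous_iff_continuousAt]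
  intro x
  have hy := mem_extChartAt_target (I := 𝓡 n) x
  have h1 : ContinuousAt (fun y => localInner g q x y (localForm x u y) (localForm x v y))
      (extChartAt (𝓡 n) x x) :=
    ((((contDiffOn_localInner g x).contDiffAt ((extChartAt_target_isOpen x).mem_nhds hy)).clm_apply
      (hu.contDiffAt hy)).clm_apply (hv.contDiffAt hy)).continuousAt
  refine (ContinuousAt.comp (f := extChartAt (𝓡 n) x) h1 (continuousAt_extChartAt x)).congr ?_
  filter_upwards [extChartAt_source_mem_nhds (I := 𝓡 n) x] with z hz
  simp only [Function.comp_apply]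
  rw [← formInner_eq_localInner g ((extChartAt (𝓡 n) x).map_source hz),
    (extChartAt (𝓡 n) x).left_inv hz]

variable [MeasurableSpace M] [BorelSpace M] [T2Space M] [CompactSpace M]

theorem riemVolume_image {c : M} {K : Set (EuclideanSpace ℝ (Fin n))}
    (hK : K ⊆ (extChartAt (𝓡 n) c).target)
    (hm : MeasurableSet ((extChartAt (𝓡 n) c).symm '' K)) :
    riemVolume g ((extChartAt (𝓡 n) c).symm '' K) = ∫⁻ y in K, ENNReal.ofReal (volDensity g c y) := by
  have h1 : (extChartAt (𝓡 n) c).symm '' K ⊆ (extChartAt (𝓡 n) c).source := by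
    rintro _ ⟨y, hy, rfl⟩
    exact (extChartAt (𝓡 n) c).map_target (hK hy)
  have h2 : (extChartAt (𝓡 n) c).symm ⁻¹' ((extChartAt (𝓡 n) c).symm '' K) ∩
      (extChartAt (𝓡 n) c).target = K := by
    ext y
    constructor
    · rintro ⟨⟨z, hz, h⟩, hy⟩
      rwa [← (extChartAt (𝓡 n) c).symm.injOn (hK hz) hy h]
    · exact fun hy => ⟨⟨y, hy, rfl⟩, hK hy⟩
  rw [← Measure.restrict_eq_self (riemVolume g) h1, riemVolume_restrict_source,
    chartVolume_apply g c hm, h2]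

/-- A closed ball inside a chart has finite volume, the density being continuous on a compact set.
Local finiteness then gives finiteness because `M` is compact. -/
instance : IsFiniteMeasure (riemVolume g) := by
  have : IsLocallyFiniteMeasure (riemVolume g) := by
    refine ⟨fun x => ?_⟩
    have hy := mem_extChartAt_target (I := 𝓡 n) x
    obtain ⟨r, hr, hb⟩ := Metric.nhds_basis_closedBall.mem_iff.1
      ((extChartAt_target_isOpen x).mem_nhds hy)
    set K := Metric.closedBall (extChartAt (𝓡 n) x x) r with hKdef
    have hK : IsCompact K := isCompact_closedBall _ _
    have hKi : IsCompact ((extChartAt (𝓡 n) x).symm '' K) :=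
      hK.image_of_continuousOn ((continuousOn_extChartAt_symm x).mono hb)
    refine ⟨(extChartAt (𝓡 n) x).symm '' K, ?_, ?_⟩
    · filter_upwards [extChartAt_source_mem_nhds (I := 𝓡 n) x,
        (continuousAt_extChartAt (I := 𝓡 n) x).eventually_mem
          (Metric.closedBall_mem_nhds _ hr)] with z hz hzK
      exact ⟨_, hzK, (extChartAt (𝓡 n) x).left_inv hz⟩
    · rw [riemVolume_image g hb hKi.measurableSet]
      have h := ((contDiffOn_volDensity g x).continuousOn.mono hb).integrableOn_compact
        (μ := volume) hK
      exact h.lintegral_lt_top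
  infer_instance

/-- The density is positive on the nonempty open set that `U` cuts out in a chart. This is what
makes the `L²` product definite on smooth forms, and hence formal adjoints unique. -/
instance : (riemVolume g).IsOpenPosMeasure := by
  refine ⟨fun U hU hne h => ?_⟩
  obtain ⟨x, hx⟩ := hne
  have hy := mem_extChartAt_target (I := 𝓡 n) x
  set V := (extChartAt (𝓡 n) x).target ∩ (extChartAt (𝓡 n) x).symm ⁻¹' U with hV
  have hVo : IsOpen V :=
    (continuousOn_extChartAt_symm x).isOpen_inter_preimage (extChartAt_target_isOpen x) hU
  have hVx : extChartAt (𝓡 n) x x ∈ V := ⟨hy, by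
    rw [Set.mem_preimage, extChartAt_to_inv]; exact hx⟩
  have h1 : chartVolume g x U = 0 := by
    rw [← riemVolume_restrict_source]
    exact le_antisymm ((Measure.restrict_apply_le _ _).trans h.le) zero_le
  rw [chartVolume_apply g x hU.measurableSet, Set.inter_comm, ← hV] at h1
  have h2 := (lintegral_eq_zero_iff' ?_).1 h1
  · have h3 : ∀ᵐ y ∂(volume.restrict V), False := by
      filter_upwards [h2, ae_restrict_mem hVo.measurableSet] with y hy1 hy2
      have := volDensity_pos g x hy2.1
      simp only [Pi.zero_apply, ENNReal.ofReal_eq_zero] at hy1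
      linarith
    rw [Filter.eventually_false_iff_eq_bot, ae_eq_bot, Measure.restrict_eq_zero] at h3
    exact (hVo.measure_pos volume ⟨_, hVx⟩).ne' h3
  · exact (((contDiffOn_volDensity g x).continuousOn.mono Set.inter_subset_left).aemeasurable
      hVo.measurableSet).ennreal_ofReal

/-- Integration in a chart. -/
theorem integral_riemVolume_of_zero_off_source {c : M} {h : M → ℝ} (hh : Continuous h)
    (h0 : ∀ x ∉ (extChartAt (𝓡 n) c).source, h x = 0) :
    ∫ x, h x ∂(riemVolume g) =
      ∫ y in (extChartAt (𝓡 n) c).target, volDensity g c y * h ((extChartAt (𝓡 n) c).symm y) := by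
  rw [← setIntegral_eq_integral_of_forall_compl_eq_zero h0, riemVolume_restrict_source,
    chartVolume, integral_map (aemeasurable_extChartAt_symm c _) hh.aestronglyMeasurable,
    integral_withDensity_eq_integral_toReal_smul₀]
  · refine integral_congr_ae (Filter.Eventually.of_forall fun y => ?_)
    simp only [smul_eq_mul, ENNReal.toReal_ofReal (Real.sqrt_nonneg _), volDensity]
  · exact ((contDiffOn_volDensity g c).continuousOn.aemeasurable
      (extChartAt_target_isOpen c).measurableSet).ennreal_ofReal
  · exact Filter.Eventually.of_forall fun y => ENNReal.ofReal_lt_top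

/-- It suffices that at each point outside the chart one of the two forms vanishes; the test forms
used below are of this kind. -/
theorem l2Inner_eq_setIntegral {c : M} {u v : DiffForm n M q} (hu : IsSmoothForm u)
    (hv : IsSmoothForm v)
    (h0 : ∀ x ∉ (extChartAt (𝓡 n) c).source, u x = 0 ∨ v x = 0) :
    l2Inner g u v = ∫ y in (extChartAt (𝓡 n) c).target,
      localWeight g q c y (localForm c u y) (localForm c v y) := by
  rw [l2Inner, integral_riemVolume_of_zero_off_source g (continuous_formInner g hu hv) (c := c)]
  · refine setIntegral_congr_fun (extChartAt_target_isOpen c).measurableSet fun y hy => ?_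
    simp only [formInner_eq_localInner g hy]
    rfl
  · intro x hx
    have hz : ∀ w : TangentSpace (𝓡 n) x [⋀^Fin q]→L[ℝ] ℝ, formInner g x w 0 = 0 := fun w => by
      simpa using formInner_smul_right g x 0 w 0
    rcases h0 x hx with h | h
    · rw [h, formInner_comm, hz]
    · rw [h, hz]

theorem integrable_formInner {u v : DiffForm n M q} (hu : IsSmoothForm u) (hv : IsSmoothForm v) :
    Integrable (fun x => formInner g x (u x) (v x)) (riemVolume g) :=
  (continuous_formInner g hu hv).integrable_of_hasCompactSupport
    (HasCompactSupport.of_compactSpace _)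

omit [BorelSpace M] in
theorem l2Inner_comm (u v : DiffForm n M q) : l2Inner g u v = l2Inner g v u := by
  simp only [l2Inner, formInner_comm]

theorem l2Inner_add_right {u v w : DiffForm n M q} (hu : IsSmoothForm u) (hv : IsSmoothForm v)
    (hw : IsSmoothForm w) : l2Inner g u (v + w) = l2Inner g u v + l2Inner g u w := by
  rw [l2Inner, l2Inner, l2Inner,
    ← integral_add (integrable_formInner g hu hv) (integrable_formInner g hu hw)]
  exact integral_congr_ae (Filter.Eventually.of_forall fun x => formInner_add_right g x _ _ _)

omit [BorelSpace M] in
theorem l2Inner_smul_right (a : ℝ) (u v : DiffForm n M q) :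
    l2Inner g u (a • v) = a * l2Inner g u v := by
  rw [l2Inner, l2Inner, ← integral_const_mul]
  exact integral_congr_ae (Filter.Eventually.of_forall fun x => formInner_smul_right g x _ _ _)

theorem l2Inner_sub_right {u v w : DiffForm n M q} (hu : IsSmoothForm u) (hv : IsSmoothForm v)
    (hw : IsSmoothForm w) : l2Inner g u (v - w) = l2Inner g u v - l2Inner g u w := by
  have h : v - w = v + (-1 : ℝ) • w := by
    funext x
    simp [sub_eq_add_neg]
  rw [h, l2Inner_add_right g hu hv (hw.const_smul _), l2Inner_smul_right]
  ring

theorem l2Inner_add_left {u v w : DiffForm n M q} (hu : IsSmoothForm u) (hv : IsSmoothForm v)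
    (hw : IsSmoothForm w) : l2Inner g (u + v) w = l2Inner g u w + l2Inner g v w := by
  rw [l2Inner_comm, l2Inner_add_right g hw hu hv, l2Inner_comm g w, l2Inner_comm g w]

omit [BorelSpace M] in
theorem l2Inner_smul_left (a : ℝ) (u v : DiffForm n M q) :
    l2Inner g (a • u) v = a * l2Inner g u v := by
  rw [l2Inner_comm, l2Inner_smul_right, l2Inner_comm]

theorem l2Inner_sum_right {ι : Type*} {s : Finset ι} {u : DiffForm n M q} {v : ι → DiffForm n M q}
    (hu : IsSmoothForm u) (hv : ∀ i ∈ s, IsSmoothForm (v i)) :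
    l2Inner g u (∑ i ∈ s, v i) = ∑ i ∈ s, l2Inner g u (v i) := by
  classical
  induction s using Finset.induction_on with
  | empty => simpa using l2Inner_smul_right g 0 u 0
  | insert i s hi ih =>
    have hs := fun j hj => hv j (Finset.mem_insert_of_mem hj)
    rw [Finset.sum_insert hi, Finset.sum_insert hi, l2Inner_add_right g hu
      (hv i (Finset.mem_insert_self i s)) (IsSmoothForm.sum hs), ih hs]

/-- The `L²` inner product is non-degenerate on smooth forms. -/
theorem eq_zero_of_l2Inner_self {u : DiffForm n M q} (hu : IsSmoothForm u)
    (h : l2Inner g u u = 0) : u = 0 := by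
  have h1 := (integral_eq_zero_iff_of_nonneg (fun x => formInner_self_nonneg g x (u x))
    (integrable_formInner g hu hu)).1 h
  have h2 := (Continuous.ae_eq_iff_eq _ (continuous_formInner g hu hu) continuous_const).1 h1
  funext x
  exact eq_zero_of_formInner_self (congrFun h2 x)

theorem eq_of_forall_l2Inner {v w : DiffForm n M q} (hv : IsSmoothForm v) (hw : IsSmoothForm w)
    (h : ∀ u : DiffForm n M q, IsSmoothForm u → l2Inner g u v = l2Inner g u w) : v = w := by
  rw [← sub_eq_zero]
  refine eq_zero_of_l2Inner_self g (hv.sub hw) ?_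
  rw [l2Inner_sub_right g (hv.sub hw) hv hw, h _ (hv.sub hw), sub_self]

end L2

end Witten
end

noncomputable section
namespace Witten

set_option maxSynthPendingDepth 3

/-! ### Pointwise Riesz representation in a chart -/

section Riesz

variable {n q : ℕ} {M : Type*} [TopologicalSpace M] [ChartedSpace (EuclideanSpace ℝ (Fin n)) M]
  [IsManifold (𝓡 n) ∞ M] (g : RMetric n M)

theorem localWeight_comm {c : M} {y : EuclideanSpace ℝ (Fin n)}
    (hy : y ∈ (extChartAt (𝓡 n) c).target)
    (α β : EuclideanSpace ℝ (Fin n) [⋀^Fin q]→L[ℝ] ℝ) :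
    localWeight g q c y α β = localWeight g q c y β α := by
  -- Every pair of alternating forms on the model space is the local expression at `y` of forms on
  -- `M`, by extending constants; smoothness is irrelevant for a pointwise identity.
  have h := fun α β : EuclideanSpace ℝ (Fin n) [⋀^Fin q]→L[ℝ] ℝ =>
    formInner_eq_localInner g hy (extendForm c fun _ => α) (extendForm c fun _ => β)
  simp only [localForm_extendForm c _ hy] at h
  change volDensity g c y * localInner g q c y α β = volDensity g c y * localInner g q c y β α
  rw [← h, ← h, formInner_comm]

theorem eq_zero_of_localWeight_self {c : M} {y : EuclideanSpace ℝ (Fin n)}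
    (hy : y ∈ (extChartAt (𝓡 n) c).target) {α : EuclideanSpace ℝ (Fin n) [⋀^Fin q]→L[ℝ] ℝ}
    (h0 : localWeight g q c y α α = 0) : α = 0 := by
  have h := formInner_eq_localInner g hy (extendForm c fun _ => α) (extendForm c fun _ => α)
  simp only [localForm_extendForm c _ hy] at h
  change volDensity g c y * localInner g q c y α α = 0 at h0
  rw [(mul_eq_zero.1 h0).resolve_left (volDensity_pos g c hy).ne'] at h
  have h2 := eq_zero_of_formInner_self h
  have h3 := localForm_extendForm c (fun _ => α) hy
  rw [localForm, h2] at h3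
  rw [← h3]
  rfl

/-- Definiteness makes the map into the dual space injective, and the dimensions agree. Smoothness
of inversion on invertible maps then makes Riesz representatives depend smoothly on the point. -/
theorem isInvertible_localWeight {c : M} {y : EuclideanSpace ℝ (Fin n)}
    (hy : y ∈ (extChartAt (𝓡 n) c).target) : (localWeight g q c y).IsInvertible := by
  have hinj : Function.Injective (localWeight g q c y).toLinearMap := by
    refine (injective_iff_map_eq_zero _).2 fun α hα => ?_
    refine eq_zero_of_localWeight_self g hy (α := α) ?_
    change ((localWeight g q c y).toLinearMap α) α = 0
    rw [hα]
    rfl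
  have hdim : Module.finrank ℝ (EuclideanSpace ℝ (Fin n) [⋀^Fin q]→L[ℝ] ℝ) =
      Module.finrank ℝ ((EuclideanSpace ℝ (Fin n) [⋀^Fin q]→L[ℝ] ℝ) →L[ℝ] ℝ) := by
    rw [← Subspace.dual_finrank_eq]
    exact LinearEquiv.finrank_eq LinearMap.toContinuousLinearMap
  refine ⟨(LinearEquiv.ofInjectiveOfFinrankEq _ hinj hdim).toContinuousLinearEquiv, ?_⟩
  ext α β
  rfl

/-- The Riesz representation of a smooth family of functionals on forms. -/
theorem exists_riesz_localWeight (c : M) {K : Set (EuclideanSpace ℝ (Fin n))}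
    {m : EuclideanSpace ℝ (Fin n) → (EuclideanSpace ℝ (Fin n) [⋀^Fin q]→L[ℝ] ℝ) →L[ℝ] ℝ}
    (hm : ContDiffOn ℝ ∞ m (extChartAt (𝓡 n) c).target)
    (h0 : ∀ y ∈ (extChartAt (𝓡 n) c).target, y ∉ K → m y = 0) :
    ∃ w : EuclideanSpace ℝ (Fin n) → EuclideanSpace ℝ (Fin n) [⋀^Fin q]→L[ℝ] ℝ,
      ContDiffOn ℝ ∞ w (extChartAt (𝓡 n) c).target ∧
      (∀ y ∈ (extChartAt (𝓡 n) c).target, y ∉ K → w y = 0) ∧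
      ∀ y ∈ (extChartAt (𝓡 n) c).target, ∀ α, localWeight g q c y α (w y) = m y α := by
  refine ⟨fun y => (localWeight g q c y).inverse (m y), fun y hy => ?_, fun y hy hyK => ?_,
    fun y hy α => ?_⟩
  · refine ContDiffWithinAt.clm_apply ?_ (hm y hy)
    exact (isInvertible_localWeight g hy).contDiffAt_map_inverse.comp_contDiffWithinAt y
      (contDiffOn_localWeight g c y hy)
  · simp only [h0 y hy hyK, map_zero]
  · rw [localWeight_comm g hy, (isInvertible_localWeight g hy).self_apply_inverse]

end Riesz

/-! ### Existence and uniqueness of the formal adjoints -/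

section Adjoint

open MeasureTheory

variable {n q : ℕ} {M : Type*} [TopologicalSpace M] [ChartedSpace (EuclideanSpace ℝ (Fin n)) M]
  [IsManifold (𝓡 n) ∞ M] (g : RMetric n M)

/-- The exterior product with a covector as a continuous linear map. -/
def wedgeCLM (α : EuclideanSpace ℝ (Fin n) →L[ℝ] ℝ) :
    (EuclideanSpace ℝ (Fin n) [⋀^Fin q]→L[ℝ] ℝ) →L[ℝ]
      EuclideanSpace ℝ (Fin n) [⋀^Fin (q + 1)]→L[ℝ] ℝ :=
  LinearMap.toContinuousLinearMap
    { toFun := wedge α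
      map_add' := wedge_add α
      map_smul' := wedge_smul α }

theorem wedgeCLM_apply (α : EuclideanSpace ℝ (Fin n) →L[ℝ] ℝ)
    (η : EuclideanSpace ℝ (Fin n) [⋀^Fin q]→L[ℝ] ℝ) : wedgeCLM α η = wedge α η := rfl

/-- The formula `du = ∑ k, e^k ∧ ∂_k u` displays `d` as a first-order operator with constant
coefficients, ready for integration by parts. -/
theorem extDeriv_eq_sum_wedge
    (u : EuclideanSpace ℝ (Fin n) → EuclideanSpace ℝ (Fin n) [⋀^Fin q]→L[ℝ] ℝ)
    (y : EuclideanSpace ℝ (Fin n)) :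
    extDeriv u y = ∑ k, wedgeCLM (EuclideanSpace.proj k)
      (fderiv ℝ u y (EuclideanSpace.single k 1)) := by
  have h : fderiv ℝ u y = ∑ k, (EuclideanSpace.proj k : EuclideanSpace ℝ (Fin n) →L[ℝ] ℝ).smulRight
      (fderiv ℝ u y (EuclideanSpace.single k 1)) := by
    ext1 v
    conv_lhs => rw [← (EuclideanSpace.basisFun (Fin n) ℝ).sum_repr v, map_sum]
    simp
  rw [extDeriv]
  conv_lhs => rw [h]
  change ContinuousAlternatingMap.alternatizeUncurryFinCLM ℝ (EuclideanSpace ℝ (Fin n)) ℝ _ = _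
  rw [map_sum]
  refine Finset.sum_congr rfl fun k _ => ?_
  rw [wedgeCLM_apply, wedge_eq_alternatize]
  rfl

variable [MeasurableSpace M] [BorelSpace M] [T2Space M] [CompactSpace M]

/-- A form supported in the domain of a chart has a formal adjoint value for the exterior
derivative. -/
theorem exists_isAdjointValue_extD_of_support {c : M} {K : Set (EuclideanSpace ℝ (Fin n))}
    (hK : IsCompact K) (hKt : K ⊆ (extChartAt (𝓡 n) c).target) {v : DiffForm n M (q + 1)}
    (hv : IsSmoothForm v) (hv0 : ∀ x ∉ (extChartAt (𝓡 n) c).source, v x = 0)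
    (hvK : ∀ y ∈ (extChartAt (𝓡 n) c).target, y ∉ K → localForm c v y = 0) :
    ∃ w, IsAdjointValue g extD v w := by
  set U := (extChartAt (𝓡 n) c).target with hU
  have hUo : IsOpen U := extChartAt_target_isOpen c
  -- `l k` is the functional `β ↦ W(v, e^k ∧ β)`, so that `W(v, du) = ∑ k, l k (∂_k u)`.
  set l : Fin n → EuclideanSpace ℝ (Fin n) →
      (EuclideanSpace ℝ (Fin n) [⋀^Fin q]→L[ℝ] ℝ) →L[ℝ] ℝ := fun k y =>
    (localWeight g (q + 1) c y (localForm c v y)).comp (wedgeCLM (EuclideanSpace.proj k)) with hl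
  have hls : ∀ k, ContDiffOn ℝ ∞ (l k) U := fun k y hy =>
    ((contDiffOn_localWeight g c y hy).clm_apply (hv.contDiffOn c y hy)).clm_comp
      contDiffWithinAt_const
  have hl0 : ∀ k, ∀ y ∈ U, y ∉ K → l k y = 0 := by
    intro k y hy hyK
    simp only [hl, hvK y hy hyK, map_zero, ContinuousLinearMap.zero_comp]
  have hld : ∀ k, ∀ y ∈ U, y ∉ K → fderiv ℝ (l k) y = 0 := by
    intro k y hy hyK
    have : l k =ᶠ[nhds y] fun _ => 0 := by
      filter_upwards [hUo.mem_nhds hy, hK.isClosed.isOpen_compl.mem_nhds hyK] with z hz hzK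
        using hl0 k z hz hzK
    rw [this.fderiv_eq]
    simp
  -- By the product rule `∑ k, l k (∂_k u) = ∑ k, ∂_k (l k u) + m u`. The divergence integrates to
  -- zero, so the adjoint value is the form representing `m`.
  set m : EuclideanSpace ℝ (Fin n) → (EuclideanSpace ℝ (Fin n) [⋀^Fin q]→L[ℝ] ℝ) →L[ℝ] ℝ :=
    fun y => -∑ k, fderiv ℝ (l k) y (EuclideanSpace.single k 1) with hm
  have hms : ContDiffOn ℝ ∞ m U := ContDiffOn.neg (ContDiffOn.sum fun k _ =>
    ((hls k).fderiv_of_isOpen hUo (m := ∞) (by simp)).clm_apply contDiffOn_const)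
  have hm0 : ∀ y ∈ U, y ∉ K → m y = 0 := by
    intro y hy hyK
    simp [hm, hld _ y hy hyK]
  obtain ⟨w, hw, hw0, hwm⟩ := exists_riesz_localWeight g c hms hm0
  have hwsm : IsSmoothForm (extendForm c w) := isSmoothForm_extendForm hK hKt hw hw0
  refine ⟨extendForm c w, hwsm, fun u hu => ?_⟩
  rw [l2Inner_eq_setIntegral g hu.extD hv fun x hx => Or.inr (hv0 x hx),
    l2Inner_eq_setIntegral g hu hwsm fun x hx => Or.inr (extendForm_of_notMem hx w)]
  have hφ : ∀ k, ContDiffOn ℝ ∞ (fun y => l k y (localForm c u y)) U := fun k =>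
    (hls k).clm_apply (hu.contDiffOn c)
  have hφ0 : ∀ k, ∀ y ∈ U, y ∉ K → l k y (localForm c u y) = 0 := by
    intro k y hy hyK
    rw [hl0 k y hy hyK]
    rfl
  have hpt : ∀ y ∈ U, localWeight g (q + 1) c y (localForm c (extD u) y) (localForm c v y) =
      (∑ k, fderiv ℝ (fun y => l k y (localForm c u y)) y (EuclideanSpace.single k 1)) +
        m y (localForm c u y) := by
    intro y hy
    have h1 : ∀ k, fderiv ℝ (fun y => l k y (localForm c u y)) y (EuclideanSpace.single k 1) =
        l k y (fderiv ℝ (localForm c u) y (EuclideanSpace.single k 1)) +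
          fderiv ℝ (l k) y (EuclideanSpace.single k 1) (localForm c u y) := by
      intro k
      rw [fderiv_clm_apply (((hls k).contDiffAt (hUo.mem_nhds hy)).differentiableAt (by simp))
        ((hu.contDiffAt hy).differentiableAt (by simp))]
      rfl
    rw [localForm_extD hu hy, localWeight_comm g hy, extDeriv_eq_sum_wedge, map_sum]
    simp only [h1, Finset.sum_add_distrib, hm, _root_.neg_apply, _root_.sum_apply]
    rw [add_neg_cancel_right]
    rfl
  have hint : ∀ k, IntegrableOn (fun y => fderiv ℝ (fun y => l k y (localForm c u y)) y
      (EuclideanSpace.single k 1)) U := by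
    intro k
    refine integrableOn_of_zero_off_compact volume hUo hK hKt
      (((hφ k).fderiv_of_isOpen hUo (m := ∞) (by simp)).continuousOn.clm_apply
        continuousOn_const) fun y hy hyK => ?_
    have : (fun y => l k y (localForm c u y)) =ᶠ[nhds y] fun _ => 0 := by
      filter_upwards [hUo.mem_nhds hy, hK.isClosed.isOpen_compl.mem_nhds hyK] with z hz hzK
        using hφ0 k z hz hzK
    rw [this.fderiv_eq]
    simp
  have hintm : IntegrableOn (fun y => m y (localForm c u y)) U :=
    integrableOn_of_zero_off_compact volume hUo hK hKt
      (hms.clm_apply (hu.contDiffOn c)).continuousOn fun y hy hyK => by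
        rw [hm0 y hy hyK]
        rfl
  rw [setIntegral_congr_fun hUo.measurableSet hpt,
    integral_add (integrable_finsetSum _ fun k _ => hint k) hintm,
    integral_finsetSum _ fun k _ => hint k]
  have h2 := fun k => setIntegral_fderiv_eq_zero volume hUo hK hKt ((hφ k).of_le (by simp))
    (hφ0 k) (EuclideanSpace.single k 1)
  simp only [h2, Finset.sum_const_zero, zero_add]
  refine setIntegral_congr_fun hUo.measurableSet fun y hy => ?_
  simp only [localForm_extendForm c w hy, hwm y hy]

/-- The formal adjoint of the exterior derivative exists. -/
theorem exists_isAdjointValue_extD {v : DiffForm n M (q + 1)} (hv : IsSmoothForm v) :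
    ∃ w, IsAdjointValue g extD v w := by
  have hloc : ∀ c : M, ∃ w, IsAdjointValue g extD (fun x => chartPartition n M c x • v x) w := by
    intro c
    have hts := tsupport_chartPartition_subset (n := n) c
    have hK : IsCompact (extChartAt (𝓡 n) c '' tsupport (chartPartition n M c)) :=
      (isClosed_tsupport _).isCompact.image_of_continuousOn ((continuousOn_extChartAt c).mono hts)
    refine exists_isAdjointValue_extD_of_support g hK ?_
      (hv.smul_fun (chartPartition n M c).contMDiff) (c := c) ?_ ?_
    · rintro _ ⟨x, hx, rfl⟩
      exact (extChartAt (𝓡 n) c).map_source (hts hx)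
    · intro x hx
      simp only [image_eq_zero_of_notMem_tsupport fun h => hx (hts h), zero_smul]
    · intro y hy hyK
      have h0 : chartPartition n M c ((extChartAt (𝓡 n) c).symm y) = 0 :=
        image_eq_zero_of_notMem_tsupport fun h => hyK ⟨_, h, (extChartAt (𝓡 n) c).right_inv hy⟩
      rw [localForm_smul, h0, zero_smul]
  choose w hw using hloc
  have hvs : v = ∑ c ∈ chartIndices n M, fun x => chartPartition n M c x • v x := by
    funext x
    rw [Finset.sum_apply, ← Finset.sum_smul, sum_chartPartition, one_smul]
  refine ⟨∑ c ∈ chartIndices n M, w c, IsSmoothForm.sum fun c _ => (hw c).1, fun u hu => ?_⟩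
  rw [l2Inner_sum_right g hu fun c _ => (hw c).1]
  conv_lhs => rw [hvs]
  rw [l2Inner_sum_right g hu.extD fun c _ => hv.smul_fun (chartPartition n M c).contMDiff]
  exact Finset.sum_congr rfl fun c _ => (hw c).2 u hu

/-- Two adjoint values have the same products with all smooth forms, so they agree by definiteness
and the choice in `formalAdjoint` is forced. -/
theorem formalAdjoint_eq {D : DiffForm n M q → DiffForm n M (q + 1)} {v : DiffForm n M (q + 1)}
    {w : DiffForm n M q} (h : IsAdjointValue g D v w) : formalAdjoint g D v = w := by
  have hex : ∃ w, IsAdjointValue g D v w := ⟨w, h⟩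
  rw [formalAdjoint, dif_pos hex]
  refine eq_of_forall_l2Inner g hex.choose_spec.1 h.1 fun u hu => ?_
  rw [← hex.choose_spec.2 u hu, h.2 u hu]

theorem isAdjointValue_codiff {v : DiffForm n M (q + 1)} (hv : IsSmoothForm v) :
    IsAdjointValue g extD v (codiff g v) := by
  obtain ⟨w, hw⟩ := exists_isAdjointValue_extD g hv
  rwa [codiff, formalAdjoint_eq g hw]

theorem codiff_add {v w : DiffForm n M (q + 1)} (hv : IsSmoothForm v) (hw : IsSmoothForm w) :
    codiff g (v + w) = codiff g v + codiff g w := by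
  have h1 := isAdjointValue_codiff g hv
  have h2 := isAdjointValue_codiff g hw
  refine formalAdjoint_eq g ⟨h1.1.add h2.1, fun u hu => ?_⟩
  rw [l2Inner_add_right g hu.extD hv hw, l2Inner_add_right g hu h1.1 h2.1, h1.2 u hu, h2.2 u hu]

theorem codiff_smul {v : DiffForm n M (q + 1)} (hv : IsSmoothForm v) (a : ℝ) :
    codiff g (a • v) = a • codiff g v := by
  have h1 := isAdjointValue_codiff g hv
  refine formalAdjoint_eq g ⟨h1.1.const_smul a, fun u hu => ?_⟩
  rw [l2Inner_smul_right, l2Inner_smul_right, h1.2 u hu]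

variable {f : M → ℝ} (hf : ContMDiff (𝓡 n) 𝓘(ℝ, ℝ) ∞ f) (t : ℝ)
include hf

omit [IsManifold (𝓡 n) ∞ M] [MeasurableSpace M] [BorelSpace M] [T2Space M] [CompactSpace M] in
theorem mvfderiv_exp_mul (x : M) :
    mvfderiv (𝓡 n) (fun y => Real.exp (t * f y)) x =
      (Real.exp (t * f x) * t) • mvfderiv (𝓡 n) f x := by
  have h1 : HasFDerivAt (fun s : ℝ => Real.exp (t * s))
      (ContinuousLinearMap.toSpanSingleton ℝ (Real.exp (t * f x) * t)) (f x) := by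
    have := ((hasDerivAt_id (f x)).const_mul t).exp
    simpa using this.hasFDerivAt
  have h2 := h1.hasMFDerivAt.comp x (hf.mdifferentiableAt (x := x) (by simp)).hasMFDerivAt
  ext v
  have h3 : mvfderiv (𝓡 n) (fun y => Real.exp (t * f y)) x v =
      mfderiv (𝓡 n) 𝓘(ℝ, ℝ) (fun y => Real.exp (t * f y)) x v := rfl
  have h4 : mvfderiv (𝓡 n) f x v = mfderiv (𝓡 n) 𝓘(ℝ, ℝ) f x v := rfl
  rw [h3, show (fun y => Real.exp (t * f y)) = (fun s : ℝ => Real.exp (t * s)) ∘ f from rfl,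
    h2.mfderiv, _root_.smul_apply, h4]
  exact mul_comm (G := ℝ) (mfderiv (𝓡 n) 𝓘(ℝ, ℝ) f x v) (Real.exp (t * f x) * t)

omit [IsManifold (𝓡 n) ∞ M] [MeasurableSpace M] [BorelSpace M] [T2Space M] [CompactSpace M] in
theorem contMDiff_exp_mul : ContMDiff (𝓡 n) 𝓘(ℝ, ℝ) ∞ fun y => Real.exp (t * f y) :=
  (Real.contDiff_exp.contMDiff).comp (contMDiff_const.mul hf)

omit [MeasurableSpace M] [BorelSpace M] [T2Space M] [CompactSpace M] in
theorem wittenD_eq {u : DiffForm n M q} (hu : IsSmoothForm u) :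
    wittenD f t u = extD u + t • fun x => wedge (mvfderiv (𝓡 n) f x) (u x) := by
  funext x
  rw [wittenD, extD_smul_fun hu (contMDiff_exp_mul hf t), mvfderiv_exp_mul hf, smul_wedge, smul_add,
    smul_smul, smul_smul, ← mul_assoc, ← Real.exp_add, neg_add_cancel, Real.exp_zero, one_smul,
    one_mul]
  rfl

/-- The zeroth-order term `df∧` has the pointwise adjoint `ι_{∇f}`; adding it to the adjoint of `d`
needs no further integration by parts. -/
theorem isAdjointValue_wittenD {v : DiffForm n M (q + 1)} (hv : IsSmoothForm v) :
    IsAdjointValue g (wittenD f t) v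
      (codiff g v + t • fun x => interior (gradient g f x) (v x)) := by
  have h1 := isAdjointValue_codiff g hv
  have hi := hv.interior_gradient g hf
  refine ⟨h1.1.add (hi.const_smul t), fun u hu => ?_⟩
  have hw := hu.wedge_mvfderiv hf
  rw [wittenD_eq hf t hu, l2Inner_add_left g hu.extD (hw.const_smul t) hv,
    l2Inner_add_right g hu h1.1 (hi.const_smul t), h1.2 u hu, l2Inner_smul_left,
    l2Inner_smul_right]
  simp only [l2Inner, formInner_wedge, gradient]

theorem wittenCodiff_eq {v : DiffForm n M (q + 1)} (hv : IsSmoothForm v) :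
    wittenCodiff g f t v = codiff g v + t • fun x => interior (gradient g f x) (v x) :=
  formalAdjoint_eq g (isAdjointValue_wittenD g hf t hv)

end Adjoint

end Witten
end

noncomputable section
namespace Witten

set_option maxSynthPendingDepth 3

/-! ### Locality of the exterior derivative -/

section Support

variable {n q : ℕ} {M : Type*} [TopologicalSpace M] [ChartedSpace (EuclideanSpace ℝ (Fin n)) M]
  [IsManifold (𝓡 n) ∞ M]

theorem extD_eq_zero_of_eventually {u : DiffForm n M q} {x : M} (h : ∀ᶠ z in nhds x, u z = 0) :
    extD u x = 0 := by
  have h1 : localForm x u =ᶠ[nhds (extChartAt (𝓡 n) x x)] fun _ => 0 := by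
    filter_upwards [eventually_extChartAt_symm h] with y hy
    rw [localForm, hy]
    rfl
  have h2 : extDeriv (localForm x u) (extChartAt (𝓡 n) x x) = 0 := by
    rw [extDeriv, h1.fderiv_eq, fderiv_fun_const]
    exact map_zero (ContinuousAlternatingMap.alternatizeUncurryFinCLM ℝ (EuclideanSpace ℝ (Fin n)) ℝ)
  rw [extD, h2]
  rfl

end Support

/-! ### The Lie derivative along the gradient and its adjoint -/

section LieDerivative

variable {n : ℕ} {M : Type*} [TopologicalSpace M] [ChartedSpace (EuclideanSpace ℝ (Fin n)) M]
  [IsManifold (𝓡 n) ∞ M] (g : RMetric n M) (f : M → ℝ)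

/-- The Lie derivative along the gradient of `f`, `d ι + ι d`. -/
def lieGrad : {q : ℕ} → DiffForm n M q → DiffForm n M q
  | 0, η => fun x => interior (gradient g f x) (extD η x)
  | _ + 1, η => extD (fun x => interior (gradient g f x) (η x)) +
      fun x => interior (gradient g f x) (extD η x)

variable {f}

theorem IsSmoothForm.lieGrad (hf : ContMDiff (𝓡 n) 𝓘(ℝ, ℝ) ∞ f) :
    ∀ {q : ℕ} {η : DiffForm n M q}, IsSmoothForm η → IsSmoothForm (lieGrad g f η)
  | 0, _, hη => hη.extD.interior_gradient g hf
  | _ + 1, _, hη => (hη.interior_gradient g hf).extD.add (hη.extD.interior_gradient g hf)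

/-- The operator is local. Hence the Lie derivative of a test form supported in a chart also
vanishes outside it and can be integrated there. -/
theorem lieGrad_eq_zero_of_eventually : ∀ {q : ℕ} {u : DiffForm n M q} {x : M},
    (∀ᶠ z in nhds x, u z = 0) → lieGrad g f u x = 0
  | 0, u, x, h => by
    have h1 : lieGrad g f u x = interior (gradient g f x) (extD u x) := rfl
    rw [h1, extD_eq_zero_of_eventually h]
    rfl
  | q + 1, u, x, h => by
    have h1 : ∀ᶠ z in nhds x, interior (gradient g f z) (u z) = 0 := by
      filter_upwards [h] with z hz
      rw [hz]
      rfl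
    have h2 : lieGrad g f u x = extD (fun x => interior (gradient g f x) (u x)) x +
      interior (gradient g f x) (extD u x) := rfl
    rw [h2, extD_eq_zero_of_eventually h, extD_eq_zero_of_eventually h1, zero_add]
    rfl

/-- The Lie derivative along the gradient in a chart. -/
theorem localForm_lieGrad (hf : ContMDiff (𝓡 n) 𝓘(ℝ, ℝ) ∞ f) :
    ∀ {q : ℕ} {η : DiffForm n M q}, IsSmoothForm η → ∀ {c : M} {y : EuclideanSpace ℝ (Fin n)},
      y ∈ (extChartAt (𝓡 n) c).target → localForm c (lieGrad g f η) y =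
        fderiv ℝ (localForm c η) y (localField c (gradient g f) y) +
          derivAct (fderiv ℝ (localField c (gradient g f)) y) (localForm c η y)
  | 0, η, hη, c, y, hy => by
    rw [Witten.lieGrad, localForm_interior _ _ hy, localForm_extD hη hy]
    exact interior_extDeriv_zero (X := localField c (gradient g f))
  | q + 1, η, hη, c, y, hy => by
    have hX := (contDiffOn_localField_gradient g hf c).contDiffAt
      ((extChartAt_target_isOpen c).mem_nhds hy)
    rw [Witten.lieGrad, localForm_add, localForm_interior _ _ hy, localForm_extD hη hy,
      localForm_extD (hη.interior_gradient g hf) hy]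
    have h1 : localForm c (fun x => interior (gradient g f x) (η x)) =ᶠ[nhds y]
        fun z => interior (localField c (gradient g f) z) (localForm c η z) := by
      filter_upwards [(extChartAt_target_isOpen c).mem_nhds hy] with z hz
      exact localForm_interior _ _ hz
    rw [h1.extDeriv_eq]
    exact extDeriv_interior_add (hX.differentiableAt (by simp))
      ((hη.contDiffAt hy).differentiableAt (by simp))

variable [MeasurableSpace M] [BorelSpace M] [T2Space M] [CompactSpace M]

variable (f) in
/-- The adjoint of the Lie derivative along the gradient of `f`. -/
def lieGradAdj : {q : ℕ} → DiffForm n M q → DiffForm n M q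
  | 0, η => codiff g fun x => wedge (mvfderiv (𝓡 n) f x) (η x)
  | _ + 1, η => (fun x => wedge (mvfderiv (𝓡 n) f x) (codiff g η x)) +
      codiff g fun x => wedge (mvfderiv (𝓡 n) f x) (η x)

theorem IsSmoothForm.lieGradAdj (hf : ContMDiff (𝓡 n) 𝓘(ℝ, ℝ) ∞ f) :
    ∀ {q : ℕ} {η : DiffForm n M q}, IsSmoothForm η → IsSmoothForm (lieGradAdj g f η)
  | 0, _, hη => (isAdjointValue_codiff g (hη.wedge_mvfderiv hf)).1
  | _ + 1, _, hη => ((isAdjointValue_codiff g hη).1.wedge_mvfderiv hf).add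
      (isAdjointValue_codiff g (hη.wedge_mvfderiv hf)).1

omit [BorelSpace M] in
theorem l2Inner_wedge_mvfderiv {q : ℕ} (u : DiffForm n M q) (v : DiffForm n M (q + 1)) :
    l2Inner g (fun x => wedge (mvfderiv (𝓡 n) f x) (u x)) v =
      l2Inner g u fun x => interior (gradient g f x) (v x) := by
  simp only [l2Inner, formInner_wedge, gradient]

/-- Adjoints are taken factor by factor: `(d ι)^* = df∧ d^*` and `(ι d)^* = d^* df∧`. -/
theorem l2Inner_lieGradAdj (hf : ContMDiff (𝓡 n) 𝓘(ℝ, ℝ) ∞ f) :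
    ∀ {q : ℕ} {u η : DiffForm n M q}, IsSmoothForm u → IsSmoothForm η →
      l2Inner g u (lieGradAdj g f η) = l2Inner g (lieGrad g f u) η
  | 0, u, η, hu, hη => by
    rw [Witten.lieGradAdj, Witten.lieGrad, ← (isAdjointValue_codiff g (hη.wedge_mvfderiv hf)).2 u hu,
      l2Inner_comm, l2Inner_wedge_mvfderiv, l2Inner_comm]
  | q + 1, u, η, hu, hη => by
    have h1 := isAdjointValue_codiff g hη
    have h2 := isAdjointValue_codiff g (hη.wedge_mvfderiv hf)
    have hi := hu.interior_gradient g hf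
    rw [Witten.lieGradAdj, Witten.lieGrad, l2Inner_add_right g hu (h1.1.wedge_mvfderiv hf) h2.1,
      l2Inner_add_left g hi.extD (hu.extD.interior_gradient g hf) hη, ← h2.2 u hu, h1.2 _ hi,
      l2Inner_comm g u, l2Inner_wedge_mvfderiv, l2Inner_comm g (extD u), l2Inner_wedge_mvfderiv,
      l2Inner_comm g (codiff g η), l2Inner_comm g η]

end LieDerivative

end Witten
end

noncomputable section
namespace Witten

set_option maxSynthPendingDepth 3

/-! ### The adjoint of the Lie derivative in a chart -/

section LocalAdjoint

open MeasureTheory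

variable {n q : ℕ} {M : Type*} [TopologicalSpace M] [ChartedSpace (EuclideanSpace ℝ (Fin n)) M]
  [IsManifold (𝓡 n) ∞ M] (g : RMetric n M) {f : M → ℝ}

/-- The divergence of a vector field on `ℝⁿ`. -/
def euclideanDiv (X : EuclideanSpace ℝ (Fin n) → EuclideanSpace ℝ (Fin n))
    (y : EuclideanSpace ℝ (Fin n)) : ℝ :=
  ∑ k, fderiv ℝ X y (EuclideanSpace.single k 1) k

theorem sum_fderiv_mul_apply {X : EuclideanSpace ℝ (Fin n) → EuclideanSpace ℝ (Fin n)}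
    {h : EuclideanSpace ℝ (Fin n) → ℝ} {y : EuclideanSpace ℝ (Fin n)}
    (hX : DifferentiableAt ℝ X y) (hh : DifferentiableAt ℝ h y) :
    ∑ k, fderiv ℝ (fun z => h z * X z k) y (EuclideanSpace.single k 1) =
      fderiv ℝ h y (X y) + h y * euclideanDiv X y := by
  have h1 : ∀ k, fderiv ℝ (fun z => h z * X z k) y (EuclideanSpace.single k 1) =
      h y * fderiv ℝ X y (EuclideanSpace.single k 1) k +
        X y k * fderiv ℝ h y (EuclideanSpace.single k 1) := by
    intro k
    have h2 : HasFDerivAt (fun z => X z k)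
        ((EuclideanSpace.proj k : EuclideanSpace ℝ (Fin n) →L[ℝ] ℝ).comp (fderiv ℝ X y)) y :=
      hasFDerivAt_clm_comp (EuclideanSpace.proj k : EuclideanSpace ℝ (Fin n) →L[ℝ] ℝ) hX.hasFDerivAt
    rw [fderiv_fun_mul hh h2.differentiableAt, h2.fderiv]
    rfl
  simp only [h1, Finset.sum_add_distrib, ← Finset.mul_sum, euclideanDiv]
  rw [add_comm]
  congr 1
  conv_rhs => rw [← (EuclideanSpace.basisFun (Fin n) ℝ).sum_repr (X y), map_sum]
  simp

/-- Integration by parts for the derivative along a vector field. -/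
theorem setIntegral_fderiv_apply {U : Set (EuclideanSpace ℝ (Fin n))} (hU : IsOpen U)
    {X : EuclideanSpace ℝ (Fin n) → EuclideanSpace ℝ (Fin n)} (hX : ContDiffOn ℝ ∞ X U)
    {h : EuclideanSpace ℝ (Fin n) → ℝ} (hh : ContDiffOn ℝ ∞ h U)
    {K : Set (EuclideanSpace ℝ (Fin n))} (hK : IsCompact K) (hKU : K ⊆ U)
    (h0 : ∀ y ∈ U, y ∉ K → h y = 0) :
    ∫ y in U, (fderiv ℝ h y (X y) + h y * euclideanDiv X y) = 0 := by
  have hXk : ∀ k, ContDiffOn ℝ ∞ (fun y => X y k) U := contDiffOn_euclidean.1 hX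
  have hφ : ∀ k, ContDiffOn ℝ ∞ (fun z => h z * X z k) U := fun k => hh.mul (hXk k)
  have hφ0 : ∀ k, ∀ y ∈ U, y ∉ K → h y * X y k = 0 := fun k y hy hyK => by
    rw [h0 y hy hyK, zero_mul]
  have hint : ∀ k, IntegrableOn (fun y => fderiv ℝ (fun z => h z * X z k) y
      (EuclideanSpace.single k 1)) U := by
    intro k
    refine integrableOn_of_zero_off_compact volume hU hK hKU
      (((hφ k).fderiv_of_isOpen hU (m := ∞) (by simp)).continuousOn.clm_apply
        continuousOn_const) fun y hy hyK => ?_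
    have : (fun z => h z * X z k) =ᶠ[nhds y] fun _ => 0 := by
      filter_upwards [hU.mem_nhds hy, hK.isClosed.isOpen_compl.mem_nhds hyK] with z hz hzK
        using hφ0 k z hz hzK
    rw [this.fderiv_eq]
    simp
  have hpt : ∀ y ∈ U, fderiv ℝ h y (X y) + h y * euclideanDiv X y =
      ∑ k, fderiv ℝ (fun z => h z * X z k) y (EuclideanSpace.single k 1) := fun y hy =>
    (sum_fderiv_mul_apply ((hX.contDiffAt (hU.mem_nhds hy)).differentiableAt (by simp))
      ((hh.contDiffAt (hU.mem_nhds hy)).differentiableAt (by simp))).symm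
  rw [setIntegral_congr_fun hU.measurableSet hpt, integral_finsetSum _ fun k _ => hint k]
  exact Finset.sum_eq_zero fun k _ =>
    setIntegral_fderiv_eq_zero volume hU hK hKU ((hφ k).of_le (by simp)) (hφ0 k) _

theorem contDiffOn_euclideanDiv {U : Set (EuclideanSpace ℝ (Fin n))} (hU : IsOpen U)
    {X : EuclideanSpace ℝ (Fin n) → EuclideanSpace ℝ (Fin n)} (hX : ContDiffOn ℝ ∞ X U) :
    ContDiffOn ℝ ∞ (euclideanDiv X) U :=
  ContDiffOn.sum fun k _ => contDiffOn_euclidean.1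
    ((hX.fderiv_of_isOpen hU (m := ∞) (by simp)).clm_apply contDiffOn_const) k

variable [MeasurableSpace M] [BorelSpace M] [T2Space M] [CompactSpace M]

/-- The adjoint of the Lie derivative along the gradient, in a chart. -/
theorem localWeight_lieGradAdj (hf : ContMDiff (𝓡 n) 𝓘(ℝ, ℝ) ∞ f) {η : DiffForm n M q}
    (hη : IsSmoothForm η) {c : M} (α : EuclideanSpace ℝ (Fin n) [⋀^Fin q]→L[ℝ] ℝ)
    {y : EuclideanSpace ℝ (Fin n)} (hy : y ∈ (extChartAt (𝓡 n) c).target) :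
    localWeight g q c y α (localForm c (lieGradAdj g f η) y) =
      localWeight g q c y (derivAct (fderiv ℝ (localField c (gradient g f)) y) α)
          (localForm c η y) -
        localWeight g q c y α (localForm c η y) * euclideanDiv (localField c (gradient g f)) y -
        fderiv ℝ (fun z => localWeight g q c z α (localForm c η z)) y
          (localField c (gradient g f) y) := by
  set U := (extChartAt (𝓡 n) c).target with hU
  set X := localField c (gradient g f) with hXdef
  have hUo : IsOpen U := extChartAt_target_isOpen c
  have hX : ContDiffOn ℝ ∞ X U := contDiffOn_localField_gradient g hf c
  have hA := hη.lieGradAdj g hf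
  set s : EuclideanSpace ℝ (Fin n) → ℝ := fun z => localWeight g q c z α (localForm c η z) with hs
  have hss : ContDiffOn ℝ ∞ s U :=
    ((contDiffOn_localWeight g c).clm_apply contDiffOn_const).clm_apply (hη.contDiffOn c)
  set r : EuclideanSpace ℝ (Fin n) → ℝ := fun z =>
    localWeight g q c z (derivAct (fderiv ℝ X z) α) (localForm c η z) with hr
  have hrs : ContinuousOn r U := by
    have h1 : ContinuousOn (fun z => derivAct (fderiv ℝ X z) α) U :=
      (α.fderivCompContinuousLinearMap (ContinuousLinearMap.id ℝ _)).continuous.comp_continuousOn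
        (hX.fderiv_of_isOpen hUo (m := ∞) (by simp)).continuousOn
    exact ((contDiffOn_localWeight g c).continuousOn.clm_apply h1).clm_apply
      (hη.contDiffOn c).continuousOn
  -- `F` is the difference of the two sides, with `α` frozen and the point variable. Being
  -- continuous, it vanishes once it integrates to zero against every test function `ψ`.
  set F : EuclideanSpace ℝ (Fin n) → ℝ := fun z =>
    localWeight g q c z α (localForm c (lieGradAdj g f η) z) -
      (r z - s z * euclideanDiv X z - fderiv ℝ s z (X z)) with hF
  have hFc : ContinuousOn F U :=
    (((contDiffOn_localWeight g c).clm_apply contDiffOn_const).clm_apply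
      (hA.contDiffOn c)).continuousOn.sub ((hrs.sub
        (hss.mul (contDiffOn_euclideanDiv hUo hX)).continuousOn).sub
        ((hss.fderiv_of_isOpen hUo (m := ∞) (by simp)).clm_apply hX).continuousOn)
  refine sub_eq_zero.1 (eq_zero_of_integral_contDiff_smul volume hUo hFc (fun ψ hψ hψc hψU => ?_) hy)
  have hK : IsCompact (tsupport ψ) := hψc
  -- The test form `ψ α` is fed into the adjointness relation; the derivative in `L` falls on `ψ`
  -- alone since `α` is constant in the chart.
  set w : EuclideanSpace ℝ (Fin n) → EuclideanSpace ℝ (Fin n) [⋀^Fin q]→L[ℝ] ℝ :=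
    fun z => ψ z • α with hw
  have hw0 : ∀ z ∈ U, z ∉ tsupport ψ → w z = 0 := fun z _ hz => by
    simp only [hw, image_eq_zero_of_notMem_tsupport hz, zero_smul]
  have hws : ContDiffOn ℝ ∞ w U := (hψ.smul contDiff_const).contDiffOn
  have hu := isSmoothForm_extendForm hK hψU hws hw0
  have hlie0 : ∀ x ∉ (extChartAt (𝓡 n) c).source, lieGrad g f (extendForm c w) x = 0 := fun x hx =>
    lieGrad_eq_zero_of_eventually g (extendForm_eventuallyEq_zero hK hψU hw0 hx)
  have hadj := l2Inner_lieGradAdj g hf hu hη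
  rw [l2Inner_eq_setIntegral g hu hA fun x hx => Or.inl (extendForm_of_notMem hx w),
    l2Inner_eq_setIntegral g (hu.lieGrad g hf) hη fun x hx => Or.inl (hlie0 x hx)] at hadj
  have hL : ∀ z ∈ U, localWeight g q c z (localForm c (extendForm c w) z)
      (localForm c (lieGradAdj g f η) z) =
      ψ z * localWeight g q c z α (localForm c (lieGradAdj g f η) z) := by
    intro z hz
    rw [localForm_extendForm c w hz]
    simp [hw]
  have hR : ∀ z ∈ U, localWeight g q c z (localForm c (lieGrad g f (extendForm c w)) z)
      (localForm c η z) = fderiv ℝ ψ z (X z) * s z + ψ z * r z := by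
    intro z hz
    have h1 : localForm c (extendForm c w) =ᶠ[nhds z] w := by
      filter_upwards [hUo.mem_nhds hz] with z' hz' using localForm_extendForm c w hz'
    have h2 : fderiv ℝ w z (X z) = fderiv ℝ ψ z (X z) • α := by
      rw [hw, fderiv_smul_const (hψ.differentiable (by simp) z)]
      rfl
    have h3 : derivAct (fderiv ℝ X z) (ψ z • α) = ψ z • derivAct (fderiv ℝ X z) α := by
      ext v
      simp [derivAct_apply, Finset.mul_sum]
    rw [localForm_lieGrad g hf hu hz, h1.fderiv_eq, h1.eq_of_nhds, ← hXdef, h2]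
    simp only [hw, h3, map_add, map_smul, _root_.add_apply, _root_.smul_apply, smul_eq_mul, hs, hr]
  rw [setIntegral_congr_fun hUo.measurableSet hL, setIntegral_congr_fun hUo.measurableSet hR]
    at hadj
  have hψs : ContDiffOn ℝ ∞ (fun z => ψ z * s z) U := hψ.contDiffOn.mul hss
  have hψ0 : ∀ z ∈ U, z ∉ tsupport ψ → ψ z = 0 := fun z _ hz => image_eq_zero_of_notMem_tsupport hz
  have hdiv := setIntegral_fderiv_apply hUo hX hψs hK hψU fun z hz hzK => by
    rw [hψ0 z hz hzK, zero_mul]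
  -- The divergence of `ψ s X` is the integrand of the `L` side minus `ψ` times the claimed
  -- expression, so integration by parts moves the derivative from `ψ` to `s`.
  have hdpt : ∀ z ∈ U, fderiv ℝ (fun z => ψ z * s z) z (X z) + ψ z * s z * euclideanDiv X z =
      (fderiv ℝ ψ z (X z) * s z + ψ z * r z) -
        ψ z * (r z - s z * euclideanDiv X z - fderiv ℝ s z (X z)) := by
    intro z hz
    rw [fderiv_fun_mul (hψ.differentiable (by simp) z)
      ((hss.contDiffAt (hUo.mem_nhds hz)).differentiableAt (by simp))]
    simp only [_root_.add_apply, _root_.smul_apply, smul_eq_mul]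
    ring
  have hdψ0 : ∀ z ∈ U, z ∉ tsupport ψ → fderiv ℝ ψ z = 0 := fun z _ hz =>
    image_eq_zero_of_notMem_tsupport fun h => hz (tsupport_fderiv_subset ℝ h)
  have hi1 : IntegrableOn (fun z => fderiv ℝ ψ z (X z) * s z + ψ z * r z) U := by
    refine integrableOn_of_zero_off_compact volume hUo hK hψU
      ((((hψ.continuous_fderiv (by simp)).continuousOn.clm_apply hX.continuousOn).mul
        hss.continuousOn).add (hψ.continuous.continuousOn.mul hrs)) fun z hz hzK => ?_
    rw [hdψ0 z hz hzK, hψ0 z hz hzK]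
    simp
  have hi2 : IntegrableOn
      (fun z => ψ z * (r z - s z * euclideanDiv X z - fderiv ℝ s z (X z))) U := by
    refine integrableOn_of_zero_off_compact volume hUo hK hψU
      (hψ.continuous.continuousOn.mul ((hrs.sub
        (hss.mul (contDiffOn_euclideanDiv hUo hX)).continuousOn).sub
        ((hss.fderiv_of_isOpen hUo (m := ∞) (by simp)).clm_apply hX).continuousOn))
      fun z hz hzK => ?_
    rw [hψ0 z hz hzK, zero_mul]
  have hi3 : IntegrableOn
      (fun z => ψ z * localWeight g q c z α (localForm c (lieGradAdj g f η) z)) U := by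
    refine integrableOn_of_zero_off_compact volume hUo hK hψU
      (hψ.continuous.continuousOn.mul (((contDiffOn_localWeight g c).clm_apply
        contDiffOn_const).clm_apply (hA.contDiffOn c)).continuousOn) fun z hz hzK => ?_
    rw [hψ0 z hz hzK, zero_mul]
  rw [setIntegral_congr_fun hUo.measurableSet hdpt, integral_sub hi1 hi2, ← hadj,
    ← integral_sub hi3 hi2] at hdiv
  rw [← hdiv]
  exact setIntegral_congr_fun hUo.measurableSet fun z _ => mul_sub _ _ _

end LocalAdjoint

end Witten
end

noncomputable section
namespace Witten

set_option maxSynthPendingDepth 3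

/-! ### Derivatives of determinants and inverses -/

section MatrixDerivative

variable {n : ℕ}

/-- Jacobi's formula. -/
theorem hasDerivAt_det {A : ℝ → Matrix (Fin n) (Fin n) ℝ} {N : Matrix (Fin n) (Fin n) ℝ} {s : ℝ}
    (h : ∀ i j, HasDerivAt (fun r => A r i j) (N i j) s) :
    HasDerivAt (fun r => (A r).det) ((A s).adjugate * N).trace s := by
  -- By Cramer's rule the diagonal entry is the determinant with column `i` replaced by that of `N`,
  -- the term that the product rule produces when it differentiates column `i`.
  have h1 : ∀ i, ((A s).adjugate * N) i i = ∑ σ : Equiv.Perm (Fin n),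
      ((Equiv.Perm.sign σ : ℤ) : ℝ) *
        ((∏ j ∈ Finset.univ.erase i, A s (σ j) j) • N (σ i) i) := by
    intro i
    have h2 : ((A s).adjugate * N) i i = (A s).cramer (fun k => N k i) i := by
      rw [Matrix.cramer_eq_adjugate_mulVec]
      rfl
    rw [h2, Matrix.cramer_apply, Matrix.det_apply']
    refine Finset.sum_congr rfl fun σ _ => ?_
    rw [← Finset.mul_prod_erase _ _ (Finset.mem_univ i), Matrix.updateCol_self, smul_eq_mul,
      mul_comm (N (σ i) i)]
    congr 2
    refine Finset.prod_congr rfl fun j hj => ?_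
    rw [Matrix.updateCol_ne (Finset.ne_of_mem_erase hj)]
  simp only [Matrix.trace, Matrix.diag_apply, h1]
  rw [Finset.sum_comm]
  simp only [← Finset.mul_sum, Matrix.det_apply']
  exact HasDerivAt.fun_sum fun σ _ => HasDerivAt.const_mul _
    (HasDerivAt.fun_finsetProd fun i _ => h (σ i) i)

/-- Differentiating `K A = 1` gives `K' A + K N = 0`; multiply by `K` on the right. -/
theorem hasDerivAt_matrix_inv_eq {A K : ℝ → Matrix (Fin n) (Fin n) ℝ}
    {N K' : Matrix (Fin n) (Fin n) ℝ} {s : ℝ}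
    (hA : ∀ i j, HasDerivAt (fun r => A r i j) (N i j) s)
    (hK : ∀ i j, HasDerivAt (fun r => K r i j) (K' i j) s)
    (h : ∀ᶠ r in nhds s, K r * A r = 1) : K' = -(K s * N * K s) := by
  have h1 : K' * A s + K s * N = 0 := by
    ext i j
    have h2 : HasDerivAt (fun r => ∑ k, K r i k * A r k j)
        (∑ k, (K' i k * A s k j + K s i k * N k j)) s :=
      HasDerivAt.fun_sum fun k _ => (hK i k).mul (hA k j)
    have h3 : (fun r => ∑ k, K r i k * A r k j) =ᶠ[nhds s]
        fun _ => (1 : Matrix (Fin n) (Fin n) ℝ) i j := by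
      filter_upwards [h] with r hr
      rw [← hr, Matrix.mul_apply]
    have h4 := h2.unique ((hasDerivAt_const s _).congr_of_eventuallyEq h3)
    rw [Matrix.add_apply, Matrix.mul_apply, Matrix.mul_apply, ← Finset.sum_add_distrib, h4,
      Matrix.zero_apply]
  have h5 : A s * K s = 1 := mul_eq_one_comm.1 h.self_of_nhds
  calc K' = K' * (A s * K s) := by rw [h5, mul_one]
    _ = (K' * A s) * K s := by rw [Matrix.mul_assoc]
    _ = -(K s * N * K s) := by rw [eq_neg_of_add_eq_zero_left h1, Matrix.neg_mul]

end MatrixDerivative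

/-! ### Derivative of the weighted inner product along a vector -/

section WeightDerivative

variable {n q : ℕ} {M : Type*} [TopologicalSpace M] [ChartedSpace (EuclideanSpace ℝ (Fin n)) M]
  [IsManifold (𝓡 n) ∞ M] (g : RMetric n M)

/-- The derivative of the metric coefficients along a vector. -/
def metricDeriv (c : M) (y v : EuclideanSpace ℝ (Fin n)) : Matrix (Fin n) (Fin n) ℝ :=
  Matrix.of fun i j => fderiv ℝ (fun z => metricCoeff g c z i j) y v

variable {c : M} {y : EuclideanSpace ℝ (Fin n)} (hy : y ∈ (extChartAt (𝓡 n) c).target)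
include hy

omit [IsManifold (𝓡 n) ∞ M] in
theorem hasDerivAt_line {F : Type*} [NormedAddCommGroup F] [NormedSpace ℝ F]
    {h : EuclideanSpace ℝ (Fin n) → F} (hh : ContDiffOn ℝ ∞ h (extChartAt (𝓡 n) c).target)
    (v : EuclideanSpace ℝ (Fin n)) :
    HasDerivAt (fun r : ℝ => h (y + r • v)) (fderiv ℝ h y v) 0 :=
  ((hh.contDiffAt ((extChartAt_target_isOpen c).mem_nhds hy)).differentiableAt
    (by simp)).hasFDerivAt.hasLineDerivAt v

theorem cometricCoeff_mul_metricCoeff : cometricCoeff g c y * metricCoeff g c y = 1 :=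
  Matrix.nonsing_inv_mul _ (metricCoeff_det_pos g c hy).ne'.isUnit

omit [IsManifold (𝓡 n) ∞ M] in
theorem eventually_line_mem (v : EuclideanSpace ℝ (Fin n)) :
    ∀ᶠ r : ℝ in nhds 0, y + r • v ∈ (extChartAt (𝓡 n) c).target := by
  have h : Filter.Tendsto (fun r : ℝ => y + r • v) (nhds 0) (nhds (y + (0 : ℝ) • v)) :=
    Continuous.tendsto (by fun_prop) 0
  rw [zero_smul, add_zero] at h
  exact h.eventually_mem ((extChartAt_target_isOpen c).mem_nhds hy)

theorem hasDerivAt_cometricCoeff_line (v : EuclideanSpace ℝ (Fin n)) (i j : Fin n) :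
    HasDerivAt (fun r : ℝ => cometricCoeff g c (y + r • v) i j)
      ((-(cometricCoeff g c y * metricDeriv g c y v * cometricCoeff g c y)) i j) 0 := by
  have h := hasDerivAt_matrix_inv_eq (A := fun r : ℝ => metricCoeff g c (y + r • v))
    (K := fun r : ℝ => cometricCoeff g c (y + r • v)) (N := metricDeriv g c y v)
    (K' := Matrix.of fun i j => fderiv ℝ (fun z => cometricCoeff g c z i j) y v)
    (fun i j => hasDerivAt_line hy (contDiffOn_metricCoeff g c i j) v)
    (fun i j => hasDerivAt_line hy (contDiffOn_cometricCoeff g c i j) v)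
    ((eventually_line_mem hy v).mono fun r hr => cometricCoeff_mul_metricCoeff g hr)
  simp only [zero_smul, add_zero] at h
  rw [← h]
  exact hasDerivAt_line hy (contDiffOn_cometricCoeff g c i j) v

theorem hasDerivAt_volDensity_line (v : EuclideanSpace ℝ (Fin n)) :
    HasDerivAt (fun r : ℝ => volDensity g c (y + r • v))
      (1 / 2 * (cometricCoeff g c y * metricDeriv g c y v).trace * volDensity g c y) 0 := by
  have hpos := metricCoeff_det_pos g c hy
  have h := hasDerivAt_det (A := fun r : ℝ => metricCoeff g c (y + r • v))
    (N := metricDeriv g c y v) fun i j => hasDerivAt_line hy (contDiffOn_metricCoeff g c i j) v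
  have h1 := h.sqrt (by simpa using hpos.ne')
  simp only [zero_smul, add_zero] at h1
  have h2 : (fun r : ℝ => volDensity g c (y + r • v)) =ᶠ[nhds 0]
      fun r => √(metricCoeff g c (y + r • v)).det :=
    (eventually_line_mem hy v).mono fun r hr => by
      simp only [volDensity, abs_of_pos (metricCoeff_det_pos g c hr)]
  refine (h1.congr_of_eventuallyEq h2).congr_deriv ?_
  have h3 : (metricCoeff g c y).adjugate = (metricCoeff g c y).det • cometricCoeff g c y := by
    rw [cometricCoeff, Matrix.inv_def, Ring.inverse_eq_inv', smul_smul, mul_inv_cancel₀ hpos.ne',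
      one_smul]
  rw [h3, Matrix.smul_mul, Matrix.trace_smul, smul_eq_mul, volDensity, abs_of_pos hpos]
  have h4 : √(metricCoeff g c y).det ≠ 0 := (Real.sqrt_pos.2 hpos).ne'
  field_simp
  rw [Real.sq_sqrt hpos.le]
  ring

omit hy in
theorem localWeight_apply (α β : EuclideanSpace ℝ (Fin n) [⋀^Fin q]→L[ℝ] ℝ) :
    localWeight g q c y α β = volDensity g c y *
      coordInner (cometricCoeff g c y) (fun i => EuclideanSpace.single i (1 : ℝ)) α β := by
  rw [← coordPairing_apply]
  rfl

/-- Product rule for `√det G` times the inner product: the density contributes half the trace by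
Jacobi's formula, the inner product varies through `K' = -K N K`. Derivatives are taken along the
line through `y` in the direction `v`, which reduces them to one variable. -/
theorem fderiv_localWeight_apply (v : EuclideanSpace ℝ (Fin n))
    (α β : EuclideanSpace ℝ (Fin n) [⋀^Fin q]→L[ℝ] ℝ) :
    fderiv ℝ (localWeight g q c) y v α β =
      1 / 2 * (cometricCoeff g c y * metricDeriv g c y v).trace * localWeight g q c y α β -
      volDensity g c y * coordInnerDeriv (cometricCoeff g c y)
        (cometricCoeff g c y * metricDeriv g c y v * cometricCoeff g c y)
        (fun i => EuclideanSpace.single i (1 : ℝ)) α β := by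
  have h1 : HasDerivAt (fun r : ℝ => localWeight g q c (y + r • v) α β)
      (fderiv ℝ (localWeight g q c) y v α β) 0 := by
    have h := hasDerivAt_line hy (contDiffOn_localWeight g (q := q) c) v
    have h2 := (h.clm_apply (hasDerivAt_const (0 : ℝ) α)).clm_apply (hasDerivAt_const (0 : ℝ) β)
    simpa using h2
  have h2 := (hasDerivAt_volDensity_line g hy v).mul (hasDerivAt_coordInner
    (fun i j => hasDerivAt_cometricCoeff_line g hy v i j)
    (fun i => EuclideanSpace.single i (1 : ℝ)) α β)
  have h3 : (fun r : ℝ => localWeight g q c (y + r • v) α β) =ᶠ[nhds 0]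
      fun r => volDensity g c (y + r • v) * coordInner (cometricCoeff g c (y + r • v))
        (fun i => EuclideanSpace.single i (1 : ℝ)) α β :=
    Filter.Eventually.of_forall fun r => localWeight_apply g α β
  rw [h1.unique (h2.congr_of_eventuallyEq h3), localWeight_apply g]
  simp only [zero_smul, add_zero, coordInnerDeriv_neg]
  ring

end WeightDerivative

/-! ### The Hessian as the Lie derivative of the metric -/

section HessianMatrix

variable {n q : ℕ} {M : Type*} [TopologicalSpace M] [ChartedSpace (EuclideanSpace ℝ (Fin n)) M]
  [IsManifold (𝓡 n) ∞ M] (g : RMetric n M)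

/-- The components of the Hessian in the chart at `c`. -/
def hessCoeff (f : M → ℝ) (c : M) (y : EuclideanSpace ℝ (Fin n)) : Matrix (Fin n) (Fin n) ℝ :=
  Matrix.of fun i j => partialD i (covectorCoeff c (mvfderiv (𝓡 n) f) j) y -
    ∑ l, christoffel g c y l i j * covectorCoeff c (mvfderiv (𝓡 n) f) l y

/-- The components of the derivative of a vector field on `ℝⁿ`. -/
def fieldDeriv (X : EuclideanSpace ℝ (Fin n) → EuclideanSpace ℝ (Fin n))
    (y : EuclideanSpace ℝ (Fin n)) : Matrix (Fin n) (Fin n) ℝ :=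
  Matrix.of fun k j => fderiv ℝ X y (EuclideanSpace.single j 1) k

variable {f : M → ℝ} (hf : ContMDiff (𝓡 n) 𝓘(ℝ, ℝ) ∞ f)
  {c : M} {y : EuclideanSpace ℝ (Fin n)} (hy : y ∈ (extChartAt (𝓡 n) c).target)
include hf hy

theorem covectorCoeff_mvfderiv (j : Fin n) :
    covectorCoeff c (mvfderiv (𝓡 n) f) j y =
      partialD j (fun z => f ((extChartAt (𝓡 n) c).symm z)) y := by
  rw [partialD, ← mvfderiv_comp_chartInvDeriv hy (hf.mdifferentiableAt (by simp))]
  rfl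

theorem partialD_covectorCoeff (i j : Fin n) :
    partialD i (covectorCoeff c (mvfderiv (𝓡 n) f) j) y =
      fderiv ℝ (fderiv ℝ fun z => f ((extChartAt (𝓡 n) c).symm z)) y (EuclideanSpace.single i 1)
        (EuclideanSpace.single j 1) := by
  have h : covectorCoeff c (mvfderiv (𝓡 n) f) j =ᶠ[nhds y]
      fun w => fderiv ℝ (fun z => f ((extChartAt (𝓡 n) c).symm z)) w (EuclideanSpace.single j 1) := by
    filter_upwards [(extChartAt_target_isOpen c).mem_nhds hy] with w hw
    exact covectorCoeff_mvfderiv hf hw j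
  have hd : DifferentiableAt ℝ (fderiv ℝ fun z => f ((extChartAt (𝓡 n) c).symm z)) y :=
    ((contDiffAt_comp_extChartAt_symm hf hy).fderiv_right (m := ∞) (by simp)).differentiableAt
      (by simp)
  rw [partialD, h.fderiv_eq, fderiv_clm_apply hd (differentiableAt_const _)]
  simp

theorem partialD_covectorCoeff_comm (i j : Fin n) :
    partialD i (covectorCoeff c (mvfderiv (𝓡 n) f) j) y =
      partialD j (covectorCoeff c (mvfderiv (𝓡 n) f) i) y := by
  rw [partialD_covectorCoeff hf hy, partialD_covectorCoeff hf hy]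
  have h := (contDiffAt_comp_extChartAt_symm hf hy).isSymmSndFDerivAt
    (by rw [minSmoothness_of_isRCLikeNormedField]; exact WithTop.coe_le_coe.2 (le_top : (2 : ℕ∞) ≤ ⊤))
  exact h _ _

/-- This is `∂_i` of the identity `∑ m, g_{jm} X^m = ∂_j f`, which holds throughout the chart. -/
theorem sum_partialD_metricCoeff_add (i j : Fin n) :
    ∑ m, (partialD i (fun z => metricCoeff g c z j m) y * localField c (gradient g f) y m +
      metricCoeff g c y j m * fieldDeriv (localField c (gradient g f)) y m i) =
      partialD i (covectorCoeff c (mvfderiv (𝓡 n) f) j) y := by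
  have ht := (extChartAt_target_isOpen c).mem_nhds hy
  have h : covectorCoeff c (mvfderiv (𝓡 n) f) j =ᶠ[nhds y]
      fun w => ∑ m, metricCoeff g c w j m * localField c (gradient g f) w m := by
    filter_upwards [ht] with w hw
    rw [covectorCoeff_mvfderiv hf hw, sum_metricCoeff_gradient g hf hw]
  have hX := ((contDiffOn_localField_gradient g hf c).contDiffAt ht).differentiableAt (by simp)
  have hXm : ∀ m, HasFDerivAt (fun z => localField c (gradient g f) z m)
      ((EuclideanSpace.proj m : EuclideanSpace ℝ (Fin n) →L[ℝ] ℝ).comp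
        (fderiv ℝ (localField c (gradient g f)) y)) y := fun m =>
    hasFDerivAt_clm_comp (EuclideanSpace.proj m : EuclideanSpace ℝ (Fin n) →L[ℝ] ℝ) hX.hasFDerivAt
  have hG : ∀ m, DifferentiableAt ℝ (fun z => metricCoeff g c z j m) y := fun m =>
    ((contDiffOn_metricCoeff g c j m).contDiffAt ht).differentiableAt (by simp)
  rw [partialD, h.fderiv_eq,
    (HasFDerivAt.fun_sum fun m _ => (hG m).hasFDerivAt.fun_mul (hXm m)).fderiv, _root_.sum_apply]
  refine Finset.sum_congr rfl fun m _ => ?_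
  rw [add_comm, mul_comm (partialD i _ y)]
  rfl

/-- The inverse metric inside the Christoffel symbol raises the index of `df`, turning it into the
gradient `X`. -/
theorem sum_christoffel_mul (i j : Fin n) :
    2 * ∑ l, christoffel g c y l i j * covectorCoeff c (mvfderiv (𝓡 n) f) l y =
      ∑ m, localField c (gradient g f) y m *
        (partialD i (fun z => metricCoeff g c z j m) y +
          partialD j (fun z => metricCoeff g c z i m) y -
          partialD m (fun z => metricCoeff g c z i j) y) := by
  have hK : ∀ l m, (metricCoeff g c y)⁻¹ l m = cometricCoeff g c y m l := by
    intro l m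
    have h : (metricCoeff g c y).transpose = metricCoeff g c y := by
      ext a b
      exact metricCoeff_symm g c y b a
    rw [cometricCoeff, ← Matrix.transpose_apply (metricCoeff g c y)⁻¹ l m,
      Matrix.transpose_nonsing_inv, h]
  simp only [localField_gradient g hf hy, covectorCoeff_mvfderiv hf hy, christoffel, hK,
    Finset.mul_sum, Finset.sum_mul]
  rw [Finset.sum_comm]
  exact Finset.sum_congr rfl fun m _ => Finset.sum_congr rfl fun l _ => by ring

/-- The Hessian is half the Lie derivative of the metric along the gradient. -/
theorem two_smul_hessCoeff :
    (2 : ℝ) • hessCoeff g f c y =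
      metricCoeff g c y * fieldDeriv (localField c (gradient g f)) y +
      (fieldDeriv (localField c (gradient g f)) y).transpose * metricCoeff g c y +
      metricDeriv g c y (localField c (gradient g f) y) := by
  ext i j
  have hN : metricDeriv g c y (localField c (gradient g f) y) i j =
      ∑ m, localField c (gradient g f) y m * partialD m (fun z => metricCoeff g c z i j) y := by
    rw [metricDeriv, Matrix.of_apply]
    conv_lhs => rw [← (EuclideanSpace.basisFun (Fin n) ℝ).sum_repr
      (localField c (gradient g f) y), map_sum]
    simp [partialD]
  have h1 := sum_partialD_metricCoeff_add g hf hy i j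
  have h2 := sum_partialD_metricCoeff_add g hf hy j i
  have h3 := sum_christoffel_mul g hf hy i j
  have h4 := partialD_covectorCoeff_comm hf hy i j
  rw [Matrix.smul_apply, Matrix.add_apply, Matrix.add_apply, hN, hessCoeff, Matrix.of_apply,
    smul_eq_mul, mul_sub, h3, two_mul]
  -- One of the two copies of `∂_i ∂_j f` is commuted. Expanding one as `∂_i (G X)_j` and the other
  -- as `∂_j (G X)_i` produces the terms `G B` and `Bᵀ G` and cancels two of the three metric
  -- derivatives from the Christoffel symbols.
  nth_rewrite 2 [h4]
  rw [← h1, ← h2, Matrix.mul_apply, Matrix.mul_apply]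
  simp only [← Finset.sum_add_distrib, ← Finset.sum_sub_distrib]
  refine Finset.sum_congr rfl fun m _ => ?_
  rw [Matrix.transpose_apply, metricCoeff_symm g c y j m]
  ring

theorem hessCoeff_symm : (hessCoeff g f c y).transpose = hessCoeff g f c y := by
  ext i j
  have h1 := sum_christoffel_mul g hf hy i j
  have h2 := sum_christoffel_mul g hf hy j i
  have h4 := partialD_covectorCoeff_comm hf hy i j
  have h5 : (fun z => metricCoeff g c z i j) = fun z => metricCoeff g c z j i :=
    funext fun z => metricCoeff_symm g c z i j
  rw [Matrix.transpose_apply]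
  simp only [hessCoeff, Matrix.of_apply]
  have h6 : ∑ l, christoffel g c y l i j * covectorCoeff c (mvfderiv (𝓡 n) f) l y =
      ∑ l, christoffel g c y l j i * covectorCoeff c (mvfderiv (𝓡 n) f) l y := by
    have h7 : ∀ a b : ℝ, 2 * a = 2 * b → a = b := fun a b h => by linarith
    refine h7 _ _ ?_
    rw [h1, h2]
    refine Finset.sum_congr rfl fun m _ => ?_
    rw [h5]
    ring
  rw [h4, h6]

end HessianMatrix

end Witten
end

noncomputable section
namespace Witten

set_option maxSynthPendingDepth 3

/-! ### The sum of the Lie derivative and its adjoint -/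

section HessianEndomorphism

variable {n q : ℕ} {M : Type*} [TopologicalSpace M] [ChartedSpace (EuclideanSpace ℝ (Fin n)) M]
  [IsManifold (𝓡 n) ∞ M] (g : RMetric n M)

/-- The endomorphism metrically associated with the Hessian, in the chart at `c`. -/
def hessEndo (f : M → ℝ) (c : M) (y : EuclideanSpace ℝ (Fin n)) :
    EuclideanSpace ℝ (Fin n) →L[ℝ] EuclideanSpace ℝ (Fin n) :=
  LinearMap.toContinuousLinearMap (Matrix.toLin (EuclideanSpace.basisFun (Fin n) ℝ).toBasis
    (EuclideanSpace.basisFun (Fin n) ℝ).toBasis (cometricCoeff g c y * hessCoeff g f c y))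

theorem hessEndo_single (f : M → ℝ) (c : M) (y : EuclideanSpace ℝ (Fin n)) (j : Fin n) :
    hessEndo g f c y (EuclideanSpace.single j 1) =
      ∑ k, (cometricCoeff g c y * hessCoeff g f c y) k j • EuclideanSpace.single k (1 : ℝ) := by
  have h := Matrix.toLin_self (EuclideanSpace.basisFun (Fin n) ℝ).toBasis
    (EuclideanSpace.basisFun (Fin n) ℝ).toBasis (cometricCoeff g c y * hessCoeff g f c y) j
  simp only [OrthonormalBasis.coe_toBasis, EuclideanSpace.basisFun_apply] at h
  exact h

theorem hessEndo_apply (f : M → ℝ) (c : M) (y v : EuclideanSpace ℝ (Fin n)) (k : Fin n) :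
    hessEndo g f c y v k = ∑ j, (cometricCoeff g c y * hessCoeff g f c y) k j * v j := by
  conv_lhs => rw [← (EuclideanSpace.basisFun (Fin n) ℝ).sum_repr v]
  simp only [EuclideanSpace.basisFun_repr, EuclideanSpace.basisFun_apply, map_sum, map_smul,
    hessEndo_single]
  simp [Pi.single_apply, mul_comm]

theorem trace_hessEndo (f : M → ℝ) (c : M) (y : EuclideanSpace ℝ (Fin n)) :
    LinearMap.trace ℝ (EuclideanSpace ℝ (Fin n)) (hessEndo g f c y).toLinearMap =
      (cometricCoeff g c y * hessCoeff g f c y).trace := by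
  rw [LinearMap.trace_eq_matrix_trace ℝ (EuclideanSpace.basisFun (Fin n) ℝ).toBasis]
  exact congrArg Matrix.trace (LinearMap.toMatrix_toLin _ _ _)

theorem fderiv_single (X : EuclideanSpace ℝ (Fin n) → EuclideanSpace ℝ (Fin n))
    (y : EuclideanSpace ℝ (Fin n)) (j : Fin n) :
    fderiv ℝ X y (EuclideanSpace.single j 1) =
      ∑ k, fieldDeriv X y k j • EuclideanSpace.single k (1 : ℝ) := by
  conv_lhs => rw [← (EuclideanSpace.basisFun (Fin n) ℝ).sum_repr
    (fderiv ℝ X y (EuclideanSpace.single j 1))]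
  simp [fieldDeriv]

theorem cometricCoeff_symm (c : M) (y : EuclideanSpace ℝ (Fin n)) :
    (cometricCoeff g c y).transpose = cometricCoeff g c y := by
  have h : (metricCoeff g c y).transpose = metricCoeff g c y := by
    ext a b
    exact metricCoeff_symm g c y b a
  rw [cometricCoeff, Matrix.transpose_nonsing_inv, h]

variable {f : M → ℝ} (hf : ContMDiff (𝓡 n) 𝓘(ℝ, ℝ) ∞ f)
  {c : M} {y : EuclideanSpace ℝ (Fin n)} (hy : y ∈ (extChartAt (𝓡 n) c).target)
include hf hy

theorem two_smul_cometricCoeff_mul_hessCoeff :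
    (2 : ℝ) • (cometricCoeff g c y * hessCoeff g f c y) =
      fieldDeriv (localField c (gradient g f)) y +
      cometricCoeff g c y * (fieldDeriv (localField c (gradient g f)) y).transpose *
        metricCoeff g c y +
      cometricCoeff g c y * metricDeriv g c y (localField c (gradient g f) y) := by
  rw [← Matrix.mul_smul, two_smul_hessCoeff g hf hy, Matrix.mul_add, Matrix.mul_add,
    ← Matrix.mul_assoc, cometricCoeff_mul_metricCoeff g hy, Matrix.one_mul, ← Matrix.mul_assoc]

/-- In the trace of `2 K H = B + K Bᵀ G + K N`, the middle term has the trace of `B` by cyclicity,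
and that trace is the divergence of `X`. -/
theorem two_mul_trace_hessEndo :
    2 * LinearMap.trace ℝ (EuclideanSpace ℝ (Fin n)) (hessEndo g f c y).toLinearMap =
      2 * euclideanDiv (localField c (gradient g f)) y +
      (cometricCoeff g c y * metricDeriv g c y (localField c (gradient g f) y)).trace := by
  have h := congrArg Matrix.trace (two_smul_cometricCoeff_mul_hessCoeff g hf hy)
  have hG : metricCoeff g c y * cometricCoeff g c y = 1 :=
    mul_eq_one_comm.1 (cometricCoeff_mul_metricCoeff g hy)
  have hd : (fieldDeriv (localField c (gradient g f)) y).trace =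
    euclideanDiv (localField c (gradient g f)) y := rfl
  rw [Matrix.trace_smul, Matrix.trace_add, Matrix.trace_add, Matrix.trace_mul_comm _
    (metricCoeff g c y), ← Matrix.mul_assoc, hG, Matrix.one_mul, Matrix.trace_transpose, hd,
    smul_eq_mul] at h
  rw [trace_hessEndo, h]
  ring

/-- The three terms are derivatives of the inner product in the directions `K Bᵀ`, `B K` and `K N
K`. These add up to `2 K H K`, and since `K` and `H` are symmetric, `K H K = K (K H)ᵀ` is the
direction belonging to the endomorphism `K H`. -/
theorem localWeight_hessEndo (α β : EuclideanSpace ℝ (Fin n) [⋀^Fin q]→L[ℝ] ℝ) :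
    localWeight g q c y α (derivAct (fderiv ℝ (localField c (gradient g f)) y) β) +
      localWeight g q c y (derivAct (fderiv ℝ (localField c (gradient g f)) y) α) β +
      volDensity g c y * coordInnerDeriv (cometricCoeff g c y)
        (cometricCoeff g c y * metricDeriv g c y (localField c (gradient g f) y) *
          cometricCoeff g c y) (fun i => EuclideanSpace.single i (1 : ℝ)) α β =
      2 * localWeight g q c y α (derivAct (hessEndo g f c y) β) := by
  have hG : metricCoeff g c y * cometricCoeff g c y = 1 :=
    mul_eq_one_comm.1 (cometricCoeff_mul_metricCoeff g hy)
  have hK := cometricCoeff_symm g c y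
  have hB := fderiv_single (localField c (gradient g f)) y
  have hH : cometricCoeff g c y * (cometricCoeff g c y * hessCoeff g f c y).transpose =
      cometricCoeff g c y * hessCoeff g f c y * cometricCoeff g c y := by
    rw [Matrix.transpose_mul, hK, hessCoeff_symm g hf hy, Matrix.mul_assoc]
  have h2 := congrArg (fun A => A * cometricCoeff g c y)
    (two_smul_cometricCoeff_mul_hessCoeff g hf hy)
  simp only [Matrix.smul_mul, Matrix.add_mul] at h2
  rw [Matrix.mul_assoc (_ * _) (metricCoeff g c y), hG, Matrix.mul_one, two_smul] at h2
  simp only [localWeight_apply]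
  rw [← coordInnerDeriv_mul_transpose _ _ _ _ hB, ← coordInnerDeriv_mul hK _ _ _ hB,
    ← coordInnerDeriv_mul_transpose _ _ _ _ (hessEndo_single g f c y), hH, ← mul_add, ← mul_add,
    ← coordInnerDeriv_add, ← coordInnerDeriv_add, add_comm (_ * Matrix.transpose _), ← h2,
    coordInnerDeriv_add]
  ring

variable [MeasurableSpace M] [BorelSpace M] [T2Space M] [CompactSpace M]

/-- The sum of the Lie derivative along the gradient and its adjoint is of order zero. -/
theorem localForm_lieGrad_add_lieGradAdj {η : DiffForm n M q} (hη : IsSmoothForm η) :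
    localForm c (lieGrad g f η) y + localForm c (lieGradAdj g f η) y =
      (2 : ℝ) • derivAct (hessEndo g f c y) (localForm c η y) -
        LinearMap.trace ℝ (EuclideanSpace ℝ (Fin n)) (hessEndo g f c y).toLinearMap •
          localForm c η y := by
  have key : ∀ α, localWeight g q c y α
      (localForm c (lieGrad g f η) y + localForm c (lieGradAdj g f η) y) =
      localWeight g q c y α ((2 : ℝ) • derivAct (hessEndo g f c y) (localForm c η y) -
        LinearMap.trace ℝ (EuclideanSpace ℝ (Fin n)) (hessEndo g f c y).toLinearMap •
          localForm c η y) := by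
    intro α
    have ht := (extChartAt_target_isOpen c).mem_nhds hy
    have hW := ((contDiffOn_localWeight g (q := q) c).contDiffAt ht).differentiableAt (by simp)
    -- Only `η` and the weight depend on the point. The term with `∂_X η` cancels against the one in
    -- `L`, which is why no derivative of `η` remains.
    have hs : fderiv ℝ (fun z => localWeight g q c z α (localForm c η z)) y
        (localField c (gradient g f) y) =
        localWeight g q c y α
          (fderiv ℝ (localForm c η) y (localField c (gradient g f) y)) +
        fderiv ℝ (localWeight g q c) y (localField c (gradient g f) y) α (localForm c η y) := by
      rw [fderiv_clm_apply (hW.clm_apply (differentiableAt_const _))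
        ((hη.contDiffAt hy).differentiableAt (by simp)),
        fderiv_clm_apply hW (differentiableAt_const _)]
      simp
    rw [map_add, localForm_lieGrad g hf hη hy, localWeight_lieGradAdj g hf hη α hy, hs,
      fderiv_localWeight_apply g hy, map_add, map_sub, map_smul, map_smul, smul_eq_mul, smul_eq_mul]
    have h1 := localWeight_hessEndo g hf hy α (localForm c η y)
    have h2 := two_mul_trace_hessEndo g hf hy
    rw [← h1]
    have h3 : LinearMap.trace ℝ (EuclideanSpace ℝ (Fin n)) (hessEndo g f c y).toLinearMap =
      euclideanDiv (localField c (gradient g f)) y + 1 / 2 *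
      (cometricCoeff g c y * metricDeriv g c y (localField c (gradient g f) y)).trace := by
      linarith
    rw [h3]
    ring
  rw [← sub_eq_zero]
  refine eq_zero_of_localWeight_self g hy ?_
  rw [map_sub (localWeight g q c y _), key, sub_self]

end HessianEndomorphism

/-! ### The Hessian endomorphism on the tangent space -/

section Pointwise

variable {n q : ℕ} {M : Type*} [TopologicalSpace M] [ChartedSpace (EuclideanSpace ℝ (Fin n)) M]
  [IsManifold (𝓡 n) ∞ M] (g : RMetric n M)

theorem localForm_self (η : DiffForm n M q) (x : M) :
    localForm x η (extChartAt (𝓡 n) x x) = η x := by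
  have h := localForm_chartDerivAt η (mem_extChartAt_source (I := 𝓡 n) x)
  have h1 : chartDerivAt x x = ContinuousLinearMap.id ℝ (EuclideanSpace ℝ (Fin n)) :=
    chartDeriv_self x
  rw [← h, h1]
  rfl

theorem hess_eq_sum (f : M → ℝ) (x : M) (v w : TangentSpace (𝓡 n) x) :
    hess g f x v w = ∑ i, ∑ j, chartDeriv x v i * chartDeriv x w j *
      hessCoeff g f x (extChartAt (𝓡 n) x x) i j := rfl

/-- The endomorphism of the tangent space metrically associated with the Hessian. -/
def hessTangent (f : M → ℝ) (x : M) : TangentSpace (𝓡 n) x →L[ℝ] TangentSpace (𝓡 n) x :=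
  hessEndo g f x (extChartAt (𝓡 n) x x)

theorem sum_mul_mul_eq (A G S : Matrix (Fin n) (Fin n) ℝ) (v w : Fin n → ℝ)
    (h : ∀ i j, S i j = ∑ k, G k j * A k i) :
    ∑ k, ∑ j, (∑ i, A k i * v i) * w j * G k j = ∑ i, ∑ j, v i * w j * S i j := by
  simp only [h, Finset.mul_sum, Finset.sum_mul]
  rw [Finset.sum_congr rfl fun k _ => Finset.sum_comm, Finset.sum_comm]
  refine Finset.sum_congr rfl fun i _ => ?_
  rw [Finset.sum_comm]
  exact Finset.sum_congr rfl fun j _ => Finset.sum_congr rfl fun k _ => by ring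

/-- In the preferred chart at `x` this is `G (K H) = H`, combined with the symmetry of `G` and `H`.
-/
theorem inner_hessTangent {f : M → ℝ} (hf : ContMDiff (𝓡 n) 𝓘(ℝ, ℝ) ∞ f) (x : M)
    (v w : TangentSpace (𝓡 n) x) :
    g.inner x (hessTangent g f x v) w = hess g f x v w := by
  have hy := mem_extChartAt_target (I := 𝓡 n) x
  have hid : ∀ u : TangentSpace (𝓡 n) x, chartDeriv x u = u := fun u =>
    DFunLike.congr_fun (F := _ →L[ℝ] _) (chartDeriv_self x) u
  have hH : chartDerivAt x x (hessTangent g f x v) =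
      hessEndo g f x (extChartAt (𝓡 n) x x) (chartDeriv x v) := by
    rw [hid v]
    exact hid _
  have hG : metricCoeff g x (extChartAt (𝓡 n) x x) * cometricCoeff g x (extChartAt (𝓡 n) x x) = 1 :=
    mul_eq_one_comm.1 (cometricCoeff_mul_metricCoeff g hy)
  rw [hess_eq_sum, inner_eq_sum_metricCoeff g x hy (extChartAt_to_inv x), hH]
  set y := extChartAt (𝓡 n) x x
  have hS : hessCoeff g f x y = metricCoeff g x y * (cometricCoeff g x y * hessCoeff g f x y) := by
    rw [← Matrix.mul_assoc, hG, Matrix.one_mul]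
  have h1 : ∀ i j, hessCoeff g f x y i j =
      ∑ k, metricCoeff g x y k j * (cometricCoeff g x y * hessCoeff g f x y) k i := by
    intro i j
    have h2 : hessCoeff g f x y i j = hessCoeff g f x y j i :=
      (congrFun (congrFun (hessCoeff_symm g hf hy) i) j).symm
    rw [h2]
    conv_lhs => rw [hS]
    rw [Matrix.mul_apply]
    exact Finset.sum_congr rfl fun k _ => by rw [metricCoeff_symm g x y j k]
  simp only [hessEndo_apply]
  exact sum_mul_mul_eq _ _ _ _ _ h1

/-- The left side is the metric dual of the covector `Hess_f(v, ·)` written in the dual basis;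
pairing both sides with `w` gives `Hess_f(v, w)`. No orthonormality of `b` is needed, since `sharp`
supplies the inverse metric. -/
theorem sum_hess_smul_sharp {f : M → ℝ} (hf : ContMDiff (𝓡 n) 𝓘(ℝ, ℝ) ∞ f) (x : M)
    (b : Module.Basis (Fin n) ℝ (TangentSpace (𝓡 n) x)) (v : TangentSpace (𝓡 n) x) :
    ∑ k, hess g f x v (b k) • sharp g x (dualCovector b k) =
      hessTangent g f x v := by
  have hb : ∀ w : TangentSpace (𝓡 n) x, bilin g x
      (∑ k, hess g f x v (b k) • sharp g x (dualCovector b k)) w =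
      bilin g x (hessTangent g f x v) w := by
    intro w
    have h1 : hess g f x v w = ∑ k, b.repr w k * hess g f x v (b k) := by
      simp only [← inner_hessTangent g hf]
      conv_lhs => rw [← b.sum_repr w, map_sum]
      simp only [map_smul, smul_eq_mul]
    rw [map_sum, LinearMap.sum_apply, bilin_apply, inner_hessTangent g hf, h1]
    refine Finset.sum_congr rfl fun k _ => ?_
    rw [map_smul, LinearMap.smul_apply, bilin_apply, inner_sharp, smul_eq_mul, mul_comm]
    rfl
  rw [← sub_eq_zero]
  refine (bilin_nondegenerate g x).1 _ fun w => ?_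
  rw [map_sub, LinearMap.sub_apply, hb, sub_self]

end Pointwise

/-! ### The Bochner formula -/

section Bochner

variable {n : ℕ} {M : Type*} [TopologicalSpace M] [ChartedSpace (EuclideanSpace ℝ (Fin n)) M]
  [IsManifold (𝓡 n) ∞ M] [MeasurableSpace M] [BorelSpace M] [T2Space M] [CompactSpace M]
  (g : RMetric n M) {f : M → ℝ} (hf : ContMDiff (𝓡 n) 𝓘(ℝ, ℝ) ∞ f)
include hf

/-- The `t` terms are by definition `L + L^*`. In the `t²` term, anticommutation of `df∧` and
`ι_{∇f}` leaves multiplication by `df(∇f) = |df|²`. In degree zero the summands beginning with an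
interior product are absent. -/
theorem wittenLaplacian_eq_lieGrad (t : ℝ) : ∀ {q : ℕ} {η : DiffForm n M q}, IsSmoothForm η →
    wittenLaplacian g f t η = hodgeLaplacian g η + t • (lieGrad g f η + lieGradAdj g f η) +
      fun x => (t ^ 2 * cometric g x (mvfderiv (𝓡 n) f x) (mvfderiv (𝓡 n) f x)) • η x
  | 0, η, hη => by
    have hw := hη.wedge_mvfderiv hf
    have hcm : ∀ x, cometric g x (mvfderiv (𝓡 n) f x) (mvfderiv (𝓡 n) f x) =
        mvfderiv (𝓡 n) f x (gradient g f x) := fun x => inner_sharp g x _ _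
    rw [wittenLaplacian, wittenD_eq hf t hη, wittenCodiff_eq g hf t (hη.extD.add (hw.const_smul t)),
      codiff_add g hη.extD (hw.const_smul t), codiff_smul g hw]
    funext x
    simp only [hodgeLaplacian, lieGrad, lieGradAdj, Pi.add_apply, Pi.smul_apply, interior_add,
      interior_smul, interior_wedge_zero, hcm]
    module
  | q + 1, η, hη => by
    have hw := hη.wedge_mvfderiv hf
    have hi := hη.interior_gradient g hf
    have hc := (isAdjointValue_codiff g hη).1
    have hcm : ∀ x, cometric g x (mvfderiv (𝓡 n) f x) (mvfderiv (𝓡 n) f x) =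
        mvfderiv (𝓡 n) f x (gradient g f x) := fun x => inner_sharp g x _ _
    rw [wittenLaplacian, wittenD_eq hf t hη, wittenCodiff_eq g hf t (hη.extD.add (hw.const_smul t)),
      codiff_add g hη.extD (hw.const_smul t), codiff_smul g hw, wittenCodiff_eq g hf t hη,
      wittenD_eq hf t (hc.add (hi.const_smul t)), extD_add hc (hi.const_smul t),
      extD_const_smul hi]
    funext x
    simp only [hodgeLaplacian, lieGrad, lieGradAdj, Pi.add_apply, Pi.smul_apply, interior_add,
      interior_smul, interior_wedge, wedge_add, wedge_smul, hcm]
    module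

/-- The chart formula is read at `x` in the preferred chart, where local expressions are the forms
themselves. Writing `2 A· - tr A` in the basis `b` and expanding `A b_l` as `∑ k, Hess_f(b_l, b_k)
(b^k)♯` gives the double sum. -/
theorem lieGrad_add_lieGradAdj_apply {q : ℕ} {η : DiffForm n M q} (hη : IsSmoothForm η) (x : M)
    (b : Module.Basis (Fin n) ℝ (TangentSpace (𝓡 n) x)) :
    lieGrad g f η x + lieGradAdj g f η x = ∑ k, ∑ l, hess g f x (b l) (b k) •
      commWedgeInterior (dualCovector b l) (sharp g x (dualCovector b k)) (η x) := by
  have h := localForm_lieGrad_add_lieGradAdj g hf (mem_extChartAt_target (I := 𝓡 n) x) hη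
  rw [localForm_self, localForm_self, localForm_self] at h
  have h1 := sum_commWedgeInterior (E := EuclideanSpace ℝ (Fin n))
    (hessEndo g f x (extChartAt (𝓡 n) x x)) b (dualCovector b) (fun k v => rfl) (η x)
  refine h.trans (h1.symm.trans ?_)
  rw [Finset.sum_comm]
  refine Finset.sum_congr rfl fun l _ => ?_
  have h2 := commWedgeInterior_sum (E := EuclideanSpace ℝ (Fin n)) Finset.univ (dualCovector b l)
    (fun k => sharp g x (dualCovector b k)) (fun k => hess g f x (b l) (b k)) (η x)
  refine Eq.trans ?_ h2.symm
  congr 1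
  exact (sum_hess_smul_sharp g hf x b (b l)).symm

end Bochner

end Witten
end

theorem mainTheorem7 {n : ℕ} {M : Type*} [TopologicalSpace M] [T2Space M] [CompactSpace M]
    [ChartedSpace (EuclideanSpace ℝ (Fin n)) M] [IsManifold (𝓡 n) ∞ M]
    [MeasurableSpace M] [BorelSpace M]
    (g : Witten.RMetric n M) (f : M → ℝ) (hf : ContMDiff (𝓡 n) 𝓘(ℝ, ℝ) ∞ f) (t : ℝ) :
    (∀ q : ℕ, Witten.IsFormalAdjoint g (q := q) Witten.extD (Witten.codiff g)) ∧
    (∀ q : ℕ, Witten.IsFormalAdjoint g (q := q) (Witten.wittenD f t)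
      (Witten.wittenCodiff g f t)) ∧
    (∀ (q : ℕ) (u : Witten.DiffForm n M q), Witten.IsSmoothForm u → ∀ x : M,
      Witten.wittenD f t u x =
        Witten.extD u x + t • Witten.wedge (mvfderiv (𝓡 n) f x) (u x)) ∧
    (∀ (q : ℕ) (v : Witten.DiffForm n M (q + 1)), Witten.IsSmoothForm v → ∀ x : M,
      Witten.wittenCodiff g f t v x =
        Witten.codiff g v x +
          t • Witten.interior (Witten.sharp g x (mvfderiv (𝓡 n) f x)) (v x)) ∧
    (∀ (q : ℕ) (η : Witten.DiffForm n M q), Witten.IsSmoothForm η →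
      ∀ (x : M) (b : Module.Basis (Fin n) ℝ (TangentSpace (𝓡 n) x)),
        Witten.wittenLaplacian g f t η x =
          Witten.hodgeLaplacian g η x +
          (t ^ 2 * Witten.cometric g x (mvfderiv (𝓡 n) f x) (mvfderiv (𝓡 n) f x)) • η x +
          t • ∑ k, ∑ l, Witten.hess g f x (b l) (b k) •
            Witten.commWedgeInterior (Witten.dualCovector b l)
              (Witten.sharp g x (Witten.dualCovector b k)) (η x)) := by
  refine ⟨fun q v hv => Witten.isAdjointValue_codiff g hv, fun q v hv => ?_, fun q u hu x => ?_,
    fun q v hv x => ?_, fun q η hη x b => ?_⟩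
  · rw [Witten.wittenCodiff_eq g hf t hv]
    exact Witten.isAdjointValue_wittenD g hf t hv
  · rw [Witten.wittenD_eq hf t hu]
    rfl
  · rw [Witten.wittenCodiff_eq g hf t hv]
    rfl
  · rw [Witten.wittenLaplacian_eq_lieGrad g hf t hη,
      ← Witten.lieGrad_add_lieGradAdj_apply g hf hη x b]
    simp only [Pi.add_apply, Pi.smul_apply]
    exact add_right_comm _ _ _
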